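/- Consider the class of generalized Burgers equations $\mathcal L_f$: $u_t+uu_x+f(t,x)u_{xx}=0$, where $f$ is a smooth nowhere vanishing function on an open domain of the $(t,x)$-plane. A regular reduction operator of $\mathcal L_f$ is a smooth vector field $Q=\tau\partial_t+\xi\partial_x+\eta\partial_u$ on an open domain of the $(t,x,u)$-space, with $\tau\neq0$ everywhere, that satisfies the conditional invariance criterion: $Q_{(2)}(u_t+uu_x+fu_{xx})=0$ at all points of the second-order jet space over the domain where $u_t+uu_x+fu_{xx}=0$, $Q[u]:=\eta-\tau u_t-\xi u_x=0$, ${\rm D}_tQ[u]=0$ and ${\rm D}_xQ[u]=0$ (here $Q_{(2)}$ is the second prolongation of $Q$ and ${\rm D}_t$, ${\rm D}_x$ are the total derivatives). It is a Lie symmetry operator if $Q_{(2)}(u_t+uu_x+fu_{xx})=0$ already wherever $u_t+uu_x+fu_{xx}=0$. Let $G^\sim$ be the equivalence (pseudo)group of the class, which consists of the transformations $$\tilde t=\frac{\alpha t+\beta}{\gamma t+\delta},\quad \tilde x=\frac{\kappa x+\mu_1t+\mu_0}{\gamma t+\delta},\quad \tilde u=\frac{\kappa(\gamma t+\delta)u-\kappa\gamma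 x+\mu_1\delta-\mu_0\gamma}{\alpha\delta-\beta\gamma},\quad \tilde f=\frac{\kappa^2}{\alpha\delta-\beta\gamma}f$$ with constants such that $\alpha\delta-\beta\gamma\ne0$ and $\kappa\neq0$; each of them maps any equation $\mathcal L_f$ to the equation $\mathcal L_{\tilde f}$ of the same class. Pairs ($\mathcal L_f$, $Q$) are considered up to the action of $G^\sim$ and up to multiplication of $Q$ by smooth nonvanishing functions of $(t,x,u)$, and locally. Theorem. All the following vector fields are regular reduction operators of the indicated equations, and, in a neighbourhood of each point of its domain, any regular reduction operator of any equation of the class is $G^\sim$-equivalent to one of them: 1. $Q^1=\partial_t+u\partial_x$ for any equation $\mathcal L_f$ of the class; 2. Lie symmetry operators of $\mathcal L_f$ with nonvanishing coefficient of $\partial_t$; 3. $Q^\theta=\partial_t-(\theta_t/\theta_x)\partial_x$ for the equation $\mathcal L_{f^\theta}$ with $f^\theta=-1/\theta_x$, where $\theta=\theta(t,x)$ is a smooth solution, with $\theta_x\ne0$, of the equation $\theta_t=\theta_{xx}/\theta_x+h(\theta)\theta_x$ and $h$ is a smooth function of $\theta$; 4. only for the classical Burgers equation $\mathcal L_1$: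 $u_t+uu_x+u_{xx}=0$, the operators $\partial_t+\big(-\frac12u+\xi^0\big)\partial_x+\big(\frac14u^3-\frac12\xi^0u^2+\eta^1u+\eta^0\big)\partial_u$ with $$\xi^0=\frac12\frac{|\bar e,\bar u,\bar z|}{|\bar e,\bar u,\bar y|},\qquad \eta^1=\frac14\frac{|\bar e,\bar y,\bar z|}{|\bar e,\bar u,\bar y|},\qquad \eta^0=-\frac14\frac{|\bar u,\bar y,\bar z|}{|\bar e,\bar u,\bar y|},$$ where $|\bar a,\bar b,\bar c|$ is the determinant of the $3\times3$ matrix with columns $\bar a$, $\bar b$, $\bar c$, $\bar e=(1,1,1)^{\rm T}$, $\bar u=(u^1,u^2,u^3)^{\rm T}$ is a triple of smooth solutions of $\mathcal L_1$ with $|\bar e,\bar u,\bar y|\neq0$ everywhere, $y^i=2u^i_x+(u^i)^2$ and $z^i=4u^i_{xx}+6u^iu^i_x+(u^i)^3$. Moreover, if a vector field of the form $\partial_t+\big(-\frac12u+\xi^0\big)\partial_x+\big(\frac14u^3-\frac12\xi^0u^2+\eta^1u+\eta^0\big)\partial_u$ with functions $\xi^0$, $\eta^1$, $\eta^0$ of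 $(t,x)$ is a regular reduction operator of $\mathcal L_f$, then $f=1$ on the projection of its domain to the $(t,x)$-plane; and any nonzero constant value of $f$ can be set to $1$ by a transformation from $G^\sim$. -/

import Mathlib

open scoped ContDiff

noncomputable section

namespace GBE

/-- The space of the independent variables `(t, x)`. -/
abbrev Plane := ℝ × ℝ

/-- The space of the variables `(t, x, u)`. -/
abbrev Space := ℝ × ℝ × ℝ

/-- The projection of a set in the `(t, x, u)`-space to the `(t, x)`-plane. -/
def base (U : Set Space) : Set Plane := (fun P : Space => (P.1, P.2.1)) '' U

/-! ### Partial derivatives -/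

/-- The partial derivative with respect to `t` of a function of `(t, x)`. -/
def dt (a : Plane → ℝ) (p : Plane) : ℝ := fderiv ℝ a p (1, 0)

/-- The partial derivative with respect to `x` of a function of `(t, x)`. -/
def dx (a : Plane → ℝ) (p : Plane) : ℝ := fderiv ℝ a p (0, 1)

/-- The partial derivative with respect to `t` of a function of `(t, x, u)`. -/
def pt (a : Space → ℝ) (P : Space) : ℝ := fderiv ℝ a P (1, 0, 0)

/-- The partial derivative with respect to `x` of a function of `(t, x, u)`. -/
def px (a : Space → ℝ) (P : Space) : ℝ := fderiv ℝ a P (0, 1, 0)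

/-- The partial derivative with respect to `u` of a function of `(t, x, u)`. -/
def pu (a : Space → ℝ) (P : Space) : ℝ := fderiv ℝ a P (0, 0, 1)

/-! ### The second-order jet space and the class of equations -/

/-- A point of the second-order jet space with the coordinates
`(t, x, u, u_t, u_x, u_tt, u_tx, u_xx)`. -/
structure Jet where
  t : ℝ
  x : ℝ
  u : ℝ
  ut : ℝ
  ux : ℝ
  utt : ℝ
  utx : ℝ
  uxx : ℝ

/-- The point of the `(t, x)`-plane under a jet. -/
def Jet.plane (j : Jet) : Plane := (j.t, j.x)

/-- The point of the `(t, x, u)`-space under a jet. -/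
def Jet.space (j : Jet) : Space := (j.t, j.x, j.u)

/-- The second-order jet of the function `u` at the point `p`. -/
def jetOf (u : Plane → ℝ) (p : Plane) : Jet :=
  ⟨p.1, p.2, u p, dt u p, dx u p, dt (dt u) p, dx (dt u) p, dx (dx u) p⟩

/-- Arbitrary elements of the class over the domain `D`: smooth nonvanishing functions of `(t, x)`. -/
def InClass (f : Plane → ℝ) (D : Set Plane) : Prop :=
  ContDiffOn ℝ ∞ f D ∧ ∀ p ∈ D, f p ≠ 0

/-- The left-hand side `u_t + u u_x + f(t, x) u_xx` of the equation `L_f` on the jet space. -/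
def lhs (f : Plane → ℝ) (j : Jet) : ℝ := j.ut + j.u * j.ux + f j.plane * j.uxx

/-- `u` is a (smooth) solution of the equation `L_f` on `D`. -/
def IsSolution (f : Plane → ℝ) (u : Plane → ℝ) (D : Set Plane) : Prop :=
  ContDiffOn ℝ ∞ u D ∧ ∀ p ∈ D, lhs f (jetOf u p) = 0

/-! ### Vector fields and their prolongations -/

/-- A vector field `τ ∂_t + ξ ∂_x + η ∂_u` in the `(t, x, u)`-space. -/
structure VField where
  τ : Space → ℝ
  ξ : Space → ℝ
  η : Space → ℝ

/-- The value of a vector field at a point, as a tangent vector. -/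
def VField.vec (Q : VField) (P : Space) : Space := (Q.τ P, Q.ξ P, Q.η P)

/-- Smoothness of a vector field on `U`. -/
def VField.SmoothOn (Q : VField) (U : Set Space) : Prop :=
  ContDiffOn ℝ ∞ Q.τ U ∧ ContDiffOn ℝ ∞ Q.ξ U ∧ ContDiffOn ℝ ∞ Q.η U

/-- The total derivative `D_t a` of a function `a = a(t, x, u)`. -/
def totT (a : Space → ℝ) (j : Jet) : ℝ := pt a j.space + j.ut * pu a j.space

/-- The total derivative `D_x a` of a function `a = a(t, x, u)`. -/
def totX (a : Space → ℝ) (j : Jet) : ℝ := px a j.space + j.ux * pu a j.space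

/-- The second total derivative `D_x ^ 2 a` of a function `a = a(t, x, u)`. -/
def totXX (a : Space → ℝ) (j : Jet) : ℝ :=
  px (px a) j.space + 2 * j.ux * pu (px a) j.space + j.ux ^ 2 * pu (pu a) j.space
    + j.uxx * pu a j.space

/-- The component `η^t` of the prolongation of `Q`. -/
def VField.etaT (Q : VField) (j : Jet) : ℝ :=
  totT Q.η j - j.ut * totT Q.τ j - j.ux * totT Q.ξ j

/-- The component `η^x` of the prolongation of `Q`. -/
def VField.etaX (Q : VField) (j : Jet) : ℝ :=
  totX Q.η j - j.ut * totX Q.τ j - j.ux * totX Q.ξ j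

/-- The component `η^xx` of the second prolongation of `Q`. -/
def VField.etaXX (Q : VField) (j : Jet) : ℝ :=
  totXX Q.η j - j.ut * totXX Q.τ j - 2 * j.utx * totX Q.τ j
    - j.ux * totXX Q.ξ j - 2 * j.uxx * totX Q.ξ j

/-- The second prolongation of `Q` applied to `u_t + u u_x + f u_xx`. -/
def prolongLhs (f : Plane → ℝ) (Q : VField) (j : Jet) : ℝ :=
  Q.etaT j + Q.η j.space * j.ux + j.u * Q.etaX j
    + (Q.τ j.space * dt f j.plane + Q.ξ j.space * dx f j.plane) * j.uxx
    + f j.plane * Q.etaXX j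

/-- The manifold in the second-order jet space defined by the invariant surface condition
`Q[u] := η - τ u_t - ξ u_x = 0` and its differential consequences `D_t Q[u] = 0`, `D_x Q[u] = 0`. -/
def VField.OnInvariantSurface (Q : VField) (j : Jet) : Prop :=
  Q.η j.space - Q.τ j.space * j.ut - Q.ξ j.space * j.ux = 0 ∧
  Q.etaT j - Q.τ j.space * j.utt - Q.ξ j.space * j.utx = 0 ∧
  Q.etaX j - Q.τ j.space * j.utx - Q.ξ j.space * j.uxx = 0

/-- `Q` is a regular reduction operator (a nonclassical symmetry with nonvanishing
`∂_t`-component) of the equation `L_f` over the domain `U` of the `(t, x, u)`-space: the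
conditional invariance criterion holds. -/
def IsRegularReductionOperator (f : Plane → ℝ) (Q : VField) (U : Set Space) : Prop :=
  Q.SmoothOn U ∧ (∀ P ∈ U, Q.τ P ≠ 0) ∧
  ∀ j : Jet, j.space ∈ U → lhs f j = 0 → Q.OnInvariantSurface j → prolongLhs f Q j = 0

/-- `Q` is a Lie symmetry operator of the equation `L_f` over the domain `U`: the infinitesimal
invariance criterion holds. -/
def IsLieSymmetryOperator (f : Plane → ℝ) (Q : VField) (U : Set Space) : Prop :=
  Q.SmoothOn U ∧ ∀ j : Jet, j.space ∈ U → lhs f j = 0 → prolongLhs f Q j = 0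

/-! ### The equivalence group -/

/-- The parameters of a transformation from the usual equivalence group of the class. -/
structure EquivTransf where
  α : ℝ
  β : ℝ
  γ : ℝ
  δ : ℝ
  κ : ℝ
  μ₀ : ℝ
  μ₁ : ℝ
  det_ne : α * δ - β * γ ≠ 0
  κ_ne : κ ≠ 0

namespace EquivTransf

/-- The transformation is defined at the points with `γ t + δ ≠ 0`. -/
def denom (g : EquivTransf) (t : ℝ) : ℝ := g.γ * t + g.δ

/-- The `(t, x)`-components of the transformation. -/
def planeMap (g : EquivTransf) (p : Plane) : Plane :=
  ((g.α * p.1 + g.β) / g.denom p.1, (g.κ * p.2 + g.μ₁ * p.1 + g.μ₀) / g.denom p.1)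

/-- The `u`-component of the transformation. -/
def uMap (g : EquivTransf) (P : Space) : ℝ :=
  (g.κ * g.denom P.1 * P.2.2 - g.κ * g.γ * P.2.1 + g.μ₁ * g.δ - g.μ₀ * g.γ)
    / (g.α * g.δ - g.β * g.γ)

/-- The transformation of the `(t, x, u)`-space. -/
def map (g : EquivTransf) (P : Space) : Space :=
  ((g.planeMap (P.1, P.2.1)).1, (g.planeMap (P.1, P.2.1)).2, g.uMap P)

/-- The multiplier in the transformation of the arbitrary element,
`f̃ = κ ^ 2 / (α δ - β γ) f`. -/
def factor (g : EquivTransf) : ℝ := g.κ ^ 2 / (g.α * g.δ - g.β * g.γ)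

/-- The transformation maps each equation `L_f` to the equation `L_f'` of the same class, where
`f' = factor * f` in the new variables: if the graph of `u` is mapped into the graph of `u'`, then
`u` satisfies `L_f` at a point if and only if `u'` satisfies `L_f'` at the image of the point. -/
def PreservesClass (g : EquivTransf) : Prop :=
  ∀ (D D' : Set Plane) (f f' u u' : Plane → ℝ), IsOpen D → IsOpen D' →
    (∀ p ∈ D, g.denom p.1 ≠ 0) → Set.MapsTo g.planeMap D D' →
    InClass f D → (∀ p ∈ D, f' (g.planeMap p) = g.factor * f p) →
    ContDiffOn ℝ ∞ u D → ContDiffOn ℝ ∞ u' D' →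
    (∀ p ∈ D, u' (g.planeMap p) = g.uMap (p.1, p.2, u p)) →
    ∀ p ∈ D, lhs f (jetOf u p) = 0 ↔ lhs f' (jetOf u' (g.planeMap p)) = 0

/-- The transformation `g` is defined on `U`, maps `U` into `U'`, maps `L_f` to `L_f'`, and pushes
the vector field `Q` forward to `Q'` up to a smooth nonvanishing multiplier. -/
def Carries (g : EquivTransf) (f : Plane → ℝ) (Q : VField) (U : Set Space)
    (f' : Plane → ℝ) (Q' : VField) (U' : Set Space) : Prop :=
  (∀ P ∈ U, g.denom P.1 ≠ 0) ∧ Set.MapsTo g.map U U' ∧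
  (∀ p ∈ base U, f' (g.planeMap p) = g.factor * f p) ∧
  ∃ m : Space → ℝ, ContDiffOn ℝ ∞ m U ∧
    ∀ P ∈ U, m P ≠ 0 ∧ fderiv ℝ g.map P (Q.vec P) = m P • Q'.vec (g.map P)

end EquivTransf

/-! ### The four families -/

/-- The operator `∂_t + u ∂_x`. -/
def IsCommonOperator (Q : VField) (U : Set Space) : Prop :=
  ∀ P ∈ U, Q.τ P = 1 ∧ Q.ξ P = P.2.2 ∧ Q.η P = 0

/-- The operator `∂_t - (θ_t / θ_x) ∂_x` for the equation with `f = -1 / θ_x`, where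
`θ_t = θ_xx / θ_x + h(θ) θ_x`. -/
def IsThetaOperator (f : Plane → ℝ) (Q : VField) (U : Set Space) : Prop :=
  ∃ (θ : Plane → ℝ) (I : Set ℝ) (h : ℝ → ℝ),
    ContDiffOn ℝ ∞ θ (base U) ∧ IsOpen I ∧ ContDiffOn ℝ ∞ h I ∧
    (∀ p ∈ base U, dx θ p ≠ 0 ∧ θ p ∈ I ∧
      dt θ p = dx (dx θ) p / dx θ p + h (θ p) * dx θ p ∧ f p = -1 / dx θ p) ∧
    ∀ P ∈ U, Q.τ P = 1 ∧ Q.ξ P = -(dt θ (P.1, P.2.1) / dx θ (P.1, P.2.1)) ∧ Q.η P = 0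

/-- The operator
`∂_t + (-u/2 + ξ⁰) ∂_x + (u^3/4 - ξ⁰ u^2/2 + η¹ u + η⁰) ∂_u` with functions `ξ⁰, η¹, η⁰` of
`(t, x)`. -/
def cubicOperator (ξ0 η1 η0 : Plane → ℝ) : VField where
  τ := fun _ => 1
  ξ := fun P => -(1 / 2) * P.2.2 + ξ0 (P.1, P.2.1)
  η := fun P => (1 / 4) * P.2.2 ^ 3 - (1 / 2) * ξ0 (P.1, P.2.1) * P.2.2 ^ 2
    + η1 (P.1, P.2.1) * P.2.2 + η0 (P.1, P.2.1)

/-- The determinant of the matrix with the columns `a`, `b`, `c`. -/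
def det3 (a b c : Fin 3 → ℝ) : ℝ := (Matrix.of fun i => ![a i, b i, c i]).det

/-- `y = 2 u_x + u^2`. -/
def yOf (u : Plane → ℝ) (p : Plane) : ℝ := 2 * dx u p + u p ^ 2

/-- `z = 4 u_xx + 6 u u_x + u^3`. -/
def zOf (u : Plane → ℝ) (p : Plane) : ℝ := 4 * dx (dx u) p + 6 * u p * dx u p + u p ^ 3

/-- The determinant with the rows `(1, u^i, y^i)`. -/
def denDet (u : Fin 3 → Plane → ℝ) (p : Plane) : ℝ :=
  det3 (fun _ => 1) (fun i => u i p) (fun i => yOf (u i) p)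

def xi0Of (u : Fin 3 → Plane → ℝ) (p : Plane) : ℝ :=
  (1 / 2) * (det3 (fun _ => 1) (fun i => u i p) (fun i => zOf (u i) p) / denDet u p)

def eta1Of (u : Fin 3 → Plane → ℝ) (p : Plane) : ℝ :=
  (1 / 4) * (det3 (fun _ => 1) (fun i => yOf (u i) p) (fun i => zOf (u i) p) / denDet u p)

def eta0Of (u : Fin 3 → Plane → ℝ) (p : Plane) : ℝ :=
  -(1 / 4) * (det3 (fun i => u i p) (fun i => yOf (u i) p) (fun i => zOf (u i) p) / denDet u p)

/-- The cubic operator with the coefficients built from three solutions of the classical Burgers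
equation `u_t + u u_x + u_xx = 0`, considered for this equation, `f = 1`. -/
def IsBurgersOperator (f : Plane → ℝ) (Q : VField) (U : Set Space) : Prop :=
  (∀ p ∈ base U, f p = 1) ∧
  ∃ u : Fin 3 → Plane → ℝ,
    (∀ i, IsSolution (fun _ => 1) (u i) (base U)) ∧ (∀ p ∈ base U, denDet u p ≠ 0) ∧
    ∀ P ∈ U, Q.vec P = (cubicOperator (xi0Of u) (eta1Of u) (eta0Of u)).vec P

/-- The pair (equation `L_f`, operator `Q`), considered over `U`, belongs to one of the four
families. -/
def IsListed (f : Plane → ℝ) (Q : VField) (U : Set Space) : Prop :=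
  IsCommonOperator Q U ∨
  (IsLieSymmetryOperator f Q U ∧ ∀ P ∈ U, Q.τ P ≠ 0) ∨
  IsThetaOperator f Q U ∨
  IsBurgersOperator f Q U

end GBE

end

/-!
Division by the coefficient of `∂_t` reduces the conditional invariance criterion to operators
`∂_t + ξ ∂_x + η ∂_u`. On the jets to be tested, `u_t`, `u_xx`, `u_tx` and `u_tt` are determined by
`t`, `x`, `u`, `u_x`, and the criterion is a cubic polynomial in `u_x`; its coefficients are the
determining equations (`criterion_iff`). They imply `ξ_uu = 0` and `ξ_u (1 - ξ_u) (1 + 2 ξ_u) = 0`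
(`Determining.slope`), so that near each point `ξ_u` is one of the constants `1`, `-1/2`, `0`.

* If `ξ_u = 1`, then `ξ = u` and `η = 0`.
* If `ξ_u = -1/2`, then `f` is a constant, which can be scaled to `1`, and `η` is cubic in `u`. The
  equations for the three coefficients are the condition that the connection of the system
  `ψ_t = -ψ_xx`, `ψ_xxx = ξ⁰ ψ_xx - η¹ ψ_x - η⁰ ψ / 2` is flat. Three of its solutions, which exist
  by the Frobenius theorem for linear systems (`exists_parallel`), are turned by the Hopf–Cole
  substitution `u = 2 ψ_x / ψ` into solutions of the Burgers equation, and Cramer's rule recovers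
  the coefficients (`CubicSystem.exists_solutions`). Conversely, `u`, `y`, `z` are `2 ψ_x / ψ`,
  `4 ψ_xx / ψ`, `8 ψ_xxx / ψ`, and differentiation of the linear relation between them yields the
  equations for its coefficients (`burgers_system`).
* If `ξ_u = 0`, then `η = a (u - ξ) + w` with `a` depending on `t` only and `w` affine in `x`, where
  `w` satisfies a linear homogeneous equation. If `w` and `w_x` vanish at a point, then `w` vanishes
  near it. Then `a_t = a ^ 2`, and the projective transformation of `t` that straightens this
  Riccati equation makes `η = 0`. The remaining equations say that the form `(ξ dt - dx) / f` is
  closed, so that it is `dθ` for some `θ`, and that `ξ + f_x` has a gradient parallel to that of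
  `θ`, hence is a function `-h(θ)` (`exists_theta`). If `w` or `w_x` does not vanish, then
  `ξ_xx = 0`, because `w w_x ξ_xx ≠ 0` contradicts the compatibility conditions of the system
  (`AffineSystem.false_of_isUnit`), and the operator multiplied by a solution `m = m(t)` of
  `m_t = (ξ_x - a) m` is a Lie symmetry operator (`lie_of_multiplier`).

The computations take place in the algebra `smoothAlg D` of smooth functions on an open set with its
commuting derivations, where they are identities of commutative algebra.
-/

namespace GBE

open TopologicalSpace Metric Set

/-! ### The differential algebra of smooth functions on an open set -/

section SmoothAlgebra

variable {E F : Type*} [NormedAddCommGroup E] [NormedSpace ℝ E]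
  [NormedAddCommGroup F] [NormedSpace ℝ F]

/-- The subalgebra of smooth functions among all real functions on the subtype `D`. -/
def smoothSubalgebra (D : Opens E) : Subalgebra ℝ (D → ℝ) where
  carrier := {a | ∃ b : E → ℝ, ContDiffOn ℝ ∞ b D ∧ ∀ p : D, a p = b p}
  mul_mem' := by
    rintro _ _ ⟨a, ha, h⟩ ⟨b, hb, h'⟩
    exact ⟨fun p => a p * b p, ha.mul hb, fun p => by simp [h, h']⟩
  add_mem' := by
    rintro _ _ ⟨a, ha, h⟩ ⟨b, hb, h'⟩
    exact ⟨fun p => a p + b p, ha.add hb, fun p => by simp [h, h']⟩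
  algebraMap_mem' c := ⟨fun _ => c, contDiffOn_const, fun p => by simp⟩

/-- The algebra of smooth real functions on the open set `D`, as functions on the subtype `D`, so
that two elements are equal as soon as they agree on `D`. -/
def smoothAlg (D : Opens E) : Type _ := smoothSubalgebra D

instance (D : Opens E) : CommRing (smoothAlg D) := inferInstanceAs (CommRing (smoothSubalgebra D))

instance (D : Opens E) : Algebra ℝ (smoothAlg D) :=
  inferInstanceAs (Algebra ℝ (smoothSubalgebra D))

variable {D : Opens E} {D' : Opens F}

/-- The element of the algebra given by a function that is smooth on `D`. -/
def sm (a : E → ℝ) (ha : ContDiffOn ℝ ∞ a D) : smoothAlg D :=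
  (⟨fun p => a p, a, ha, fun _ => rfl⟩ : smoothSubalgebra D)

/-- The value of a smooth function at a point of `D`. -/
def val (a : smoothAlg D) (p : E) (hp : p ∈ D) : ℝ := a.1 ⟨p, hp⟩

theorem smoothAlg_ext {a b : smoothAlg D} (h : ∀ p hp, val a p hp = val b p hp) : a = b :=
  Subtype.ext (funext fun p => h p.1 p.2)

@[simp] theorem val_sm (a : E → ℝ) (ha : ContDiffOn ℝ ∞ a D) (p : E) (hp : p ∈ D) :
    val (sm a ha) p hp = a p := rfl
@[simp] theorem val_add (a b : smoothAlg D) (p : E) (hp : p ∈ D) :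
    val (a + b) p hp = val a p hp + val b p hp := rfl
@[simp] theorem val_sub (a b : smoothAlg D) (p : E) (hp : p ∈ D) :
    val (a - b) p hp = val a p hp - val b p hp := rfl
@[simp] theorem val_neg (a : smoothAlg D) (p : E) (hp : p ∈ D) :
    val (-a) p hp = -val a p hp := rfl
@[simp] theorem val_mul (a b : smoothAlg D) (p : E) (hp : p ∈ D) :
    val (a * b) p hp = val a p hp * val b p hp := rfl
@[simp] theorem val_pow (a : smoothAlg D) (n : ℕ) (p : E) (hp : p ∈ D) :
    val (a ^ n) p hp = val a p hp ^ n := rfl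
@[simp] theorem val_zero (p : E) (hp : p ∈ D) : val (0 : smoothAlg D) p hp = 0 := rfl
@[simp] theorem val_one (p : E) (hp : p ∈ D) : val (1 : smoothAlg D) p hp = 1 := rfl
@[simp] theorem val_ofNat (n : ℕ) [n.AtLeastTwo] (p : E) (hp : p ∈ D) :
    val (ofNat(n) : smoothAlg D) p hp = ofNat(n) := rfl
@[simp] theorem val_smul (c : ℝ) (a : smoothAlg D) (p : E) (hp : p ∈ D) :
    val (c • a) p hp = c * val a p hp := rfl
@[simp] theorem val_algebraMap (c : ℝ) (p : E) (hp : p ∈ D) :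
    val (algebraMap ℝ (smoothAlg D) c) p hp = c := rfl

theorem sm_congr {a b : E → ℝ} (ha : ContDiffOn ℝ ∞ a D) (hb : ContDiffOn ℝ ∞ b D) :
    sm a ha = sm b hb ↔ ∀ p ∈ D, a p = b p :=
  ⟨fun h p hp => by simpa using congrArg (fun c => val c p hp) h,
    fun h => smoothAlg_ext fun p hp => by simpa using h p hp⟩

theorem exists_sm (a : smoothAlg D) : ∃ (b : E → ℝ) (hb : ContDiffOn ℝ ∞ b D), a = sm b hb :=
  ⟨a.2.choose, a.2.choose_spec.1, smoothAlg_ext fun p hp => a.2.choose_spec.2 ⟨p, hp⟩⟩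

theorem sm_add {a b : E → ℝ} (ha : ContDiffOn ℝ ∞ a D) (hb : ContDiffOn ℝ ∞ b D) :
    sm a ha + sm b hb = sm (fun p => a p + b p) (ha.add hb) := rfl

theorem sm_mul {a b : E → ℝ} (ha : ContDiffOn ℝ ∞ a D) (hb : ContDiffOn ℝ ∞ b D) :
    sm a ha * sm b hb = sm (fun p => a p * b p) (ha.mul hb) := rfl

theorem differentiableAt_of_smooth {a : E → ℝ} (ha : ContDiffOn ℝ ∞ a D) {p : E} (hp : p ∈ D) :
    DifferentiableAt ℝ a p :=
  (ha.contDiffAt (D.isOpen.mem_nhds hp)).differentiableAt (by simp)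

theorem fderiv_congr_open {a b : E → ℝ} (h : ∀ p ∈ D, a p = b p) {p : E} (hp : p ∈ D) :
    fderiv ℝ a p = fderiv ℝ b p :=
  Filter.EventuallyEq.fderiv_eq (Filter.eventuallyEq_of_mem (D.isOpen.mem_nhds hp) h)

theorem contDiffOn_fderiv_apply {a : E → ℝ} (ha : ContDiffOn ℝ ∞ a D) (v : E) :
    ContDiffOn ℝ ∞ (fun p => fderiv ℝ a p v) D :=
  (ha.fderiv_of_isOpen D.isOpen (by simp)).clm_apply contDiffOn_const

/-- The derivative in the direction `v` of an element of the algebra, computed on an arbitrary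
smooth extension of it. -/
noncomputable def dirFun (v : E) (a : smoothAlg D) : smoothAlg D :=
  sm (fun p => fderiv ℝ a.2.choose p v) (contDiffOn_fderiv_apply a.2.choose_spec.1 v)

theorem dirFun_sm (v : E) (a : E → ℝ) (ha : ContDiffOn ℝ ∞ a D) :
    dirFun v (sm a ha) = sm (fun p => fderiv ℝ a p v) (contDiffOn_fderiv_apply ha v) := by
  refine (sm_congr _ _).2 fun p hp => ?_
  rw [fderiv_congr_open (D := D) (b := a) (fun q hq => ?_) hp]
  exact ((sm a ha).2.choose_spec.2 ⟨q, hq⟩).symm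

/-- The derivation of the algebra of smooth functions along the constant vector `v`. -/
noncomputable def dir (v : E) : Derivation ℝ (smoothAlg D) (smoothAlg D) :=
  Derivation.mk'
    { toFun := dirFun v
      map_add' := fun a b => by
        obtain ⟨a, ha, rfl⟩ := exists_sm a
        obtain ⟨b, hb, rfl⟩ := exists_sm b
        rw [sm_add, dirFun_sm, dirFun_sm, dirFun_sm, sm_add, sm_congr]
        intro p hp
        rw [fderiv_fun_add (differentiableAt_of_smooth ha hp) (differentiableAt_of_smooth hb hp)]
        rfl
      map_smul' := fun c a => by
        obtain ⟨a, ha, rfl⟩ := exists_sm a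
        have : c • sm a ha = sm (fun p => c * a p) (contDiffOn_const.mul ha) := rfl
        rw [this, dirFun_sm, dirFun_sm]
        refine smoothAlg_ext fun p hp => ?_
        simp [fderiv_const_mul (differentiableAt_of_smooth ha hp)] }
    (fun a b => by
      obtain ⟨a, ha, rfl⟩ := exists_sm a
      obtain ⟨b, hb, rfl⟩ := exists_sm b
      refine smoothAlg_ext fun p hp => ?_
      simp [sm_mul, dirFun_sm, fderiv_fun_mul (differentiableAt_of_smooth ha hp)
        (differentiableAt_of_smooth hb hp)])

theorem dir_sm (v : E) (a : E → ℝ) (ha : ContDiffOn ℝ ∞ a D) :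
    dir v (sm a ha) = sm (fun p => fderiv ℝ a p v) (contDiffOn_fderiv_apply ha v) :=
  dirFun_sm v a ha

theorem dir_comm (v w : E) (a : smoothAlg D) : dir v (dir w a) = dir w (dir v a) := by
  obtain ⟨a, ha, rfl⟩ := exists_sm a
  rw [dir_sm, dir_sm, dir_sm, dir_sm, sm_congr]
  intro p hp
  have hd : DifferentiableAt ℝ (fderiv ℝ a) p :=
    ((ha.fderiv_of_isOpen D.isOpen (m := ∞) (by simp)).contDiffAt
      (D.isOpen.mem_nhds hp)).differentiableAt (by simp)
  have hs : IsSymmSndFDerivAt ℝ a p :=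
    (ha.contDiffAt (D.isOpen.mem_nhds hp)).isSymmSndFDerivAt
      (by simpa using WithTop.coe_le_coe.2 (le_top : (2 : ℕ∞) ≤ ⊤))
  have h : ∀ v w : E, fderiv ℝ (fun q => fderiv ℝ a q w) p v = fderiv ℝ (fderiv ℝ a) p v w := by
    intro v w
    rw [fderiv_clm_apply hd (differentiableAt_const _)]
    simp
  rw [h, h, hs.eq]

theorem exists_inv (a : smoothAlg D) (h : ∀ p hp, val a p hp ≠ 0) : ∃ b, a * b = 1 := by
  obtain ⟨a, ha, rfl⟩ := exists_sm a
  refine ⟨sm (fun p => (a p)⁻¹) (ha.inv h), smoothAlg_ext fun p hp => ?_⟩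
  simpa using mul_inv_cancel₀ (h p hp)

/-- The pullback of smooth functions along a smooth map. -/
def pull (φ : E → F) (hφ : ContDiffOn ℝ ∞ φ D) (h : Set.MapsTo φ D D') :
    smoothAlg D' →ₐ[ℝ] smoothAlg D where
  toFun a := (⟨fun p => a.1 ⟨φ p, h p.2⟩, by
    obtain ⟨a, b, hb, hab⟩ := a
    exact ⟨b ∘ φ, hb.comp hφ h, fun p => hab _⟩⟩ : smoothSubalgebra D)
  map_one' := rfl
  map_mul' _ _ := rfl
  map_zero' := rfl
  map_add' _ _ := rfl
  commutes' _ := rfl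

theorem pull_sm (φ : E → F) (hφ : ContDiffOn ℝ ∞ φ D) (h : Set.MapsTo φ D D')
    (a : F → ℝ) (ha : ContDiffOn ℝ ∞ a D') :
    pull φ hφ h (sm a ha) = sm (fun p => a (φ p)) (ha.comp hφ h) := rfl

@[simp] theorem val_pull (φ : E → F) (hφ : ContDiffOn ℝ ∞ φ D) (h : Set.MapsTo φ D D')
    (a : smoothAlg D') (p : E) (hp : p ∈ D) :
    val (pull φ hφ h a) p hp = val a (φ p) (h hp) := rfl

/-- The chain rule for a pullback along a map whose derivative in the direction `v` is a
combination of constant vectors with smooth coefficients. -/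
theorem dir_pull {ι : Type*} [Fintype ι] (φ : E → F) (hφ : ContDiffOn ℝ ∞ φ D)
    (h : Set.MapsTo φ D D') (v : E) (c : ι → smoothAlg D) (w : ι → F)
    (hw : ∀ p hp, fderiv ℝ φ p v = ∑ i, val (c i) p hp • w i) (a : smoothAlg D') :
    dir v (pull φ hφ h a) = ∑ i, c i * pull φ hφ h (dir (w i) a) := by
  obtain ⟨a, ha, rfl⟩ := exists_sm a
  refine smoothAlg_ext fun p hp => ?_
  have hsum : ∀ g : ι → smoothAlg D, val (∑ i, g i) p hp = ∑ i, val (g i) p hp := by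
    intro g
    exact map_sum (AddMonoidHom.mk' (fun b : smoothAlg D => val b p hp) (fun _ _ => rfl)) g _
  have hφd : DifferentiableAt ℝ φ p :=
    (hφ.contDiffAt (D.isOpen.mem_nhds hp)).differentiableAt (by simp)
  rw [pull_sm, dir_sm, hsum]
  simp only [dir_sm, pull_sm, val_sm, val_mul]
  rw [show (fun p => a (φ p)) = a ∘ φ from rfl,
    fderiv_comp p (differentiableAt_of_smooth ha (h hp)) hφd]
  simp [hw p hp]

end SmoothAlgebra

/-! ### Differential algebra of the determining equations -/

section DifferentialAlgebra

variable {R : Type*} [CommRing R] [Algebra ℝ R]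

theorem eq_zero_of_ofNat_mul (n : ℕ) [n.AtLeastTwo] {x : R} (h : (ofNat(n) : R) * x = 0) :
    x = 0 := by
  have hn : (OfNat.ofNat n : ℝ) ≠ 0 := OfNat.ofNat_ne_zero n
  have h1 : (OfNat.ofNat n : ℝ) • x = 0 := by
    rw [Algebra.smul_def, map_ofNat, h]
  simpa [hn] using congrArg ((OfNat.ofNat n : ℝ)⁻¹ • ·) h1

theorem der_ofNat (D : Derivation ℝ R R) (n : ℕ) [n.AtLeastTwo] :
    D (ofNat(n) : R) = 0 := by
  simpa using D.map_natCast (OfNat.ofNat n)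

theorem der_mul (D : Derivation ℝ R R) (a b : R) : D (a * b) = a * D b + b * D a := by
  simp

theorem der_sq (D : Derivation ℝ R R) (a : R) : D (a ^ 2) = 2 * a * D a := by
  rw [pow_two, der_mul]; ring

theorem der_cube (D : Derivation ℝ R R) (a : R) : D (a ^ 3) = 3 * a ^ 2 * D a := by
  rw [pow_succ, der_mul, der_sq]; ring

theorem der_inv (D : Derivation ℝ R R) {a b : R} (h : a * b = 1) : D b = -(b ^ 2 * D a) := by
  have := congrArg D h
  rw [der_mul, D.map_one_eq_zero] at this
  linear_combination b * this - D b * h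

variable (T X U : Derivation ℝ R R)

/-- In terms of `u = 2 ψ_x / ψ` with `ψ_t + ψ_xx = 0`, the equation `q_t + u q_x + q_xx = 0` says
that `ψ q` solves the same heat equation, and `2 q_x + u q` corresponds to `2 (ψ q)_x`. -/
theorem heat_step (hXT : ∀ a, T (X a) = X (T a)) {u q : R}
    (hu : T u + u * X u + X (X u) = 0) (hq : T q + u * X q + X (X q) = 0) :
    T (2 * X q + u * q) + u * X (2 * X q + u * q) + X (X (2 * X q + u * q)) = 0 := by
  have h := congrArg X hq
  simp only [map_add, der_mul, der_ofNat, hXT, map_zero] at h ⊢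
  linear_combination 2 * h + q * hu + u * hq

/-- A linear relation between `z`, `y`, `u` and `1`, where `y` and `z` arise from `u` by the step
above, yields a relation between `y`, `u` and `1`, whose coefficients are the left-hand sides of
the cubic system. -/
theorem heat_relation {u y z ξ η₁ η₀ : R}
    (hu : T u + u * X u + X (X u) = 0) (hy : T y + u * X y + X (X y) = 0)
    (hz : T z + u * X z + X (X z) = 0) (hyu : y = 2 * X u + u ^ 2) (hzy : z = 2 * X y + u * y)
    (hr : z = 2 * ξ * y - 4 * η₁ * u - 4 * η₀) :
    (T ξ + X (X ξ) + 2 * ξ * X ξ - 2 * X η₁) * y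
      - 2 * (T η₁ + X (X η₁) + 2 * X ξ * η₁ + X η₀) * u
      - 2 * (T η₀ + X (X η₀) + 2 * X ξ * η₀) = 0 := by
  have hT := congrArg T hr
  have hX := congrArg X hr
  have hXX := congrArg X hX
  simp only [map_add, map_sub, der_mul, der_ofNat, map_zero] at hT hX hXX
  apply eq_zero_of_ofNat_mul 2
  linear_combination (-hT - u * hX - hXX) + hz - 2 * ξ * hy + 4 * η₁ * hu + 2 * X ξ * (hzy - hr)
    - 4 * X η₁ * hyu

/-- The setting of the determining equations: derivations `T`, `X`, `U` that play the role of
`∂_t`, `∂_x`, `∂_u`, the last of which commutes with the others, the coordinate function `u` and a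
unit `f` that does not depend on `u`. -/
structure Setting (T X U : Derivation ℝ R R) (f u : R) : Prop where
  hUX : ∀ a, U (X a) = X (U a)
  hUT : ∀ a, U (T a) = T (U a)
  hf : IsUnit f
  hUf : U f = 0
  hUu : U u = 1
  hXu : X u = 0
  hTu : T u = 0

/-- The determining equations for a reduction operator `∂_t + ξ ∂_x + η ∂_u`: the coefficients of
the powers of `u_x` in the conditional invariance criterion. -/
structure Determining (T X U : Derivation ℝ R R) (f u ξ η : R) : Prop where
  e3 : U (U ξ) = 0
  e2 : f * U (U η) - 2 * f * U (X ξ) + 2 * U ξ * (u - ξ) = 0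
  e1 : f * (-T ξ + 2 * U ξ * η + η - u * X ξ + 2 * X ξ * (u - ξ)) - (T f + ξ * X f) * (u - ξ)
    + f ^ 2 * (2 * U (X η) - X (X ξ)) = 0
  e0 : f * (T η + u * X η + f * X (X η) + 2 * X ξ * η) - (T f + ξ * X f) * η = 0

variable {T X U} {f u ξ η : R}

/-- The `u`-derivative of the equation `e2`. It expresses `η_uuu` in terms of `ξ_u`; since `ξ` is
affine in `u`, `η` is a polynomial of degree at most three in `u`. -/
theorem Determining.third (c : Setting T X U f u) (h : Determining T X U f u ξ η) :
    f * U (U (U η)) + 2 * U ξ * (1 - U ξ) = 0 := by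
  have := congrArg U h.e2
  simp only [map_add, map_sub, der_mul, der_ofNat, map_zero, c.hUX, c.hUf, c.hUu, h.e3] at this
  linear_combination this

theorem Determining.fourth (c : Setting T X U f u) (h : Determining T X U f u ξ η) :
    U (U (U (U η))) = 0 := by
  have := congrArg U (h.third c)
  simp only [map_add, map_sub, der_mul, der_ofNat, map_zero, c.hUf, h.e3,
    Derivation.map_one_eq_zero] at this
  exact c.hf.mul_right_eq_zero.1 (by linear_combination this)

/-- The third `u`-derivative of the equation `e1` restricts `ξ_u` to three constant values. -/
theorem Determining.slope (c : Setting T X U f u) (h : Determining T X U f u ξ η) :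
    U ξ * (1 - U ξ) * (1 + 2 * U ξ) = 0 := by
  have h1 := congrArg U (congrArg U (congrArg U h.e1))
  simp only [map_add, map_sub, map_neg, der_mul, der_ofNat, map_zero, c.hUX, c.hUT, c.hUf, c.hUu,
    h.e3, Derivation.map_one_eq_zero, h.fourth c, der_sq] at h1
  apply eq_zero_of_ofNat_mul 2
  linear_combination (1 + 2 * U ξ) * h.third c - h1

theorem Determining.of_slope_one (c : Setting T X U f u) (h : Determining T X U f u ξ η)
    (hs : U ξ = 1) : ξ = u ∧ η = 0 := by
  have h2 := h.e2
  simp only [c.hUX, hs, Derivation.map_one_eq_zero] at h2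
  have h3 := h.third c
  simp only [hs] at h3
  have h3 : U (U (U η)) = 0 := c.hf.mul_right_eq_zero.1 (by linear_combination h3)
  have h1 := congrArg U (congrArg U h.e1)
  simp only [map_add, map_sub, map_neg, der_mul, der_ofNat, map_zero, c.hUX, c.hUT, c.hUf, c.hUu,
    hs, h3, Derivation.map_one_eq_zero, der_sq] at h1
  have hk : ξ = u := by
    refine sub_eq_zero.1 (eq_zero_of_ofNat_mul 6 ?_)
    linear_combination h1 - 3 * h2
  subst hk
  have h4 : U (U η) = 0 := c.hf.mul_right_eq_zero.1 (by linear_combination h2)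
  have h5 := congrArg U h.e1
  have h6 := h.e1
  simp only [map_add, map_sub, map_neg, der_mul, der_ofNat, map_zero, c.hUX, c.hUT, c.hUf, c.hUu,
    c.hXu, c.hTu, h4, Derivation.map_one_eq_zero, der_sq] at h5 h6
  have h7 : U η = 0 := by
    apply c.hf.mul_right_eq_zero.1
    apply eq_zero_of_ofNat_mul 3
    linear_combination h5
  refine ⟨rfl, c.hf.mul_right_eq_zero.1 (eq_zero_of_ofNat_mul 3 ?_)⟩
  simp only [h7, map_zero] at h6
  linear_combination h6

/-- If `ξ` does not depend on `u`, then `η = a u + η₀` and the determining equations split into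
equations for functions of `(t, x)`. -/
theorem Determining.of_slope_zero (c : Setting T X U f u) (h : Determining T X U f u ξ η)
    (hs : U ξ = 0) :
    U (U η) = 0 ∧ T f + ξ * X f = f * (U η + X ξ) ∧ X (U η) = 0 ∧
    T (U η) + X (η - u * U η) + (X ξ - U η) * U η = 0 ∧
    T (η - u * U η) + f * X (X (η - u * U η)) + (X ξ - U η) * (η - u * U η) = 0 ∧
    η - u * U η = T ξ + ξ * X ξ - ξ * U η + f * X (X ξ) := by
  have h2 : U (U η) = 0 := by
    apply c.hf.mul_right_eq_zero.1
    have := h.e2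
    simp only [c.hUX, hs, map_zero] at this
    linear_combination this
  have h1 : T f + ξ * X f = f * (U η + X ξ) := by
    have := congrArg U h.e1
    simp only [map_add, map_sub, map_neg, der_mul, der_ofNat, map_zero, c.hUX, c.hUT, c.hUf,
      c.hUu, hs, h2, der_sq] at this
    linear_combination -this
  have h0 : T η + u * X η + f * X (X η) + (X ξ - U η) * η = 0 := by
    apply c.hf.mul_right_eq_zero.1
    linear_combination h.e0 + η * h1
  have ha : X (U η) = 0 := by
    have := congrArg U (congrArg U h0)
    simp only [map_add, map_sub, der_mul, map_zero, c.hUX, c.hUT, c.hUf, c.hUu, hs, h2,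
      Derivation.map_one_eq_zero] at this
    apply eq_zero_of_ofNat_mul 2
    linear_combination this
  have h3 : T (U η) + X (η - u * U η) + (X ξ - U η) * U η = 0 := by
    have := congrArg U h0
    simp only [map_add, map_sub, der_mul, map_zero, c.hUX, c.hUT, c.hUf, c.hUu, c.hXu, hs, h2,
      ha] at this ⊢
    linear_combination this
  refine ⟨h2, h1, ha, h3, ?_, ?_⟩
  · simp only [map_add, map_sub, der_mul, map_zero, c.hXu, c.hTu, ha] at h3 ⊢
    linear_combination h0 - u * h3
  · refine sub_eq_zero.1 (c.hf.mul_right_eq_zero.1 ?_)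
    have := h.e1
    simp only [c.hUX, ha, hs] at this
    linear_combination this + (u - ξ) * h1

/-- If `ξ_u = -1/2`, then `f` is constant; the coefficients `ξ₀`, `η₁`, `η₀` of the powers of `u`
in `ξ` and `η` are recovered by Taylor's formula. -/
theorem Determining.of_slope_neg_half (c : Setting T X U f u) (h : Determining T X U f u ξ η)
    (hs : 2 * U ξ = -1) :
    X f = 0 ∧ T f = 0 ∧ 2 * f * U (U (U η)) = 3 ∧
    f * (U (U η) - u * U (U (U η))) = U ξ * u - ξ := by
  have hs' : ∀ D : Derivation ℝ R R, D (U ξ) = 0 := by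
    intro D
    apply eq_zero_of_ofNat_mul 2
    have := congrArg D hs
    simp only [der_mul, der_ofNat, map_neg, Derivation.map_one_eq_zero] at this
    linear_combination this
  have h2 := h.e2
  simp only [c.hUX, hs'] at h2
  have h2 : f * U (U η) = u - ξ := by linear_combination h2 - (u - ξ) * hs
  have h3 : 2 * f * U (U (U η)) = 3 := by
    have := congrArg U h2
    simp only [map_sub, der_mul, c.hUf, c.hUu] at this
    linear_combination 2 * this - hs
  have h3X : f * X (U (U (U η))) + X f * U (U (U η)) = 0 := by
    have := congrArg X h3
    simp only [der_mul, der_ofNat] at this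
    apply eq_zero_of_ofNat_mul 2
    linear_combination this
  have h2X : f * X (U (U η)) + X f * U (U η) = - X ξ := by
    have := congrArg X h2
    simp only [der_mul, map_sub, c.hXu] at this
    linear_combination this
  have hXf : X f = 0 := by
    have := congrArg U (congrArg U h.e1)
    simp only [map_add, map_sub, map_neg, der_mul, der_ofNat, map_zero, c.hUX, c.hUT, c.hUf,
      c.hUu, hs', der_sq, Derivation.map_one_eq_zero] at this
    apply eq_zero_of_ofNat_mul 3
    linear_combination (-2) * this + 4 * f * h3X - 2 * X f * h3 - 2 * X f * (1 - U ξ) * hs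
      + (2 * f * U (U η) - X f) * hs
  refine ⟨hXf, ?_, h3, ?_⟩
  · have := congrArg U h.e1
    simp only [map_add, map_sub, map_neg, der_mul, der_ofNat, map_zero, c.hUX, c.hUT, c.hUf,
      c.hUu, hs', der_sq, hXf] at this h2X
    apply eq_zero_of_ofNat_mul 3
    linear_combination (-2) * this + 4 * f * h2X + (T f - 2 * f * X ξ + 2 * f * U η) * hs
  · apply sub_eq_zero.1
    apply eq_zero_of_ofNat_mul 2
    linear_combination 2 * h2 - u * h3 - u * hs

/-- The system for the coefficients of the cubic operators
`∂_t + (-u/2 + ξ₀) ∂_x + ((u^3/4 - ξ₀ u^2/2) / f + η₁ u + η₀) ∂_u` with constant `f`. -/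
structure CubicSystem (T X : Derivation ℝ R R) (f ξ₀ η₁ η₀ : R) : Prop where
  s2 : T ξ₀ + f * X (X ξ₀) + 2 * ξ₀ * X ξ₀ - 2 * f * X η₁ = 0
  s1 : T η₁ + f * X (X η₁) + 2 * X ξ₀ * η₁ + X η₀ = 0
  s0 : T η₀ + f * X (X η₀) + 2 * X ξ₀ * η₀ = 0

/-- For a cubic operator, `e1` and `e0` split with respect to `u` into the cubic system. -/
theorem determining_cubic_iff (c : Setting T X U f u) {ξ₀ η₁ η₀ : R} (hXf : X f = 0)
    (hTf : T f = 0) (hξ₀ : U ξ₀ = 0) (hη₁ : U η₁ = 0) (hη₀ : U η₀ = 0)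
    (hξ : 2 * ξ = 2 * ξ₀ - u)
    (hη : 4 * f * η = u ^ 3 - 2 * ξ₀ * u ^ 2 + 4 * f * η₁ * u + 4 * f * η₀) :
    Determining T X U f u ξ η ↔ CubicSystem T X f ξ₀ η₁ η₀ := by
  have hs : 2 * U ξ = -1 := by
    simpa [der_mul, der_ofNat, hξ₀, c.hUu] using congrArg U hξ
  have hs' : ∀ D : Derivation ℝ R R, D (U ξ) = 0 := fun D => by
    apply eq_zero_of_ofNat_mul 2
    simpa [der_mul, der_ofNat] using congrArg D hs
  have hTξ : T ξ = T ξ₀ := by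
    apply sub_eq_zero.1
    apply eq_zero_of_ofNat_mul 2
    have := congrArg T hξ
    simp only [der_mul, der_ofNat, map_sub, c.hTu] at this
    linear_combination this
  have hXξ : X ξ = X ξ₀ := by
    apply sub_eq_zero.1
    apply eq_zero_of_ofNat_mul 2
    have := congrArg X hξ
    simp only [der_mul, der_ofNat, map_sub, c.hXu] at this
    linear_combination this
  have hT := congrArg T hη
  have hX := congrArg X hη
  have hXX := congrArg X hX
  have hU := congrArg U hη
  have hUU := congrArg U hU
  have hXU := congrArg X hU
  simp only [map_add, map_sub, der_mul, der_ofNat, map_zero, c.hUf, c.hUu, c.hXu,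
    c.hTu, hXf, hTf, hξ₀, hη₁, hη₀, der_sq, der_cube, Derivation.map_one_eq_zero]
    at hT hX hXX hU hUU hXU
  have k2 : f * U (U η) - 2 * f * U (X ξ) + 2 * U ξ * (u - ξ) = 0 := by
    rw [c.hUX, hs']
    apply eq_zero_of_ofNat_mul 4
    linear_combination hUU + (4 * u - 4 * ξ) * hs + 2 * hξ
  have k1 : f * (-T ξ + 2 * U ξ * η + η - u * X ξ + 2 * X ξ * (u - ξ)) - (T f + ξ * X f) * (u - ξ)
      + f ^ 2 * (2 * U (X η) - X (X ξ))
      = -f * (T ξ₀ + f * X (X ξ₀) + 2 * ξ₀ * X ξ₀ - 2 * f * X η₁) := by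
    rw [c.hUX, hTξ, hXξ, hXf, hTf]
    apply sub_eq_zero.1
    apply eq_zero_of_ofNat_mul 2
    linear_combination f * hXU + 2 * f * η * hs - 2 * f * X ξ₀ * hξ
  have k0 : 4 * f * (f * (T η + u * X η + f * X (X η) + 2 * X ξ * η) - (T f + ξ * X f) * η)
      = f * (-2 * u ^ 2 * (T ξ₀ + f * X (X ξ₀) + 2 * ξ₀ * X ξ₀ - 2 * f * X η₁)
        + 4 * f * (u * (T η₁ + f * X (X η₁) + 2 * X ξ₀ * η₁ + X η₀)
          + (T η₀ + f * X (X η₀) + 2 * X ξ₀ * η₀))) := by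
    rw [hXξ, hXf, hTf]
    linear_combination f * hT + f * u * hX + f ^ 2 * hXX + 2 * f * X ξ₀ * hη
  constructor
  · intro h
    have s2 : T ξ₀ + f * X (X ξ₀) + 2 * ξ₀ * X ξ₀ - 2 * f * X η₁ = 0 := by
      apply c.hf.mul_right_eq_zero.1
      linear_combination k1 - h.e1
    have s : u * (T η₁ + f * X (X η₁) + 2 * X ξ₀ * η₁ + X η₀)
          + (T η₀ + f * X (X η₀) + 2 * X ξ₀ * η₀) = 0 := by
      apply c.hf.mul_right_eq_zero.1
      apply c.hf.mul_right_eq_zero.1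
      apply eq_zero_of_ofNat_mul 4
      linear_combination 4 * f * h.e0 - k0 + 2 * f * u ^ 2 * s2
    have s1 : T η₁ + f * X (X η₁) + 2 * X ξ₀ * η₁ + X η₀ = 0 := by
      have := congrArg U s
      simp only [map_add, der_mul, der_ofNat, map_zero, c.hUX, c.hUT, c.hUf, c.hUu, hξ₀, hη₁,
        hη₀] at this
      linear_combination this
    exact ⟨s2, s1, by linear_combination s - u * s1⟩
  · rintro ⟨s2, s1, s0⟩
    refine ⟨hs' U, k2, by rw [k1, s2]; ring, ?_⟩
    apply c.hf.mul_right_eq_zero.1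
    apply eq_zero_of_ofNat_mul 4
    linear_combination k0 - 2 * f * u ^ 2 * s2 + 4 * f ^ 2 * u * s1 + 4 * f ^ 2 * s0

end DifferentialAlgebra

/-! ### Operators with `ξ` independent of `u` -/

section AffineCase

variable {R : Type*} [CommRing R] [Algebra ℝ R] {T X : Derivation ℝ R R}

/-- The system for the coefficients of the operator `∂_t + ξ ∂_x + (a u + η₀) ∂_u` with `ξ`, `a`,
`η₀` not depending on `u`, in terms of `w = η₀ + a ξ`. -/
structure AffineSystem (T X : Derivation ℝ R R) (f ξ a w : R) : Prop where
  hf : T f + ξ * X f = f * (a + X ξ)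
  ha : X a = 0
  hw : w = T ξ + ξ * X ξ + f * X (X ξ)
  hXw : X w = a ^ 2 - T a
  hTw : T w = 2 * a * w - ξ * X w - w * X ξ

theorem AffineSystem.of_split (hTX : ∀ a, T (X a) = X (T a)) {f ξ a η₀ : R}
    (h1 : T f + ξ * X f = f * (a + X ξ)) (h2 : X a = 0) (h3 : T a + X η₀ + (X ξ - a) * a = 0)
    (h4 : T η₀ + f * X (X η₀) + (X ξ - a) * η₀ = 0)
    (h5 : η₀ = T ξ + ξ * X ξ - ξ * a + f * X (X ξ)) :
    AffineSystem T X f ξ a (η₀ + a * ξ) := by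
  have h6 := congrArg X h3
  simp only [map_add, map_sub, der_mul, map_zero, ← hTX, h2] at h6
  refine ⟨h1, h2, ?_, ?_, ?_⟩
  · linear_combination h5
  · simp only [map_add, der_mul, h2]
    linear_combination h3
  · simp only [map_add, der_mul, h2]
    linear_combination h4 - f * h6 - a * h5 + ξ * h3

theorem AffineSystem.hXXw (hTX : ∀ a, T (X a) = X (T a)) {f ξ a w : R}
    (h : AffineSystem T X f ξ a w) : X (X w) = 0 := by
  simp [h.hXw, ← hTX, h.ha]

theorem AffineSystem.hTXw (hTX : ∀ a, T (X a) = X (T a)) {f ξ a w : R}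
    (h : AffineSystem T X f ξ a w) :
    T (X w) = 2 * a * X w - w * X (X ξ) - 2 * X w * X ξ := by
  rw [hTX, h.hTw]
  simp only [map_sub, der_mul, der_ofNat, h.ha, h.hXXw hTX]
  ring

/-- Where neither `w` nor `w_x` nor `ξ_xx` vanish, the system is incompatible. Cross differentiation
yields algebraic relations between `f ξ_xx`, its `x`-derivative, `w`, `w_x`, `ξ_x`, `ξ_xx` and
functions of `t`; their repeated differentiation in `x` ends in `w_x ξ_xx = 0`. -/
theorem AffineSystem.false_of_isUnit (hTX : ∀ a, T (X a) = X (T a)) {f ξ a w : R}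
    (h : AffineSystem T X f ξ a w) (hw : IsUnit w) (hb : IsUnit (X w)) (hv : IsUnit (X (X ξ))) :
    (1 : R) = 0 := by
  obtain ⟨b, hb'⟩ : ∃ b, b = X w := ⟨_, rfl⟩
  obtain ⟨r, hr⟩ : ∃ r, r = X ξ := ⟨_, rfl⟩
  obtain ⟨v, hv'⟩ : ∃ v, v = X r := ⟨_, rfl⟩
  have hXb : X b = 0 := by rw [hb', h.hXXw hTX]
  have hTb : T b = 2 * a * b - w * v - 2 * b * r := by rw [hb', h.hTXw hTX, hv', hr]
  have hTw := h.hTw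
  have hXa := h.ha
  have hf := h.hf
  have hW := h.hw
  rw [← hr, ← hv'] at hv hW
  rw [← hb'] at hb hTw
  rw [← hr] at hf hTw
  -- `v` is a multiple of `w⁻³` with a coefficient that does not depend on `x`
  have hXv : w * X v = -3 * b * v := by
    have := congrArg X hTb
    simp only [map_sub, der_mul, der_ofNat, hXa, hXb, ← hTX, map_zero, ← hb', ← hv'] at this
    linear_combination this
  obtain ⟨vi, hvi⟩ := hv.exists_right_inv
  obtain ⟨c, hc⟩ : ∃ c, c = (T v + ξ * X v) * vi - 3 * r := ⟨_, rfl⟩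
  have hDv : T v + ξ * X v = v * (c + 3 * r) := by
    rw [hc]; linear_combination (-(T v + ξ * X v)) * hvi
  have hXc : X c = 0 := by
    have h1 := congrArg X hDv
    have h2 := congrArg T hXv
    have h3 := congrArg X hXv
    simp only [map_add, map_neg, der_mul, der_ofNat, hXb, hTb, hTw, ← hTX, ← hb', ← hr, ← hv']
      at h1 h2 h3
    apply hw.mul_right_eq_zero.1
    apply hv.mul_right_eq_zero.1
    linear_combination (-w) * h1 + h2 + ξ * h3 - 3 * b * hDv + (-2 * a - c - r) * hXv
  have hXTc : X (T c) = 0 := by rw [← hTX, hXc, map_zero]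
  have hXTa : X (T a) = 0 := by rw [← hTX, hXa, map_zero]
  -- the function `g = f v` and its first two derivatives in `x`
  obtain ⟨g, hg⟩ : ∃ g, g = f * v := ⟨_, rfl⟩
  obtain ⟨g₁, hg₁⟩ : ∃ g₁, g₁ = X g := ⟨_, rfl⟩
  have hDξ : T ξ + ξ * r = w - g := by rw [hg]; linear_combination -hW
  have hDr : T r + ξ * v = b - g₁ - r ^ 2 := by
    have := congrArg X hDξ
    simp only [map_add, map_sub, der_mul, ← hTX, ← hr, ← hv', ← hg₁, ← hb'] at this
    linear_combination this
  have hg₂ : X g₁ = -(v * (c + 6 * r)) := by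
    have := congrArg X hDr
    simp only [map_add, map_sub, der_mul, der_sq, ← hTX, ← hr, ← hv', hXb] at this
    linear_combination this - hDv
  have hDg : T g + ξ * g₁ = g * (a + c + 4 * r) := by
    rw [hg₁, hg]
    simp only [der_mul]
    linear_combination v * hf + f * hDv
  have hDg₁ : T g₁ + ξ * X g₁ = g₁ * (a + c + 3 * r) + 4 * g * v := by
    have := congrArg X hDg
    simp only [map_add, der_mul, der_ofNat, ← hTX, ← hr, ← hv', ← hg₁, hXa, hXc] at this
    linear_combination this
  have hA : 12 * g * b = w * (g₁ + (c - 6 * a) * r + (T c - c * a + 6 * b)) := by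
    have h1 := congrArg X hDg₁
    have h2 := congrArg T hg₂
    have h3 := congrArg X hg₂
    simp only [map_add, map_neg, der_mul, der_ofNat, ← hTX, ← hr, ← hv', ← hg₁, hXa, hXc]
      at h1 h2 h3
    apply sub_eq_zero.1
    apply hv.mul_right_eq_zero.1
    linear_combination w * (h1 - h2 - ξ * h3) + w * (a + c + 2 * r) * hg₂ + 6 * w * v * hDr
      + w * (c + 6 * r) * hDv + 4 * g * hXv
  have hB : 2 * g₁ * b * w = 2 * g * b ^ 2 - w ^ 2 * v * (a + r) := by
    have := congrArg X hA
    simp only [map_add, map_sub, der_mul, der_ofNat, hXa, hXb, hXc, hXTc, ← hv', ← hg₁,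
      ← hb', hg₂] at this
    apply sub_eq_zero.1
    apply eq_zero_of_ofNat_mul 6
    linear_combination w * this - b * hA
  have hC : w * v = b * (a + 13 * r + 2 * c) := by
    have := congrArg X hB
    simp only [map_add, map_sub, der_mul, der_ofNat, der_sq, hXa, hXb, ← hv', ← hg₁,
      ← hb', hg₂] at this
    apply sub_eq_zero.1
    apply hw.mul_right_eq_zero.1
    apply hv.mul_right_eq_zero.1
    linear_combination this - w * (a + r) * hXv
  have hD : b * v = 0 := by
    have := congrArg X hC
    simp only [map_add, der_mul, der_ofNat, hXa, hXb, hXc, ← hv', ← hb'] at this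
    apply eq_zero_of_ofNat_mul 15
    linear_combination -this + hXv
  obtain ⟨bi, hbi⟩ := hb.exists_right_inv
  linear_combination bi * vi * hD - hbi - b * bi * hvi

end AffineCase

/-! ### Parallel sections of flat connections -/

section Frobenius

set_option maxSynthPendingDepth 3

variable {F E : Type*} [NormedAddCommGroup F] [NormedSpace ℝ F] [NormedAddCommGroup E]
  [NormedSpace ℝ E]

theorem exists_linear_ode [CompleteSpace E] (B : ℝ → E →L[ℝ] E) (hB : ContinuousOn B (Icc 0 1))
    (hB' : ∀ s ∈ Icc (0 : ℝ) 1, ‖B s‖ ≤ 1 / 2) (v : E) :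
    ∃ α : ℝ → E, α 0 = v ∧
      ∀ s ∈ Icc (0 : ℝ) 1, HasDerivWithinAt α (B s (α s)) (Icc 0 1) s := by
  have hp : IsPicardLindelof (fun s y => B s y) (⟨0, by simp⟩ : Icc (0 : ℝ) 1) v
      (‖v‖₊ + 1) 0 (‖v‖₊ + 1) 1 := by
    refine ⟨fun s hs => ?_, fun y _ => ?_, fun s hs y hy => ?_, ?_⟩
    · refine ((B s).lipschitz.weaken ?_).lipschitzOnWith
      have := hB' s hs
      rw [← NNReal.coe_le_coe]
      simp only [coe_nnnorm, NNReal.coe_one]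
      linarith
    · exact hB.clm_apply continuousOn_const
    · have h1 := (B s).le_opNorm y
      have h2 : ‖y‖ ≤ ‖v‖ + (‖v‖ + 1) := by
        have h3 := norm_le_norm_add_norm_sub' y v
        rw [mem_closedBall, dist_eq_norm] at hy
        exact h3.trans (by simpa using hy)
      have h4 := mul_le_mul (hB' s hs) h2 (norm_nonneg _) (by norm_num)
      simp only [NNReal.coe_add, coe_nnnorm, NNReal.coe_one]
      linarith
    · simp
  exact hp.exists_eq_forall_mem_Icc_hasDerivWithinAt₀

/-- A connection form with bounded values and bounded Lipschitz derivative on the ball of radius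
`ρ` about `p₀` that is flat there. -/
structure FlatOn (A : F → F →L[ℝ] E →L[ℝ] E) (p₀ : F) (ρ C : ℝ) : Prop where
  hC : 1 ≤ C
  diff : ∀ p ∈ ball p₀ ρ, HasFDerivAt A (fderiv ℝ A p) p
  bound : ∀ p ∈ ball p₀ ρ, ‖A p‖ ≤ C
  bound' : ∀ p ∈ ball p₀ ρ, ‖fderiv ℝ A p‖ ≤ C
  lip : ∀ p ∈ ball p₀ ρ, ∀ p' ∈ ball p₀ ρ, ‖fderiv ℝ A p' - fderiv ℝ A p‖ ≤ C * ‖p' - p‖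
  flat : ∀ p ∈ ball p₀ ρ, ∀ h k, fderiv ℝ A p h k + (A p k).comp (A p h)
    = fderiv ℝ A p k h + (A p h).comp (A p k)

theorem FlatOn.lip₀ {A : F → F →L[ℝ] E →L[ℝ] E} {p₀ : F} {ρ C : ℝ} (h : FlatOn A p₀ ρ C)
    {p p' : F} (hp : p ∈ ball p₀ ρ) (hp' : p' ∈ ball p₀ ρ) : ‖A p' - A p‖ ≤ C * ‖p' - p‖ :=
  (convex_ball p₀ ρ).norm_image_sub_le_of_norm_hasFDerivWithin_le
    (fun q hq => (h.diff q hq).hasFDerivWithinAt) h.bound' hp hp'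

theorem FlatOn.taylor {A : F → F →L[ℝ] E →L[ℝ] E} {p₀ : F} {ρ C : ℝ} (h : FlatOn A p₀ ρ C)
    {p p' : F} (hp : p ∈ ball p₀ ρ) (hp' : p' ∈ ball p₀ ρ) :
    ‖A p' - A p - fderiv ℝ A p (p' - p)‖ ≤ C * ‖p' - p‖ * ‖p' - p‖ := by
  have hs : segment ℝ p p' ⊆ ball p₀ ρ := (convex_ball p₀ ρ).segment_subset hp hp'
  refine (convex_segment p p').norm_image_sub_le_of_norm_hasFDerivWithin_le'
    (fun q hq => (h.diff q (hs hq)).hasFDerivWithinAt) (fun q hq => ?_)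
    (left_mem_segment ℝ p p') (right_mem_segment ℝ p p')
  refine (h.lip p hp q (hs hq)).trans ?_
  have := h.hC
  gcongr
  obtain ⟨s, hs0, hs1, rfl⟩ : ∃ s : ℝ, 0 ≤ s ∧ s ≤ 1 ∧ p + s • (p' - p) = q := by
    rw [segment_eq_image'] at hq
    obtain ⟨s, hs, rfl⟩ := hq
    exact ⟨s, hs.1, hs.2, rfl⟩
  rw [add_sub_cancel_left, norm_smul, Real.norm_of_nonneg hs0]
  exact mul_le_of_le_one_left (norm_nonneg _) hs1

theorem norm_clm_apply₂_le (A : F →L[ℝ] E →L[ℝ] E) {k : F} {y : E} {a b c : ℝ} (hA : ‖A‖ ≤ a)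
    (hk : ‖k‖ ≤ b) (hy : ‖y‖ ≤ c) (hb : 0 ≤ b) (ha : 0 ≤ a) : ‖A k y‖ ≤ a * b * c :=
  ((A k).le_opNorm y).trans (mul_le_mul ((A.le_opNorm k).trans (by gcongr)) hy (norm_nonneg _)
    (by positivity))

/-- The defect in first-order approximation of the parallel transport along neighbouring rays
satisfies a linear differential inequality: flatness turns the derivative of the approximation
along the ray into the variation of the connection form, up to a quadratic error. -/
theorem FlatOn.increment {A : F → F →L[ℝ] E →L[ℝ] E} {p₀ : F} {ρ C : ℝ} (h : FlatOn A p₀ ρ C)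
    (hρ : ρ ≤ 1) {q k : F} (hq : ‖q‖ < ρ) (hqk : ‖q + k‖ < ρ) {α β : ℝ → E} (h0 : α 0 = β 0)
    (hα : ∀ s ∈ Icc (0 : ℝ) 1, HasDerivWithinAt α (A (p₀ + s • q) q (α s)) (Icc 0 1) s)
    (hβ : ∀ s ∈ Icc (0 : ℝ) 1,
      HasDerivWithinAt β (A (p₀ + s • (q + k)) (q + k) (β s)) (Icc 0 1) s)
    {M : ℝ} (hM : ∀ s ∈ Icc (0 : ℝ) 1, ‖α s‖ ≤ M) :
    ‖β 1 - α 1 - A (p₀ + q) k (α 1)‖ ≤ 4 * C * M * ‖k‖ ^ 2 * (Real.exp C - 1) := by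
  have hC := h.hC
  have hM0 : 0 ≤ M := (norm_nonneg _).trans (hM 0 (by simp))
  have mem : ∀ s ∈ Icc (0 : ℝ) 1, ∀ q' : F, ‖q'‖ < ρ → p₀ + s • q' ∈ ball p₀ ρ := by
    intro s hs q' hq'
    rw [mem_ball, dist_eq_norm, add_sub_cancel_left, norm_smul, Real.norm_of_nonneg hs.1]
    exact (mul_le_of_le_one_left (norm_nonneg _) hs.2).trans_lt hq'
  let P : ℝ → F := fun s => p₀ + s • q
  let P' : ℝ → F := fun s => p₀ + s • (q + k)
  have hPP : ∀ s, P' s - P s = s • k := fun s => by simp [P, P', smul_add]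
  let e : ℝ → E := fun s => β s - α s - s • A (P s) k (α s)
  let e' : ℝ → E := fun s => A (P' s) (q + k) (β s) - A (P s) q (α s)
    - (s • (fderiv ℝ A (P s) q k (α s) + A (P s) k (A (P s) q (α s))) + A (P s) k (α s))
  have hP : ∀ s, HasDerivWithinAt P q (Icc 0 1) s := fun s => by
    simpa [P] using (((hasDerivAt_id s).smul_const q).const_add p₀).hasDerivWithinAt
  have he : ∀ s ∈ Icc (0 : ℝ) 1, HasDerivWithinAt e (e' s) (Icc 0 1) s := by
    intro s hs
    have h1 : HasDerivWithinAt (fun s => A (P s)) (fderiv ℝ A (P s) q) (Icc 0 1) s :=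
      HasFDerivAt.comp_hasDerivWithinAt (f := P) s (h.diff (P s) (mem s hs q hq)) (hP s)
    have h2 : HasDerivWithinAt (fun s => A (P s) k) (fderiv ℝ A (P s) q k) (Icc 0 1) s := by
      simpa using h1.clm_apply (hasDerivWithinAt_const s _ k)
    have h3 := h2.clm_apply (hα s hs)
    have h4 := (hasDerivWithinAt_id s (Icc 0 1)).smul h3
    have h5 := ((hβ s hs).sub (hα s hs)).sub h4
    exact h5.congr_deriv (by simp only [e', P, P', id, one_smul])
  have hbound : ∀ s ∈ Icc (0 : ℝ) 1, ‖e' s‖ ≤ C * ‖e s‖ + 4 * C ^ 2 * M * ‖k‖ ^ 2 := by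
    intro s hs
    have hp := mem s hs q hq
    have hp' := mem s hs (q + k) hqk
    have hsk : ‖P' s - P s‖ ≤ ‖k‖ := by
      rw [hPP, norm_smul, Real.norm_of_nonneg hs.1]
      exact mul_le_of_le_one_left (norm_nonneg _) hs.2
    have hα' := hM s hs
    have hq1 : ‖q‖ ≤ 1 := (hq.trans_le hρ).le
    have hqk1 : ‖q + k‖ ≤ 1 := (hqk.trans_le hρ).le
    have hd : ‖A (P' s) - A (P s)‖ ≤ C * ‖k‖ := (h.lip₀ hp hp').trans (by gcongr)
    have hflat := congrArg (fun B => B (α s)) (h.flat (P s) hp q k)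
    simp only [add_apply, ContinuousLinearMap.comp_apply] at hflat
    have key : e' s = A (P' s) (q + k) (e s)
        + ((A (P' s) - A (P s) - fderiv ℝ A (P s) (P' s - P s)) q (α s)
          + (A (P' s) - A (P s)) k (α s)
          + s • (A (P' s) - A (P s)) q (A (P s) k (α s))
          + s • A (P' s) k (A (P s) k (α s))) := by
      simp only [e', hflat]
      simp only [e, hPP, map_add, map_sub, map_smul, add_apply,
        sub_apply, smul_apply, smul_add, smul_sub]
      abel
    have n1 := norm_clm_apply₂_le (A (P' s)) (h.bound _ hp') hqk1 (le_refl ‖e s‖) zero_le_one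
      (by linarith)
    have n2 : ‖A (P' s) - A (P s) - fderiv ℝ A (P s) (P' s - P s)‖ ≤ C * ‖k‖ * ‖k‖ :=
      (h.taylor hp hp').trans (by gcongr)
    have n3 := norm_clm_apply₂_le _ n2 hq1 hα' zero_le_one (by positivity)
    have n4 := norm_clm_apply₂_le _ hd (le_refl ‖k‖) hα' (norm_nonneg _) (by positivity)
    have n5 := norm_clm_apply₂_le _ (h.bound _ hp) (le_refl ‖k‖) hα' (norm_nonneg _) (by linarith)
    have n6 := norm_clm_apply₂_le _ hd hq1 n5 zero_le_one (by positivity)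
    have n7 := norm_clm_apply₂_le _ (h.bound _ hp') (le_refl ‖k‖) n5 (norm_nonneg _) (by linarith)
    have ns : ∀ y : E, ‖s • y‖ ≤ ‖y‖ := fun y => by
      rw [norm_smul, Real.norm_of_nonneg hs.1]
      exact mul_le_of_le_one_left (norm_nonneg _) hs.2
    rw [key]
    refine (norm_add_le _ _).trans ?_
    have n8 := norm_add₄_le (a := (A (P' s) - A (P s) - fderiv ℝ A (P s) (P' s - P s)) q (α s))
      (b := (A (P' s) - A (P s)) k (α s)) (c := s • (A (P' s) - A (P s)) q (A (P s) k (α s)))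
      (d := s • A (P' s) k (A (P s) k (α s)))
    have n9 := (ns _).trans n6
    have n10 := (ns _).trans n7
    have n11 : C * (M * ‖k‖ ^ 2) ≤ C ^ 2 * (M * ‖k‖ ^ 2) :=
      mul_le_mul_of_nonneg_right (by nlinarith) (by positivity)
    nlinarith
  have hg := norm_le_gronwallBound_of_norm_deriv_right_le (f := e) (f' := e') (δ := 0) (K := C)
    (ε := 4 * C ^ 2 * M * ‖k‖ ^ 2) (a := 0) (b := 1)
    (fun s hs => (he s hs).continuousWithinAt)
    (fun s hs => ((he s (Ico_subset_Icc_self hs)).mono_of_mem_nhdsWithin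
      (Icc_mem_nhdsGE_of_mem hs)))
    (by simp [e, h0]) (fun s hs => hbound s (Ico_subset_Icc_self hs)) 1 (by simp)
  rw [gronwallBound_of_K_ne_0 (by positivity)] at hg
  refine (le_of_eq ?_).trans (hg.trans (le_of_eq ?_))
  · simp [e, P]
  · field_simp
    simp

/-- Existence of parallel sections of a flat connection: the total differential equation
`dΨ = A Ψ` with `dA` symmetric up to the commutator has a local solution with any given value at a
point. The solution is found by integration along the rays through the point. -/
theorem exists_parallel [CompleteSpace E] (A : F → F →L[ℝ] E →L[ℝ] E) (p₀ : F) {r : ℝ}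
    (hr : 0 < r) (hA : ContDiffOn ℝ ∞ A (ball p₀ r))
    (flat : ∀ p ∈ ball p₀ r, ∀ h k, fderiv ℝ A p h k + (A p k).comp (A p h)
      = fderiv ℝ A p k h + (A p h).comp (A p k)) (v : E) :
    ∃ ρ, 0 < ρ ∧ ρ ≤ r ∧ ∃ Ψ : F → E, Ψ p₀ = v ∧ ContDiffOn ℝ ∞ Ψ (ball p₀ ρ) ∧
      ∀ p ∈ ball p₀ ρ, HasFDerivAt Ψ ((A p).flip (Ψ p)) p := by
  have hA0 : ContDiffAt ℝ ∞ A p₀ := hA.contDiffAt (isOpen_ball.mem_nhds (mem_ball_self hr))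
  have hA1 : ContDiffAt ℝ ∞ (fderiv ℝ A) p₀ :=
    (hA.fderiv_of_isOpen isOpen_ball (by simp)).contDiffAt
      (isOpen_ball.mem_nhds (mem_ball_self hr))
  have h1 : (1 : ℕ∞ω) ≤ ∞ := WithTop.coe_le_coe.2 le_top
  obtain ⟨C₁, t, ht, hlip⟩ := (hA1.of_le h1).exists_lipschitzOnWith
  have e0 : ∀ᶠ p in nhds p₀, ‖A p‖ < ‖A p₀‖ + 1 :=
    hA0.continuousAt.norm.eventually (gt_mem_nhds (lt_add_one _))
  have e1 : ∀ᶠ p in nhds p₀, ‖fderiv ℝ A p‖ < ‖fderiv ℝ A p₀‖ + 1 :=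
    hA1.continuousAt.norm.eventually (gt_mem_nhds (lt_add_one _))
  obtain ⟨ρ₀, hρ₀, hb⟩ := Metric.eventually_nhds_iff_ball.1 ((e0.and e1).and ht)
  let C : ℝ := ‖A p₀‖ + ‖fderiv ℝ A p₀‖ + C₁ + 1
  have hC : 1 ≤ C := by
    have := norm_nonneg (A p₀)
    have := norm_nonneg (fderiv ℝ A p₀)
    have := C₁.2
    simp only [C]
    linarith
  let ρ : ℝ := min (min r ρ₀) (min 1 (1 / (2 * C)))
  have hρ : 0 < ρ := by positivity
  have hρr : ρ ≤ r := (min_le_left _ _).trans (min_le_left _ _)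
  have hρρ : ρ ≤ ρ₀ := (min_le_left _ _).trans (min_le_right _ _)
  have hρ1 : ρ ≤ 1 := (min_le_right _ _).trans (min_le_left _ _)
  have hρC : ρ ≤ 1 / (2 * C) := (min_le_right _ _).trans (min_le_right _ _)
  have hF : FlatOn A p₀ ρ C := by
    have hA0' := norm_nonneg (A p₀)
    have hA1' := norm_nonneg (fderiv ℝ A p₀)
    have hC₁ := C₁.2
    refine ⟨hC, fun p hp => ?_, fun p hp => ?_, fun p hp => ?_, fun p hp p' hp' => ?_,
      fun p hp => flat p (ball_subset_ball hρr hp)⟩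
    · exact ((hA.contDiffAt (isOpen_ball.mem_nhds (ball_subset_ball hρr hp))).differentiableAt
        (by simp)).hasFDerivAt
    · have := (hb p (ball_subset_ball hρρ hp)).1.1
      simp only [C]
      linarith
    · have := (hb p (ball_subset_ball hρρ hp)).1.2
      simp only [C]
      linarith
    · have := hlip.norm_sub_le (hb p' (ball_subset_ball hρρ hp')).2
        (hb p (ball_subset_ball hρρ hp)).2
      refine this.trans (mul_le_mul_of_nonneg_right ?_ (norm_nonneg _))
      simp only [C]
      linarith
  have mem : ∀ s ∈ Icc (0 : ℝ) 1, ∀ q' : F, ‖q'‖ < ρ → p₀ + s • q' ∈ ball p₀ ρ := by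
    intro s hs q' hq'
    rw [mem_ball, dist_eq_norm, add_sub_cancel_left, norm_smul, Real.norm_of_nonneg hs.1]
    exact (mul_le_of_le_one_left (norm_nonneg _) hs.2).trans_lt hq'
  have hex : ∀ q : F, ∃ α : ℝ → E, ‖q‖ < ρ → α 0 = v ∧
      ∀ s ∈ Icc (0 : ℝ) 1, HasDerivWithinAt α (A (p₀ + s • q) q (α s)) (Icc 0 1) s := by
    intro q
    by_cases hq : ‖q‖ < ρ
    · obtain ⟨α, h⟩ := exists_linear_ode (fun s => A (p₀ + s • q) q)
        (ContinuousOn.clm_apply (hA.continuousOn.comp (by fun_prop)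
          fun s hs => ball_subset_ball hρr (mem s hs q hq)) continuousOn_const)
        (fun s hs => by
          refine ((A _).le_opNorm q).trans ?_
          calc ‖A (p₀ + s • q)‖ * ‖q‖ ≤ C * (1 / (2 * C)) :=
                mul_le_mul (hF.bound _ (mem s hs q hq)) (hq.le.trans hρC) (norm_nonneg _)
                  (by linarith)
            _ = 1 / 2 := by field_simp) v
      exact ⟨α, fun _ => h⟩
    · exact ⟨0, fun h => absurd h hq⟩
  choose α hα using hex
  let Ψ : F → E := fun p => α (p - p₀) 1
  have hder : ∀ p ∈ ball p₀ ρ, HasFDerivAt Ψ ((A p).flip (Ψ p)) p := by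
    intro p hp
    have hq : ‖p - p₀‖ < ρ := by rwa [← dist_eq_norm]
    obtain ⟨hα0, hα1⟩ := hα _ hq
    have hcont : ContinuousOn (α (p - p₀)) (Icc 0 1) :=
      fun s hs => (hα1 s hs).continuousWithinAt
    obtain ⟨M, hM⟩ := isCompact_Icc.exists_bound_of_continuousOn hcont
    rw [hasFDerivAt_iff_isLittleO_nhds_zero]
    have hO : (fun k => Ψ (p + k) - Ψ p - (A p).flip (Ψ p) k) =O[nhds 0] fun k => ‖k‖ ^ 2 := by
      refine Asymptotics.IsBigO.of_bound (4 * C * M * (Real.exp C - 1)) ?_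
      have hopen : ∀ᶠ k in nhds (0 : F), ‖p - p₀ + k‖ < ρ := by
        have hc : Continuous fun k : F => ‖p - p₀ + k‖ := by fun_prop
        exact (hc.tendsto 0).eventually_lt_const (by simpa using hq)
      filter_upwards [hopen] with k hk
      have hinc := hF.increment hρ1 hq hk (hα0.trans (hα _ hk).1.symm) hα1 (hα _ hk).2 hM
      rw [add_sub_cancel] at hinc
      simp only [Ψ, ContinuousLinearMap.flip_apply, norm_pow, norm_norm]
      rw [show p + k - p₀ = p - p₀ + k by abel]
      refine hinc.trans (le_of_eq (by ring))
    refine hO.trans_isLittleO ?_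
    simpa using Asymptotics.isLittleO_norm_pow_id (E' := F) one_lt_two
  refine ⟨ρ, hρ, hρr, Ψ, ?_, ?_, hder⟩
  · have h0 : ‖(0 : F)‖ < ρ := by simpa
    obtain ⟨hα0, hα1⟩ := hα 0 h0
    have := constant_of_has_deriv_right_zero (f := α 0) (a := 0) (b := 1)
      (fun s hs => (hα1 s hs).continuousWithinAt)
      (fun s hs => by
        simpa using (hα1 s (Ico_subset_Icc_self hs)).mono_of_mem_nhdsWithin
          (Icc_mem_nhdsGE_of_mem hs)) 1 (by simp)
    simp [Ψ, this, hα0]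
  · have hcont : ∀ n : ℕ, ContDiffOn ℝ n Ψ (ball p₀ ρ) := by
      intro n
      induction n with
      | zero =>
        exact contDiffOn_zero.2 fun p hp => (hder p hp).continuousAt.continuousWithinAt
      | succ n ih =>
        push_cast
        rw [contDiffOn_succ_iff_fderiv_of_isOpen isOpen_ball]
        refine ⟨fun p hp => (hder p hp).differentiableAt.differentiableWithinAt, by simp, ?_⟩
        refine ContDiffOn.congr (f := fun p => (A p).flip (Ψ p)) ?_
          fun p hp => (hder p hp).fderiv
        have hA' : ContDiffOn ℝ n (fun p => (A p).flip) (ball p₀ ρ) :=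
          (ContinuousLinearMap.flipₗᵢ ℝ F E E).contDiff.comp_contDiffOn
            ((hA.mono (ball_subset_ball hρr)).of_le (WithTop.coe_le_coe.2 le_top))
        exact hA'.clm_apply ih
    exact contDiffOn_infty.2 hcont

end Frobenius

theorem fderiv_plane (a : Plane → ℝ) (p h : Plane) :
    fderiv ℝ a p h = h.1 * dt a p + h.2 * dx a p := by
  have : h = h.1 • ((1, 0) : Plane) + h.2 • ((0, 1) : Plane) := by ext <;> simp
  have := congrArg (fderiv ℝ a p) this
  rw [map_add, map_smul, map_smul] at this
  exact this

section MatrixFrobenius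

set_option maxSynthPendingDepth 3

variable {n : ℕ}

/-- The action of matrices on vectors, with values in continuous linear maps. -/
noncomputable def matAct (n : ℕ) :
    Matrix (Fin n) (Fin n) ℝ →ₗ[ℝ] (Fin n → ℝ) →L[ℝ] (Fin n → ℝ) :=
  (LinearMap.toContinuousLinearMap.toLinearMap).comp (Matrix.toLin'.toLinearMap)

theorem matAct_apply (M : Matrix (Fin n) (Fin n) ℝ) (v : Fin n → ℝ) :
    matAct n M v = M.mulVec v := rfl

theorem matAct_mul (M N : Matrix (Fin n) (Fin n) ℝ) :
    (matAct n M).comp (matAct n N) = matAct n (M * N) := by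
  ext1 v
  simp [matAct_apply]

theorem matAct_eq_sum (M : Matrix (Fin n) (Fin n) ℝ) :
    matAct n M = ∑ i, ∑ j, M i j • matAct n (Matrix.single i j 1) := by
  conv_lhs => rw [Matrix.matrix_eq_sum_single M]
  simp only [map_sum, ← map_smul, Matrix.smul_single, smul_eq_mul, mul_one]

/-- The connection form `M₁ dt + M₂ dx` of a pair of matrix functions. -/
noncomputable def connection (mt mx : Fin n → Fin n → Plane → ℝ) (p : Plane) :
    Plane →L[ℝ] (Fin n → ℝ) →L[ℝ] (Fin n → ℝ) :=
  ∑ i, ∑ j, (mt i j p • (ContinuousLinearMap.fst ℝ ℝ ℝ).smulRight (matAct n (Matrix.single i j 1))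
    + mx i j p • (ContinuousLinearMap.snd ℝ ℝ ℝ).smulRight (matAct n (Matrix.single i j 1)))

theorem connection_apply (mt mx : Fin n → Fin n → Plane → ℝ) (p k : Plane) :
    connection mt mx p k = matAct n (Matrix.of fun i j => mt i j p * k.1 + mx i j p * k.2) := by
  rw [matAct_eq_sum]
  simp [connection, add_smul, mul_smul]

theorem connection_fderiv (mt mx : Fin n → Fin n → Plane → ℝ) (p h k : Plane)
    (ht : ∀ i j, DifferentiableAt ℝ (mt i j) p) (hx : ∀ i j, DifferentiableAt ℝ (mx i j) p) :
    fderiv ℝ (connection mt mx) p h k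
      = matAct n
        (Matrix.of fun i j => fderiv ℝ (mt i j) p h * k.1 + fderiv ℝ (mx i j) p h * k.2) := by
  have := HasFDerivAt.fun_sum (u := Finset.univ) (x := p) fun i _ =>
    HasFDerivAt.fun_sum (u := Finset.univ) (x := p) fun j _ =>
      ((ht i j).hasFDerivAt.smul_const
        ((ContinuousLinearMap.fst ℝ ℝ ℝ).smulRight (matAct n (Matrix.single i j 1)))).add
      ((hx i j).hasFDerivAt.smul_const
        ((ContinuousLinearMap.snd ℝ ℝ ℝ).smulRight (matAct n (Matrix.single i j 1))))
  rw [HasFDerivAt.fderiv (show HasFDerivAt (connection mt mx) _ p from this), matAct_eq_sum]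
  simp [add_smul, mul_smul]

/-- A linear system `ψ_t = M₁ ψ`, `ψ_x = M₂ ψ` with zero curvature has a smooth solution with any
given value at a point. -/
theorem exists_parallel_matrix (mt mx : Fin n → Fin n → Plane → ℝ) (p₀ : Plane) {r : ℝ}
    (hr : 0 < r) (ht : ∀ i j, ContDiffOn ℝ ∞ (mt i j) (ball p₀ r))
    (hx : ∀ i j, ContDiffOn ℝ ∞ (mx i j) (ball p₀ r))
    (flat : ∀ p ∈ ball p₀ r, ∀ i j, dx (mt i j) p + ∑ l, mt i l p * mx l j p
      = dt (mx i j) p + ∑ l, mx i l p * mt l j p) (v : Fin n → ℝ) :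
    ∃ ρ, 0 < ρ ∧ ρ ≤ r ∧ ∃ ψ : Fin n → Plane → ℝ, (∀ i, ψ i p₀ = v i) ∧
      (∀ i, ContDiffOn ℝ ∞ (ψ i) (ball p₀ ρ)) ∧ ∀ p ∈ ball p₀ ρ, ∀ i,
        dt (ψ i) p = ∑ j, mt i j p * ψ j p ∧ dx (ψ i) p = ∑ j, mx i j p * ψ j p := by
  have hdt : ∀ p ∈ ball p₀ r, ∀ i j, DifferentiableAt ℝ (mt i j) p := fun p hp i j =>
    ((ht i j).contDiffAt (isOpen_ball.mem_nhds hp)).differentiableAt (by simp)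
  have hdx : ∀ p ∈ ball p₀ r, ∀ i j, DifferentiableAt ℝ (mx i j) p := fun p hp i j =>
    ((hx i j).contDiffAt (isOpen_ball.mem_nhds hp)).differentiableAt (by simp)
  obtain ⟨ρ, hρ, hρr, Ψ, h0, hs, hd⟩ := exists_parallel (connection mt mx) p₀ hr
    (by
      unfold connection
      exact ContDiffOn.sum fun i _ => ContDiffOn.sum fun j _ =>
        ((ht i j).smul contDiffOn_const).add ((hx i j).smul contDiffOn_const))
    (fun p hp h k => by
      rw [connection_fderiv _ _ _ _ _ (hdt p hp) (hdx p hp),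
        connection_fderiv _ _ _ _ _ (hdt p hp) (hdx p hp), connection_apply, connection_apply,
        matAct_mul, matAct_mul, ← map_add, ← map_add]
      congr 1
      ext i j
      have := flat p hp i j
      simp only [Matrix.add_apply, Matrix.mul_apply, Matrix.of_apply, fderiv_plane]
      have e : ∀ a b c d : ℝ, ∑ l, (mt i l p * a + mx i l p * b) * (mt l j p * c + mx l j p * d)
          = a * c * ∑ l, mt i l p * mt l j p + a * d * ∑ l, mt i l p * mx l j p
            + b * c * ∑ l, mx i l p * mt l j p + b * d * ∑ l, mx i l p * mx l j p := by
        intro a b c d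
        simp only [Finset.mul_sum, ← Finset.sum_add_distrib]
        exact Finset.sum_congr rfl fun l _ => by ring
      rw [e, e]
      linear_combination (h.2 * k.1 - h.1 * k.2) * this) v
  refine ⟨ρ, hρ, hρr, fun i p => Ψ p i, fun i => by simp [h0], fun i => ?_, fun p hp i => ?_⟩
  · exact contDiffOn_pi.1 hs i
  · have h1 := (hasFDerivAt_pi'.1 (hd p hp) i).fderiv
    simp only [dt, dx, h1]
    simp [connection_apply, matAct_apply, Matrix.mulVec, dotProduct]

end MatrixFrobenius

/-- A solution of a linear homogeneous system of two ordinary differential equations with bounded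
coefficients that vanishes at a point vanishes identically. -/
theorem linear_pair_eq_zero {w b α β γ δ : ℝ → ℝ} {t₀ t₁ t₂ K : ℝ} (ht₀ : t₀ ∈ Ioo t₁ t₂)
    (hα : ∀ t ∈ Ioo t₁ t₂, |α t| ≤ K) (hβ : ∀ t ∈ Ioo t₁ t₂, |β t| ≤ K)
    (hγ : ∀ t ∈ Ioo t₁ t₂, |γ t| ≤ K) (hδ : ∀ t ∈ Ioo t₁ t₂, |δ t| ≤ K)
    (hw : ∀ t ∈ Ioo t₁ t₂, HasDerivAt w (α t * w t + β t * b t) t)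
    (hb : ∀ t ∈ Ioo t₁ t₂, HasDerivAt b (γ t * w t + δ t * b t) t)
    (hw0 : w t₀ = 0) (hb0 : b t₀ = 0) : ∀ t ∈ Ioo t₁ t₂, w t = 0 ∧ b t = 0 := by
  have hK : 0 ≤ K := (abs_nonneg _).trans (hα t₀ ht₀)
  have := ODE_solution_unique_of_mem_Ioo
    (v := fun t y => ((α t * y.1 + β t * y.2, γ t * y.1 + δ t * y.2) : ℝ × ℝ))
    (s := fun _ => univ) (K := (2 * K).toNNReal) (f := fun t => (w t, b t)) (g := fun _ => 0)
    (t₀ := t₀) (a := t₁) (b := t₂) ?_ ht₀ ?_ ?_ ?_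
  · intro t ht
    simpa using this ht
  · intro t ht
    refine LipschitzOnWith.of_dist_le_mul fun x _ y _ => ?_
    rw [Real.coe_toNNReal _ (by positivity), dist_eq_norm, dist_eq_norm]
    have h1 := norm_fst_le (x - y)
    have h2 := norm_snd_le (x - y)
    rw [Real.norm_eq_abs] at h1 h2
    have e : ∀ c d : ℝ, |c| ≤ K → |d| ≤ K →
        |c * (x - y).1 + d * (x - y).2| ≤ 2 * K * ‖x - y‖ := by
      intro c d hc hd
      refine (abs_add_le _ _).trans ?_
      rw [abs_mul, abs_mul]
      have := mul_le_mul hc h1 (abs_nonneg _) hK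
      have := mul_le_mul hd h2 (abs_nonneg _) hK
      linarith
    refine (Prod.norm_def _).trans_le (max_le ?_ ?_)
    · refine (le_of_eq ?_).trans (e _ _ (hα t ht) (hβ t ht))
      simp only [Real.norm_eq_abs, Prod.fst_sub, Prod.snd_sub]
      ring_nf
    · refine (le_of_eq ?_).trans (e _ _ (hγ t ht) (hδ t ht))
      simp only [Real.norm_eq_abs, Prod.fst_sub, Prod.snd_sub]
      ring_nf
  · exact fun t ht => ⟨(hw t ht).prodMk (hb t ht), mem_univ _⟩
  · exact fun t ht => ⟨(hasDerivAt_const t (0 : ℝ × ℝ)).congr_deriv (by ext <;> simp), mem_univ _⟩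
  · simp [hw0, hb0]

/-! ### The conditional invariance criterion as a system of determining equations -/

/-- The projection to the `(t, x)`-plane. -/
def proj (P : Space) : Plane := (P.1, P.2.1)

theorem contDiff_proj : ContDiff ℝ ∞ proj := by unfold proj; fun_prop

theorem isOpen_base {U : Set Space} (hU : IsOpen U) : IsOpen (base U) := by
  have h : IsOpenMap (fun P : Space => (P.1, P.2.1)) :=
    IsOpenMap.id.prodMap (isOpenMap_fst (X := ℝ) (Y := ℝ))
  exact h U hU

theorem proj_mem_base {U : Set Space} {P : Space} (h : P ∈ U) : proj P ∈ base U := ⟨P, h, rfl⟩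

/-- The projection to the `(t, x)`-plane of an open set, as an open set. -/
def baseOpens (U : Opens Space) : Opens Plane := ⟨base U, isOpen_base U.isOpen⟩

theorem proj_mem {U : Opens Space} {P : Space} (h : P ∈ U) : proj P ∈ baseOpens U :=
  proj_mem_base h

section

variable {U : Opens Space} {D : Opens Plane}

/-- The derivation `∂_t` for functions of `(t, x, u)`. -/
noncomputable abbrev dT (U : Opens Space) := dir (D := U) (1, 0, 0)
/-- The derivation `∂_x` for functions of `(t, x, u)`. -/
noncomputable abbrev dX (U : Opens Space) := dir (D := U) (0, 1, 0)
/-- The derivation `∂_u` for functions of `(t, x, u)`. -/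
noncomputable abbrev dU (U : Opens Space) := dir (D := U) (0, 0, 1)
/-- The derivation `∂_t` for functions of `(t, x)`. -/
noncomputable abbrev dt' (D : Opens Plane) := dir (D := D) (1, 0)
/-- The derivation `∂_x` for functions of `(t, x)`. -/
noncomputable abbrev dx' (D : Opens Plane) := dir (D := D) (0, 1)

theorem smooth_pt {a : Space → ℝ} (ha : ContDiffOn ℝ ∞ a U) : ContDiffOn ℝ ∞ (pt a) U :=
  contDiffOn_fderiv_apply ha _
theorem smooth_px {a : Space → ℝ} (ha : ContDiffOn ℝ ∞ a U) : ContDiffOn ℝ ∞ (px a) U :=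
  contDiffOn_fderiv_apply ha _
theorem smooth_pu {a : Space → ℝ} (ha : ContDiffOn ℝ ∞ a U) : ContDiffOn ℝ ∞ (pu a) U :=
  contDiffOn_fderiv_apply ha _
theorem smooth_dt {a : Plane → ℝ} (ha : ContDiffOn ℝ ∞ a D) : ContDiffOn ℝ ∞ (dt a) D :=
  contDiffOn_fderiv_apply ha _
theorem smooth_dx {a : Plane → ℝ} (ha : ContDiffOn ℝ ∞ a D) : ContDiffOn ℝ ∞ (dx a) D :=
  contDiffOn_fderiv_apply ha _

@[simp] theorem dT_sm {a : Space → ℝ} (ha : ContDiffOn ℝ ∞ a U) :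
    dir (1, 0, 0) (sm a ha) = sm (pt a) (smooth_pt ha) := dir_sm _ _ _
@[simp] theorem dX_sm {a : Space → ℝ} (ha : ContDiffOn ℝ ∞ a U) :
    dir (0, 1, 0) (sm a ha) = sm (px a) (smooth_px ha) := dir_sm _ _ _
@[simp] theorem dU_sm {a : Space → ℝ} (ha : ContDiffOn ℝ ∞ a U) :
    dir (0, 0, 1) (sm a ha) = sm (pu a) (smooth_pu ha) := dir_sm _ _ _
@[simp] theorem dt'_sm {a : Plane → ℝ} (ha : ContDiffOn ℝ ∞ a D) :
    dir (1, 0) (sm a ha) = sm (dt a) (smooth_dt ha) := dir_sm _ _ _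
@[simp] theorem dx'_sm {a : Plane → ℝ} (ha : ContDiffOn ℝ ∞ a D) :
    dir (0, 1) (sm a ha) = sm (dx a) (smooth_dx ha) := dir_sm _ _ _

/-- Functions of `(t, x)` as functions of `(t, x, u)`. -/
noncomputable def lift (U : Opens Space) : smoothAlg (baseOpens U) →ₐ[ℝ] smoothAlg U :=
  pull proj contDiff_proj.contDiffOn fun _ hP => proj_mem hP

theorem lift_sm {a : Plane → ℝ} (ha : ContDiffOn ℝ ∞ a (baseOpens U)) :
    lift U (sm a ha) = sm (fun P => a (proj P))
      (ha.comp contDiff_proj.contDiffOn fun _ hP => proj_mem hP) := rfl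

@[simp] theorem val_lift (a : smoothAlg (baseOpens U)) (P : Space) (hP : P ∈ U) :
    val (lift U a) P hP = val a (proj P) (proj_mem hP) := rfl

theorem dir_lift (v : Space) (a : smoothAlg (baseOpens U)) :
    dir v (lift U a) = lift U (dir (proj v) a) := by
  have hφ : ∀ P : Space, HasFDerivAt proj ((ContinuousLinearMap.fst ℝ ℝ (ℝ × ℝ)).prod
      ((ContinuousLinearMap.fst ℝ ℝ ℝ).comp (ContinuousLinearMap.snd ℝ ℝ (ℝ × ℝ)))) P :=
    fun P => ContinuousLinearMap.hasFDerivAt ((ContinuousLinearMap.fst ℝ ℝ (ℝ × ℝ)).prod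
      ((ContinuousLinearMap.fst ℝ ℝ ℝ).comp (ContinuousLinearMap.snd ℝ ℝ (ℝ × ℝ))))
  have := dir_pull (D := U) (D' := baseOpens U) proj contDiff_proj.contDiffOn
    (fun _ hP => proj_mem hP) v (fun _ : Unit => 1) (fun _ => proj v)
    (fun P hP => by simp [(hφ P).fderiv, proj]) a
  simpa [lift] using this

@[simp] theorem dT_lift (a : smoothAlg (baseOpens U)) :
    dir (1, 0, 0) (lift U a) = lift U (dir (1, 0) a) := dir_lift _ _
@[simp] theorem dX_lift (a : smoothAlg (baseOpens U)) :
    dir (0, 1, 0) (lift U a) = lift U (dir (0, 1) a) := dir_lift _ _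
@[simp] theorem dU_lift (a : smoothAlg (baseOpens U)) : dir (0, 0, 1) (lift U a) = 0 := by
  rw [dir_lift]
  obtain ⟨a, ha, rfl⟩ := exists_sm a
  rw [dir_sm, lift_sm]
  refine smoothAlg_ext fun P hP => ?_
  have : proj (0, 0, 1) = 0 := rfl
  simp [this]

/-- The coordinate function `u`. -/
noncomputable def uCoord (U : Opens Space) : smoothAlg U :=
  sm (fun P => P.2.2) (by fun_prop)

@[simp] theorem val_uCoord (P : Space) (hP : P ∈ U) : val (uCoord U) P hP = P.2.2 := rfl

theorem dir_uCoord (v : Space) : dir v (uCoord U) = algebraMap ℝ _ v.2.2 := by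
  have hφ : ∀ P : Space, HasFDerivAt (fun P : Space => P.2.2)
      ((ContinuousLinearMap.snd ℝ ℝ ℝ).comp (ContinuousLinearMap.snd ℝ ℝ (ℝ × ℝ))) P :=
    fun P => ContinuousLinearMap.hasFDerivAt
      ((ContinuousLinearMap.snd ℝ ℝ ℝ).comp (ContinuousLinearMap.snd ℝ ℝ (ℝ × ℝ)))
  rw [uCoord, dir_sm]
  refine smoothAlg_ext fun P hP => ?_
  simp [(hφ P).fderiv]

theorem isUnit_of_ne_zero {E : Type*} [NormedAddCommGroup E] [NormedSpace ℝ E] {D : Opens E}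
    {a : smoothAlg D} (h : ∀ p hp, val a p hp ≠ 0) : IsUnit a := by
  obtain ⟨b, hb⟩ := exists_inv a h
  exact IsUnit.of_mul_eq_one b hb

/-- Smooth functions of `(t, x, u)` form a setting for the determining equations. -/
theorem setting {f : Plane → ℝ} (hf : InClass f (baseOpens U)) :
    Setting (dT U) (dX U) (dU U) (lift U (sm f hf.1)) (uCoord U) where
  hUX := dir_comm _ _
  hUT := dir_comm _ _
  hf := isUnit_of_ne_zero fun P hP => hf.2 _ (proj_mem_base hP)
  hUf := dU_lift _
  hUu := by simp [dir_uCoord]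
  hXu := by simp [dir_uCoord]
  hTu := by simp [dir_uCoord]

end

section Congr

variable {U : Opens Space}

theorem pt_congr {a b : Space → ℝ} (h : ∀ P ∈ U, a P = b P) {P : Space} (hP : P ∈ U) :
    pt a P = pt b P := by rw [pt, fderiv_congr_open h hP, pt]
theorem px_congr {a b : Space → ℝ} (h : ∀ P ∈ U, a P = b P) {P : Space} (hP : P ∈ U) :
    px a P = px b P := by rw [px, fderiv_congr_open h hP, px]
theorem pu_congr {a b : Space → ℝ} (h : ∀ P ∈ U, a P = b P) {P : Space} (hP : P ∈ U) :
    pu a P = pu b P := by rw [pu, fderiv_congr_open h hP, pu]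

variable {j : Jet} (hj : j.space ∈ U)
include hj

theorem totT_congr {a b : Space → ℝ} (h : ∀ P ∈ U, a P = b P) : totT a j = totT b j := by
  rw [totT, totT, pt_congr h hj, pu_congr h hj]
theorem totX_congr {a b : Space → ℝ} (h : ∀ P ∈ U, a P = b P) : totX a j = totX b j := by
  rw [totX, totX, px_congr h hj, pu_congr h hj]
theorem totXX_congr {a b : Space → ℝ} (h : ∀ P ∈ U, a P = b P) : totXX a j = totXX b j := by
  rw [totXX, totXX, px_congr (fun _ => px_congr h) hj, pu_congr (fun _ => px_congr h) hj,
    pu_congr (fun _ => pu_congr h) hj, pu_congr h hj]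

variable {Q Q' : VField} (hτ : ∀ P ∈ U, Q.τ P = Q'.τ P) (hξ : ∀ P ∈ U, Q.ξ P = Q'.ξ P)
  (hη : ∀ P ∈ U, Q.η P = Q'.η P)
include hτ hξ hη

theorem prolongLhs_congr (f : Plane → ℝ) : prolongLhs f Q j = prolongLhs f Q' j := by
  simp only [prolongLhs, VField.etaT, VField.etaX, VField.etaXX, totT_congr hj hτ,
    totT_congr hj hξ, totT_congr hj hη, totX_congr hj hτ, totX_congr hj hξ, totX_congr hj hη,
    totXX_congr hj hτ, totXX_congr hj hξ, totXX_congr hj hη, hτ _ hj, hξ _ hj, hη _ hj]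

theorem onInvariantSurface_congr : Q.OnInvariantSurface j ↔ Q'.OnInvariantSurface j := by
  simp only [VField.OnInvariantSurface, VField.etaT, VField.etaX, totT_congr hj hτ,
    totT_congr hj hξ, totT_congr hj hη, totX_congr hj hτ, totX_congr hj hξ, totX_congr hj hη,
    hτ _ hj, hξ _ hj, hη _ hj]

end Congr

/-- The vector field `∂_t + ξ ∂_x + η ∂_u`. -/
def normalField (ξ η : Space → ℝ) : VField := ⟨fun _ => 1, ξ, η⟩

section Multiplier

variable {U : Opens Space} {m a : Space → ℝ} (hm : ContDiffOn ℝ ∞ m U) (ha : ContDiffOn ℝ ∞ a U)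
  {j : Jet} (hj : j.space ∈ U)
include hm ha hj

theorem totT_mul : totT (fun P => m P * a P) j = m j.space * totT a j + a j.space * totT m j := by
  have h1 := congrArg (fun c => val c _ hj) (der_mul (dT U) (sm m hm) (sm a ha))
  have h2 := congrArg (fun c => val c _ hj) (der_mul (dU U) (sm m hm) (sm a ha))
  simp only [sm_mul, dT_sm, dU_sm, val_sm, sm_add] at h1 h2
  rw [totT, totT, totT, h1, h2]
  ring

theorem totX_mul : totX (fun P => m P * a P) j = m j.space * totX a j + a j.space * totX m j := by
  have h1 := congrArg (fun c => val c _ hj) (der_mul (dX U) (sm m hm) (sm a ha))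
  have h2 := congrArg (fun c => val c _ hj) (der_mul (dU U) (sm m hm) (sm a ha))
  simp only [sm_mul, dX_sm, dU_sm, val_sm, sm_add] at h1 h2
  rw [totX, totX, totX, h1, h2]
  ring

theorem totXX_mul : totXX (fun P => m P * a P) j
    = m j.space * totXX a j + 2 * totX m j * totX a j + a j.space * totXX m j := by
  have h1 := congrArg (fun c => val c _ hj) (der_mul (dU U) (sm m hm) (sm a ha))
  have h2 : val (dX U (dX U (sm m hm * sm a ha))) _ hj = val (sm m hm * dX U (dX U (sm a ha))
      + 2 * dX U (sm m hm) * dX U (sm a ha) + sm a ha * dX U (dX U (sm m hm))) _ hj := by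
    congr 1
    simp only [der_mul, map_add]
    ring
  have h3 : val (dU U (dX U (sm m hm * sm a ha))) _ hj = val (sm m hm * dU U (dX U (sm a ha))
      + dU U (sm m hm) * dX U (sm a ha) + dX U (sm m hm) * dU U (sm a ha)
      + sm a ha * dU U (dX U (sm m hm))) _ hj := by
    congr 1
    simp only [der_mul, map_add]
    ring
  have h4 : val (dU U (dU U (sm m hm * sm a ha))) _ hj = val (sm m hm * dU U (dU U (sm a ha))
      + 2 * dU U (sm m hm) * dU U (sm a ha) + sm a ha * dU U (dU U (sm m hm))) _ hj := by
    congr 1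
    simp only [der_mul, map_add]
    ring
  simp only [sm_mul, dX_sm, dU_sm, val_sm, sm_add, val_add, val_mul, val_ofNat] at h1 h2 h3 h4
  rw [totXX, totXX, totXX, totX, totX, h1, h2, h3, h4]
  ring

end Multiplier

section Normal

variable {U : Opens Space} {m ξ η : Space → ℝ} {j : Jet}

theorem totT_const (c : ℝ) : totT (fun _ => c) j = 0 := by
  simp [totT, pt, pu]
theorem totX_const (c : ℝ) : totX (fun _ => c) j = 0 := by
  simp [totX, px, pu]
theorem totXX_const (c : ℝ) : totXX (fun _ => c) j = 0 := by
  have h1 : px (fun _ => c) = fun _ => 0 := by funext; simp [px]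
  have h2 : pu (fun _ => c) = fun _ => 0 := by funext; simp [pu]
  have h3 : px (fun _ => (0 : ℝ)) = fun _ => 0 := by funext; simp [px]
  have h4 : pu (fun _ => (0 : ℝ)) = fun _ => 0 := by funext; simp [pu]
  simp [totXX, h1, h2, h3, h4]

theorem normal_etaT : (normalField ξ η).etaT j = totT η j - j.ux * totT ξ j := by
  simp [VField.etaT, normalField, totT_const]
theorem normal_etaX : (normalField ξ η).etaX j = totX η j - j.ux * totX ξ j := by
  simp [VField.etaX, normalField, totX_const]
theorem normal_etaXX : (normalField ξ η).etaXX j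
    = totXX η j - j.ux * totXX ξ j - 2 * j.uxx * totX ξ j := by
  simp [VField.etaXX, normalField, totX_const, totXX_const]

variable (hm : ContDiffOn ℝ ∞ m U) (hξ : ContDiffOn ℝ ∞ ξ U) (hη : ContDiffOn ℝ ∞ η U)

/-- The characteristic `η - u_t - ξ u_x` of the field `∂_t + ξ ∂_x + η ∂_u`. -/
def chi (ξ η : Space → ℝ) (j : Jet) : ℝ := η j.space - j.ut - ξ j.space * j.ux

/-- The vector field `∂_t + ξ ∂_x + η ∂_u` multiplied by `m`. -/
def scaledField (m ξ η : Space → ℝ) : VField := ⟨m, fun P => m P * ξ P, fun P => m P * η P⟩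

include hm hξ hη

theorem scaled_etaT (hj : j.space ∈ U) : (scaledField m ξ η).etaT j
    = m j.space * (normalField ξ η).etaT j + totT m j * chi ξ η j := by
  rw [normal_etaT, VField.etaT]
  simp only [scaledField, totT_mul hm hξ hj, totT_mul hm hη hj, chi]
  ring

theorem scaled_etaX (hj : j.space ∈ U) : (scaledField m ξ η).etaX j
    = m j.space * (normalField ξ η).etaX j + totX m j * chi ξ η j := by
  rw [normal_etaX, VField.etaX]
  simp only [scaledField, totX_mul hm hξ hj, totX_mul hm hη hj, chi]
  ring

theorem scaled_prolongLhs (f : Plane → ℝ) (hj : j.space ∈ U) :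
    prolongLhs f (scaledField m ξ η) j = m j.space * prolongLhs f (normalField ξ η) j
      + totT m j * chi ξ η j + j.u * totX m j * chi ξ η j
      + f j.plane * (totXX m j * chi ξ η j + 2 * totX m j
        * ((normalField ξ η).etaX j - j.utx - ξ j.space * j.uxx)) := by
  rw [prolongLhs, scaled_etaT hm hξ hη hj, scaled_etaX hm hξ hη hj, prolongLhs, normal_etaXX,
    normal_etaT, normal_etaX, VField.etaXX]
  simp only [scaledField, normalField,
    totX_mul hm hξ hj, totXX_mul hm hξ hj, totXX_mul hm hη hj, chi]
  ring

theorem scaled_onInvariantSurface (hj : j.space ∈ U) (hm0 : m j.space ≠ 0) :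
    (scaledField m ξ η).OnInvariantSurface j ↔ (normalField ξ η).OnInvariantSurface j := by
  have h0 : (scaledField m ξ η).η j.space - (scaledField m ξ η).τ j.space * j.ut
      - (scaledField m ξ η).ξ j.space * j.ux = m j.space * chi ξ η j := by
    simp only [scaledField, chi]; ring
  have h0' : (normalField ξ η).η j.space - (normalField ξ η).τ j.space * j.ut
      - (normalField ξ η).ξ j.space * j.ux = chi ξ η j := by
    simp only [normalField, chi]; ring
  rw [VField.OnInvariantSurface, VField.OnInvariantSurface, h0, h0', mul_eq_zero,
    or_iff_right hm0]
  refine and_congr_right fun hχ => ?_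
  rw [scaled_etaT hm hξ hη hj, scaled_etaX hm hξ hη hj, hχ]
  have e1 : m j.space * (normalField ξ η).etaT j + totT m j * 0
      - (scaledField m ξ η).τ j.space * j.utt - (scaledField m ξ η).ξ j.space * j.utx
      = m j.space * ((normalField ξ η).etaT j - (normalField ξ η).τ j.space * j.utt
        - (normalField ξ η).ξ j.space * j.utx) := by
    simp only [scaledField, normalField]; ring
  have e2 : m j.space * (normalField ξ η).etaX j + totX m j * 0
      - (scaledField m ξ η).τ j.space * j.utx - (scaledField m ξ η).ξ j.space * j.uxx
      = m j.space * ((normalField ξ η).etaX j - (normalField ξ η).τ j.space * j.utx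
        - (normalField ξ η).ξ j.space * j.uxx) := by
    simp only [scaledField, normalField]; ring
  rw [e1, e2, mul_eq_zero, mul_eq_zero, or_iff_right hm0, or_iff_right hm0]

omit hm in
/-- For a field with the coefficient `1` of `∂_t`, the conditional invariance criterion is
equivalent to the determining equations: the jets to be tested are parametrized by `t`, `x`, `u` and
`u_x`, and the criterion is polynomial in `u_x`. -/
theorem criterion_iff {f : Plane → ℝ} (hf : InClass f (baseOpens U)) :
    (∀ j : Jet, j.space ∈ U → lhs f j = 0 → (normalField ξ η).OnInvariantSurface j →
      prolongLhs f (normalField ξ η) j = 0) ↔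
    Determining (dT U) (dX U) (dU U) (lift U (sm f hf.1)) (uCoord U) (sm ξ hξ) (sm η hη) := by
  have key : ∀ j : Jet, j.space ∈ U → lhs f j = 0 → chi ξ η j = 0 →
      f j.plane * prolongLhs f (normalField ξ η) j =
        -(f j.plane) ^ 2 * pu (pu ξ) j.space * j.ux ^ 3
        + f j.plane * (f j.plane * pu (pu η) j.space - 2 * f j.plane * pu (px ξ) j.space
          + 2 * pu ξ j.space * (j.u - ξ j.space)) * j.ux ^ 2
        + (f j.plane * (-pt ξ j.space + 2 * pu ξ j.space * η j.space + η j.space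
          - j.u * px ξ j.space + 2 * px ξ j.space * (j.u - ξ j.space))
          - (dt f j.plane + ξ j.space * dx f j.plane) * (j.u - ξ j.space)
          + f j.plane ^ 2 * (2 * pu (px η) j.space - px (px ξ) j.space)) * j.ux
        + (f j.plane * (pt η j.space + j.u * px η j.space + f j.plane * px (px η) j.space
          + 2 * px ξ j.space * η j.space)
          - (dt f j.plane + ξ j.space * dx f j.plane) * η j.space) := by
    intro j hj hl hχ
    simp only [lhs] at hl
    simp only [chi] at hχ
    rw [prolongLhs, normal_etaT, normal_etaX, normal_etaXX]
    simp only [totT, totX, totXX, normalField]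
    linear_combination ((dt f j.plane + ξ j.space * dx f j.plane) + f j.plane
        * (pu η j.space - 3 * j.ux * pu ξ j.space - 2 * px ξ j.space)) * hl
      - (f j.plane * (pu η j.space - j.ux * pu ξ j.space)
        - ((dt f j.plane + ξ j.space * dx f j.plane) + f j.plane
          * (pu η j.space - 3 * j.ux * pu ξ j.space - 2 * px ξ j.space))) * hχ
  constructor
  · intro h
    have main : ∀ P ∈ U, pu (pu ξ) P = 0 ∧
        f (proj P) * pu (pu η) P - 2 * f (proj P) * pu (px ξ) P
          + 2 * pu ξ P * (P.2.2 - ξ P) = 0 ∧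
        f (proj P) * (-pt ξ P + 2 * pu ξ P * η P + η P - P.2.2 * px ξ P
          + 2 * px ξ P * (P.2.2 - ξ P)) - (dt f (proj P) + ξ P * dx f (proj P)) * (P.2.2 - ξ P)
          + f (proj P) ^ 2 * (2 * pu (px η) P - px (px ξ) P) = 0 ∧
        f (proj P) * (pt η P + P.2.2 * px η P + f (proj P) * px (px η) P
          + 2 * px ξ P * η P) - (dt f (proj P) + ξ P * dx f (proj P)) * η P = 0 := by
      intro P hP
      have hf0 : f (proj P) ≠ 0 := hf.2 _ (proj_mem_base hP)
      have hpoly : ∀ s : ℝ, -(f (proj P)) ^ 2 * pu (pu ξ) P * s ^ 3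
          + f (proj P) * (f (proj P) * pu (pu η) P - 2 * f (proj P) * pu (px ξ) P
            + 2 * pu ξ P * (P.2.2 - ξ P)) * s ^ 2
          + (f (proj P) * (-pt ξ P + 2 * pu ξ P * η P + η P - P.2.2 * px ξ P
            + 2 * px ξ P * (P.2.2 - ξ P)) - (dt f (proj P) + ξ P * dx f (proj P)) * (P.2.2 - ξ P)
            + f (proj P) ^ 2 * (2 * pu (px η) P - px (px ξ) P)) * s
          + (f (proj P) * (pt η P + P.2.2 * px η P + f (proj P) * px (px η) P
            + 2 * px ξ P * η P) - (dt f (proj P) + ξ P * dx f (proj P)) * η P) = 0 := by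
        intro s
        -- the jet over `P` with `u_x = s` that satisfies the equation and the surface conditions
        let j₀ : Jet := ⟨P.1, P.2.1, P.2.2, η P - ξ P * s, s, 0, 0,
          -(η P - ξ P * s + P.2.2 * s) / f (proj P)⟩
        let etx : ℝ := totX η j₀ - s * totX ξ j₀
        let j : Jet := ⟨P.1, P.2.1, P.2.2, η P - ξ P * s, s,
          totT η j₀ - s * totT ξ j₀ - ξ P * (etx - ξ P * j₀.uxx), etx - ξ P * j₀.uxx, j₀.uxx⟩
        have hl : lhs f j = 0 := by
          have : lhs f j = (η P - ξ P * s) + P.2.2 * s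
              + f (proj P) * (-(η P - ξ P * s + P.2.2 * s) / f (proj P)) := rfl
          rw [this]
          field_simp
          ring
        have hχ : chi ξ η j = 0 := by
          have : chi ξ η j = η P - (η P - ξ P * s) - ξ P * s := rfl
          rw [this]; ring
        have hs : (normalField ξ η).OnInvariantSurface j := by
          refine ⟨?_, ?_, ?_⟩
          · have : chi ξ η j = η P - 1 * (η P - ξ P * s) - ξ P * s := by rw [one_mul]; rfl
            exact this.symm.trans hχ
          · rw [normal_etaT]
            change totT η j₀ - s * totT ξ j₀
              - 1 * (totT η j₀ - s * totT ξ j₀ - ξ P * (etx - ξ P * j₀.uxx))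
              - ξ P * (etx - ξ P * j₀.uxx) = 0
            ring
          · rw [normal_etaX]
            change etx - 1 * (etx - ξ P * j₀.uxx) - ξ P * j₀.uxx = 0
            ring
        have := key j hP hl hχ
        rw [h j hP hl hs, mul_zero] at this
        exact this.symm
      have h0 := hpoly 0
      have h1 := hpoly 1
      have h2 := hpoly (-1)
      have h3 := hpoly 2
      norm_num at h0
      have c3 : -(f (proj P)) ^ 2 * pu (pu ξ) P = 0 := by linarith
      have c2 : f (proj P) * (f (proj P) * pu (pu η) P - 2 * f (proj P) * pu (px ξ) P
            + 2 * pu ξ P * (P.2.2 - ξ P)) = 0 := by linarith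
      exact ⟨by simpa [hf0] using c3, (mul_eq_zero.1 c2).resolve_left hf0, by linarith, h0⟩
    refine ⟨smoothAlg_ext fun P hP => ?_, smoothAlg_ext fun P hP => ?_,
      smoothAlg_ext fun P hP => ?_, smoothAlg_ext fun P hP => ?_⟩
    · simpa using (main P hP).1
    · simpa using (main P hP).2.1
    · simpa using (main P hP).2.2.1
    · simpa using (main P hP).2.2.2
  · intro h j hj hl hs
    have hf0 : f j.plane ≠ 0 := hf.2 _ (proj_mem_base hj)
    have hχ : chi ξ η j = 0 := by
      have := hs.1
      simpa [normalField, chi] using this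
    have e3 := congrArg (fun c => val c _ hj) h.e3
    have e2 := congrArg (fun c => val c _ hj) h.e2
    have e1 := congrArg (fun c => val c _ hj) h.e1
    have e0 := congrArg (fun c => val c _ hj) h.e0
    simp at e3 e2 e1 e0
    have hk := key j hj hl hχ
    refine (mul_eq_zero.1 (hk.trans ?_)).resolve_left hf0
    have p : proj j.space = j.plane := rfl
    have q : j.space.2.2 = j.u := rfl
    rw [p, q] at e2 e1 e0
    linear_combination (-(f j.plane) ^ 2 * j.ux ^ 3) * e3 + f j.plane * j.ux ^ 2 * e2
      + j.ux * e1 + e0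

end Normal

/-! ### The listed operators are reduction operators -/

section Regular

variable {U : Opens Space} {f : Plane → ℝ} {Q : VField}

/-- Fields with the coefficient `1` of `∂_t` that satisfy the determining equations are reduction
operators; it suffices to know their coefficients on `U`. -/
theorem regular_of_determining (hf : InClass f (baseOpens U)) {ξ η : Space → ℝ}
    (hξ : ContDiffOn ℝ ∞ ξ U) (hη : ContDiffOn ℝ ∞ η U)
    (h : Determining (dT U) (dX U) (dU U) (lift U (sm f hf.1)) (uCoord U) (sm ξ hξ) (sm η hη))
    (hQ : ∀ P ∈ U, Q.τ P = 1 ∧ Q.ξ P = ξ P ∧ Q.η P = η P) :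
    IsRegularReductionOperator f Q U := by
  have h1 : ∀ P ∈ U, Q.τ P = (normalField ξ η).τ P := fun P hP => (hQ P hP).1
  have h2 : ∀ P ∈ U, Q.ξ P = (normalField ξ η).ξ P := fun P hP => (hQ P hP).2.1
  have h3 : ∀ P ∈ U, Q.η P = (normalField ξ η).η P := fun P hP => (hQ P hP).2.2
  refine ⟨⟨?_, hξ.congr h2, hη.congr h3⟩, fun P hP => by simp [(hQ P hP).1], fun j hj hl hs => ?_⟩
  · exact (contDiffOn_const (c := (1 : ℝ))).congr h1
  · rw [prolongLhs_congr hj h1 h2 h3]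
    exact (criterion_iff hξ hη hf).2 h j hj hl ((onInvariantSurface_congr hj h1 h2 h3).1 hs)

/-- Division by the coefficient of `∂_t` preserves the conditional invariance criterion, since on
the invariant surface the prolongation of a multiple of a field is the multiple of its prolongation.
-/
theorem determining_of_regular (hf : InClass f (baseOpens U))
    (h : IsRegularReductionOperator f Q U) :
    ∃ (hξ : ContDiffOn ℝ ∞ (fun P => Q.ξ P / Q.τ P) U)
      (hη : ContDiffOn ℝ ∞ (fun P => Q.η P / Q.τ P) U),
      Determining (dT U) (dX U) (dU U) (lift U (sm f hf.1)) (uCoord U) (sm _ hξ) (sm _ hη) := by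
  obtain ⟨⟨hτ, hξ, hη⟩, hτ0, hcrit⟩ := h
  have hξ' : ContDiffOn ℝ ∞ (fun P => Q.ξ P / Q.τ P) U := hξ.div hτ hτ0
  have hη' : ContDiffOn ℝ ∞ (fun P => Q.η P / Q.τ P) U := hη.div hτ hτ0
  refine ⟨hξ', hη', (criterion_iff hξ' hη' hf).1 fun j hj hl hs => ?_⟩
  have h1 : ∀ P ∈ U, Q.τ P
      = (scaledField Q.τ (fun P => Q.ξ P / Q.τ P) (fun P => Q.η P / Q.τ P)).τ P :=
    fun P hP => rfl
  have h2 : ∀ P ∈ U, Q.ξ P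
      = (scaledField Q.τ (fun P => Q.ξ P / Q.τ P) (fun P => Q.η P / Q.τ P)).ξ P :=
    fun P hP => (mul_div_cancel₀ _ (hτ0 P hP)).symm
  have h3 : ∀ P ∈ U, Q.η P
      = (scaledField Q.τ (fun P => Q.ξ P / Q.τ P) (fun P => Q.η P / Q.τ P)).η P :=
    fun P hP => (mul_div_cancel₀ _ (hτ0 P hP)).symm
  have hs' := (onInvariantSurface_congr hj h1 h2 h3).2
    ((scaled_onInvariantSurface hτ hξ' hη' hj (hτ0 _ hj)).2 hs)
  have h0 := hcrit j hj hl hs'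
  rw [prolongLhs_congr hj h1 h2 h3, scaled_prolongLhs hτ hξ' hη' f hj] at h0
  have hχ : chi (fun P => Q.ξ P / Q.τ P) (fun P => Q.η P / Q.τ P) j = 0 := by
    have := hs.1
    simpa [normalField, chi] using this
  have hX : (normalField (fun P => Q.ξ P / Q.τ P) (fun P => Q.η P / Q.τ P)).etaX j - j.utx
      - Q.ξ j.space / Q.τ j.space * j.uxx = 0 := by
    have := hs.2.2
    simpa [normalField] using this
  rw [hχ, hX] at h0
  simpa [hτ0 _ hj] using h0

theorem regular_of_common (hf : InClass f (baseOpens U)) (h : IsCommonOperator Q U) :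
    IsRegularReductionOperator f Q U := by
  have c := setting hf
  refine regular_of_determining hf (ξ := fun P => P.2.2) (η := fun _ => 0) (by fun_prop)
    contDiffOn_const ?_ h
  have h0 : sm (fun _ : Space => (0 : ℝ)) (D := U) contDiffOn_const = 0 := rfl
  change Determining _ _ _ _ _ (uCoord U) _
  rw [h0]
  refine ⟨?_, ?_, ?_, ?_⟩ <;> simp [c.hUu, c.hXu, c.hTu]

theorem regular_of_lie (h : IsLieSymmetryOperator f Q U) (hτ : ∀ P ∈ U, Q.τ P ≠ 0) :
    IsRegularReductionOperator f Q U :=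
  ⟨h.1, hτ, fun j hj hl _ => h.2 j hj hl⟩

end Regular

/-! ### Operators built from a potential `θ` -/

section ThetaAlgebra

variable {R : Type*} [CommRing R] [Algebra ℝ R] {T X : Derivation ℝ R R}

/-- The equation for `θ`, where `H` stands for `h(θ)` and `h'` for the value of the derivative of
`h` at `θ`, means that `f = -1 / θ_x` and `ξ = -θ_t / θ_x` satisfy the determining equations for
the operator `∂_t + ξ ∂_x`. -/
theorem theta_relations (hTX : ∀ a, T (X a) = X (T a)) {f ξ θ H h' : R} (hu : IsUnit (X θ))
    (hf : f * X θ = -1) (hξ : ξ * X θ = -T θ) (hθ : T θ * X θ = X (X θ) + H * X θ ^ 2)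
    (hX : X H = h' * X θ) (hT : T H = h' * T θ) :
    T f + ξ * X f = f * X ξ ∧ T ξ + ξ * X ξ + f * X (X ξ) = 0 := by
  have h1 : T f + ξ * X f = f * X ξ := by
    have e1 := congrArg T hf
    have e2 := congrArg X hf
    have e3 := congrArg X hξ
    simp only [der_mul, map_neg, Derivation.map_one_eq_zero, hTX] at e1 e2 e3
    apply sub_eq_zero.1
    apply hu.mul_right_eq_zero.1
    linear_combination e1 + ξ * e2 - f * e3
  have h2 : ξ + X f = -H := by
    have e2 := congrArg X hf
    simp only [der_mul, map_neg, Derivation.map_one_eq_zero] at e2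
    apply sub_eq_zero.1
    apply (hu.pow 2).mul_right_eq_zero.1
    linear_combination X θ * hξ + X θ * e2 - X (X θ) * hf - hθ
  refine ⟨h1, ?_⟩
  have e1 := congrArg X h1
  have e2 := congrArg T h2
  have e3 := congrArg X h2
  simp only [map_add, map_neg, der_mul, hTX, hX, hT] at e1 e2 e3
  linear_combination e2 + ξ * e3 - e1 - h' * hξ

variable {U : Derivation ℝ R R} {f u ξ : R}

theorem determining_of_inertial (c : Setting T X U f u) (hU : U ξ = 0)
    (h1 : T f + ξ * X f = f * X ξ) (h2 : T ξ + ξ * X ξ + f * X (X ξ) = 0) :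
    Determining T X U f u ξ 0 := by
  refine ⟨by simp [hU], by simp [hU, c.hUX], ?_, by simp⟩
  simp only [map_zero, hU]
  linear_combination (ξ - u) * h1 - f * h2

end ThetaAlgebra

theorem regular_of_theta {U : Opens Space} {f : Plane → ℝ} {Q : VField}
    (hf : InClass f (baseOpens U)) (h : IsThetaOperator f Q U) :
    IsRegularReductionOperator f Q U := by
  obtain ⟨θ, I, h, hθ, hI, hh, hp, hQ⟩ := h
  have hθ : ContDiffOn ℝ ∞ θ (baseOpens U) := hθ
  have hp : ∀ p ∈ baseOpens U, dx θ p ≠ 0 ∧ θ p ∈ I ∧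
      dt θ p = dx (dx θ) p / dx θ p + h (θ p) * dx θ p ∧ f p = -1 / dx θ p := hp
  have hξ : ContDiffOn ℝ ∞ (fun p => -(dt θ p / dx θ p)) (baseOpens U) :=
    ((smooth_dt hθ).div (smooth_dx hθ) fun p hp' => (hp p hp').1).neg
  have hH : ContDiffOn ℝ ∞ (fun p => h (θ p)) (baseOpens U) :=
    hh.comp hθ fun p hp' => (hp p hp').2.1
  have hh' : ContDiffOn ℝ ∞ (fun p => deriv h (θ p)) (baseOpens U) :=
    (hh.deriv_of_isOpen hI (by simp)).comp hθ fun p hp' => (hp p hp').2.1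
  have hchain : ∀ p ∈ baseOpens U, ∀ v, fderiv ℝ (fun q => h (θ q)) p v
      = deriv h (θ p) * fderiv ℝ θ p v := by
    intro p hp' v
    have e1 : HasDerivAt h (deriv h (θ p)) (θ p) :=
      ((hh.contDiffAt (hI.mem_nhds (hp p hp').2.1)).differentiableAt (by simp)).hasDerivAt
    have := (e1.comp_hasFDerivAt p (differentiableAt_of_smooth hθ hp').hasFDerivAt).fderiv
    rw [show (fun q => h (θ q)) = h ∘ θ from rfl, this]
    simp
  have hrel := theta_relations (T := dt' (baseOpens U)) (X := dx' (baseOpens U)) (dir_comm _ _)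
    (f := sm f hf.1) (ξ := sm _ hξ) (θ := sm θ hθ) (H := sm _ hH) (h' := sm _ hh')
    (isUnit_of_ne_zero fun p hp' => by simpa using (hp p hp').1)
    (smoothAlg_ext fun p hp' => by
      have := hp p hp'
      simp [this.2.2.2, div_mul_cancel₀ _ this.1])
    (smoothAlg_ext fun p hp' => by
      have := hp p hp'
      simp [div_mul_cancel₀ _ this.1])
    (smoothAlg_ext fun p hp' => by
      obtain ⟨h1, -, h2, -⟩ := hp p hp'
      simp only [dt'_sm, dx'_sm, val_mul, val_sm, val_add, val_pow]
      rw [h2]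
      field_simp)
    (smoothAlg_ext fun p hp' => by
      simp only [dx'_sm, val_mul, val_sm]
      exact hchain p hp' (0, 1))
    (smoothAlg_ext fun p hp' => by
      simp only [dt'_sm, val_mul, val_sm]
      exact hchain p hp' (1, 0))
  have h0 : sm (fun _ : Space => (0 : ℝ)) (D := U) contDiffOn_const = 0 := rfl
  refine regular_of_determining hf
    (ξ := fun P => -(dt θ (proj P) / dx θ (proj P))) (η := fun _ => 0)
    (hξ.comp contDiff_proj.contDiffOn fun P hP => proj_mem hP) contDiffOn_const ?_ hQ
  rw [h0, ← lift_sm hξ]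
  refine determining_of_inertial (setting hf) (dU_lift _) ?_ ?_
  · simpa using congrArg (lift U) hrel.1
  · simpa using congrArg (lift U) hrel.2

/-! ### Cubic operators built from solutions of the Burgers equation -/

theorem det3_eq (a b c : Fin 3 → ℝ) : det3 a b c =
    a 0 * (b 1 * c 2 - c 1 * b 2) - b 0 * (a 1 * c 2 - c 1 * a 2)
      + c 0 * (a 1 * b 2 - b 1 * a 2) := by
  simp only [det3, Matrix.det_fin_three, Matrix.of_apply, Matrix.cons_val]
  ring

section Burgers

variable {D : Opens Plane} {u : Fin 3 → Plane → ℝ}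

theorem smooth_yOf {v : Plane → ℝ} (hv : ContDiffOn ℝ ∞ v D) : ContDiffOn ℝ ∞ (yOf v) D :=
  (contDiffOn_const.mul (smooth_dx hv)).add (hv.pow 2)

theorem smooth_zOf {v : Plane → ℝ} (hv : ContDiffOn ℝ ∞ v D) : ContDiffOn ℝ ∞ (zOf v) D :=
  ((contDiffOn_const.mul (smooth_dx (smooth_dx hv))).add
    ((contDiffOn_const.mul hv).mul (smooth_dx hv))).add (hv.pow 3)

theorem smooth_det3 {a b c : Plane → Fin 3 → ℝ} (ha : ∀ i, ContDiffOn ℝ ∞ (fun p => a p i) D)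
    (hb : ∀ i, ContDiffOn ℝ ∞ (fun p => b p i) D) (hc : ∀ i, ContDiffOn ℝ ∞ (fun p => c p i) D) :
    ContDiffOn ℝ ∞ (fun p => det3 (a p) (b p) (c p)) D := by
  simp only [det3_eq]
  exact ((((ha 0).mul (((hb 1).mul (hc 2)).sub ((hc 1).mul (hb 2)))).sub
    ((hb 0).mul (((ha 1).mul (hc 2)).sub ((hc 1).mul (ha 2))))).add
    ((hc 0).mul (((ha 1).mul (hb 2)).sub ((hb 1).mul (ha 2)))))

/-- Cramer's rule: the functions `ξ⁰`, `η¹`, `η⁰` are the coefficients in the linear relation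
between the columns `z`, `y`, `u` and `(1, 1, 1)`. -/
theorem cramer_relation {p : Plane} (h : denDet u p ≠ 0) (i : Fin 3) :
    zOf (u i) p = 2 * xi0Of u p * yOf (u i) p - 4 * eta1Of u p * u i p - 4 * eta0Of u p := by
  simp only [xi0Of, eta1Of, eta0Of]
  field_simp
  simp only [denDet, det3_eq]
  fin_cases i <;> simp only [Fin.zero_eta, Fin.mk_one, Fin.reduceFinMk] <;> ring

/-- The functions `ξ⁰`, `η¹`, `η⁰` satisfy the cubic system: by `heat_relation`, the left-hand sides
of the system are the coefficients of linear relations between the columns `y`, `u` and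
`(1, 1, 1)`, which are independent. -/
theorem burgers_system (hu : ∀ i, IsSolution (fun _ => 1) (u i) D)
    (hΔ : ∀ p ∈ D, denDet u p ≠ 0) :
    ∃ (h2 : ContDiffOn ℝ ∞ (xi0Of u) D) (h1 : ContDiffOn ℝ ∞ (eta1Of u) D)
      (h0 : ContDiffOn ℝ ∞ (eta0Of u) D),
      CubicSystem (dt' D) (dx' D) 1 (sm _ h2) (sm _ h1) (sm _ h0) := by
  have su : ∀ i, ContDiffOn ℝ ∞ (fun p => u i p) D := fun i => (hu i).1
  have sy : ∀ i, ContDiffOn ℝ ∞ (fun p => yOf (u i) p) D := fun i => smooth_yOf (su i)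
  have sz : ∀ i, ContDiffOn ℝ ∞ (fun p => zOf (u i) p) D := fun i => smooth_zOf (su i)
  have s1 : ∀ _ : Fin 3, ContDiffOn ℝ ∞ (fun _ : Plane => (1 : ℝ)) D := fun _ => contDiffOn_const
  have sΔ : ContDiffOn ℝ ∞ (denDet u) D := smooth_det3 s1 su sy
  have h2 : ContDiffOn ℝ ∞ (xi0Of u) D :=
    contDiffOn_const.mul ((smooth_det3 s1 su sz).div sΔ hΔ)
  have h1 : ContDiffOn ℝ ∞ (eta1Of u) D :=
    contDiffOn_const.mul ((smooth_det3 s1 sy sz).div sΔ hΔ)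
  have h0 : ContDiffOn ℝ ∞ (eta0Of u) D :=
    contDiffOn_const.mul ((smooth_det3 su sy sz).div sΔ hΔ)
  refine ⟨h2, h1, h0, ?_⟩
  have hTX : ∀ a, dt' D (dx' D a) = dx' D (dt' D a) := dir_comm _ _
  have hy : ∀ i, sm _ (sy i) = 2 * dx' D (sm _ (su i)) + sm _ (su i) ^ 2 := fun i =>
    smoothAlg_ext fun p hp => by simp [yOf]
  have hz : ∀ i, sm _ (sz i) = 2 * dx' D (sm _ (sy i)) + sm _ (su i) * sm _ (sy i) := by
    intro i
    rw [hy]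
    simp only [map_add, der_mul, der_sq, der_ofNat]
    refine smoothAlg_ext fun p hp => ?_
    simp [zOf]
    ring
  have Ku : ∀ i, dt' D (sm _ (su i)) + sm _ (su i) * dx' D (sm _ (su i))
      + dx' D (dx' D (sm _ (su i))) = 0 := fun i => smoothAlg_ext fun p hp => by
    simpa [lhs, jetOf] using (hu i).2 p hp
  have Ky : ∀ i, dt' D (sm _ (sy i)) + sm _ (su i) * dx' D (sm _ (sy i))
      + dx' D (dx' D (sm _ (sy i))) = 0 := fun i => by
    rw [hy, pow_two]
    exact heat_step _ _ hTX (Ku i) (Ku i)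
  have Kz : ∀ i, dt' D (sm _ (sz i)) + sm _ (su i) * dx' D (sm _ (sz i))
      + dx' D (dx' D (sm _ (sz i))) = 0 := fun i => by
    rw [hz]
    exact heat_step _ _ hTX (Ku i) (Ky i)
  have hr : ∀ i, sm _ (sz i) = 2 * sm _ h2 * sm _ (sy i) - 4 * sm _ h1 * sm _ (su i)
      - 4 * sm _ h0 := fun i => smoothAlg_ext fun p hp => by
    simpa using cramer_relation (hΔ p hp) i
  have key := fun i => heat_relation _ _ (Ku i) (Ky i) (Kz i) (hy i) (hz i) (hr i)
  have main : ∀ A B C : smoothAlg D, (∀ i, A * sm _ (sy i) - 2 * B * sm _ (su i) - 2 * C = 0) →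
      A = 0 ∧ B = 0 ∧ C = 0 := by
    intro A B C h
    have hp : ∀ p (hp : p ∈ D), val A p hp = 0 ∧ val B p hp = 0 ∧ val C p hp = 0 := by
      intro p hp
      have e := fun i => congrArg (fun c => val c p hp) (h i)
      simp only [val_sub, val_mul, val_sm, val_ofNat, val_zero] at e
      have hd := hΔ p hp
      simp only [denDet, det3_eq] at hd
      have e0 := e 0
      have e1 := e 1
      have e2 := e 2
      refine ⟨(mul_eq_zero.1 (?_ : _ * val A p hp = 0)).resolve_left hd,
        (mul_eq_zero.1 (?_ : _ * val B p hp = 0)).resolve_left hd,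
        (mul_eq_zero.1 (?_ : _ * val C p hp = 0)).resolve_left hd⟩
      · linear_combination (u 2 p - u 1 p) * e0 + (u 0 p - u 2 p) * e1 + (u 1 p - u 0 p) * e2
      · linear_combination (1 / 2) * ((yOf (u 2) p - yOf (u 1) p) * e0
          + (yOf (u 0) p - yOf (u 2) p) * e1 + (yOf (u 1) p - yOf (u 0) p) * e2)
      · linear_combination (-1 / 2) * ((u 1 p * yOf (u 2) p - yOf (u 1) p * u 2 p) * e0
          + (u 2 p * yOf (u 0) p - yOf (u 2) p * u 0 p) * e1
          + (u 0 p * yOf (u 1) p - yOf (u 0) p * u 1 p) * e2)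
    exact ⟨smoothAlg_ext fun p hp' => (hp p hp').1, smoothAlg_ext fun p hp' => (hp p hp').2.1,
      smoothAlg_ext fun p hp' => (hp p hp').2.2⟩
  obtain ⟨r2, r1, r0⟩ := main _ _ _ key
  exact ⟨by linear_combination r2, by linear_combination r1, by linear_combination r0⟩

end Burgers

theorem CubicSystem.lift {U : Opens Space} {f a b c : smoothAlg (baseOpens U)}
    (h : CubicSystem (dt' _) (dx' _) f a b c) :
    CubicSystem (dT U) (dX U) (lift U f) (lift U a) (lift U b) (lift U c) := by
  refine ⟨?_, ?_, ?_⟩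
  · have := congrArg (GBE.lift U) h.s2
    simp only [map_add, map_sub, map_mul, map_zero, map_ofNat] at this
    simpa only [dT_lift, dX_lift] using this
  · have := congrArg (GBE.lift U) h.s1
    simp only [map_add, map_mul, map_zero, map_ofNat] at this
    simpa only [dT_lift, dX_lift] using this
  · have := congrArg (GBE.lift U) h.s0
    simp only [map_add, map_mul, map_zero, map_ofNat] at this
    simpa only [dT_lift, dX_lift] using this

theorem regular_of_burgers {U : Opens Space} {f : Plane → ℝ} {Q : VField}
    (hf : InClass f (baseOpens U)) (h : IsBurgersOperator f Q U) :
    IsRegularReductionOperator f Q U := by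
  obtain ⟨hf1, u, hu, hΔ, hQ⟩ := h
  obtain ⟨h2, h1, h0, hS⟩ := burgers_system (D := baseOpens U) hu hΔ
  have hF : sm f hf.1 = 1 := smoothAlg_ext fun p hp => by simpa using hf1 p hp
  have s2 : ContDiffOn ℝ ∞ (fun P : Space => xi0Of u (proj P)) U :=
    h2.comp contDiff_proj.contDiffOn fun P hP => proj_mem hP
  have s1 : ContDiffOn ℝ ∞ (fun P : Space => eta1Of u (proj P)) U :=
    h1.comp contDiff_proj.contDiffOn fun P hP => proj_mem hP
  have s0 : ContDiffOn ℝ ∞ (fun P : Space => eta0Of u (proj P)) U :=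
    h0.comp contDiff_proj.contDiffOn fun P hP => proj_mem hP
  have su : ContDiffOn ℝ ∞ (fun P : Space => P.2.2) U := by fun_prop
  refine regular_of_determining hf (ξ := (cubicOperator (xi0Of u) (eta1Of u) (eta0Of u)).ξ)
    (η := (cubicOperator (xi0Of u) (eta1Of u) (eta0Of u)).η)
    ((contDiffOn_const.mul su).add s2)
    ((((contDiffOn_const.mul (su.pow 3)).sub ((contDiffOn_const.mul s2).mul (su.pow 2))).add
      (s1.mul su)).add s0) ?_ (fun P hP => ?_)
  · refine (determining_cubic_iff (setting hf) (ξ₀ := lift U (sm _ h2)) (η₁ := lift U (sm _ h1))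
      (η₀ := lift U (sm _ h0)) ?_ ?_ (dU_lift _) (dU_lift _) (dU_lift _) ?_ ?_).2 ?_
    · rw [hF, map_one, Derivation.map_one_eq_zero]
    · rw [hF, map_one, Derivation.map_one_eq_zero]
    · refine smoothAlg_ext fun P hP => ?_
      simp [cubicOperator, proj]
      ring
    · rw [hF, map_one]
      refine smoothAlg_ext fun P hP => ?_
      simp [cubicOperator, proj]
      ring
    · rw [hF]
      exact hS.lift
  · have := hQ P hP
    simp only [VField.vec, Prod.mk.injEq] at this
    exact this

theorem regular_of_listed {U : Opens Space} {f : Plane → ℝ} {Q : VField}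
    (hf : InClass f (baseOpens U)) (h : IsListed f Q U) :
    IsRegularReductionOperator f Q U := by
  rcases h with h | h | h | h
  · exact regular_of_common hf h
  · exact regular_of_lie h.1 h.2
  · exact regular_of_theta hf h
  · exact regular_of_burgers hf h

/-! ### The value of `f` for cubic operators -/

theorem pu_of_cubic_line {a : Space → ℝ} {P : Space} (ha : DifferentiableAt ℝ a P)
    {c₃ c₂ c₁ c₀ : ℝ} (h : ∀ᶠ s in nhds P.2.2,
      a (P.1, P.2.1, s) = c₃ * s ^ 3 + c₂ * s ^ 2 + c₁ * s + c₀) :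
    pu a P = 3 * c₃ * P.2.2 ^ 2 + 2 * c₂ * P.2.2 + c₁ := by
  have h1 : HasDerivAt (fun s : ℝ => (P.1, P.2.1, s)) ((0, 0, 1) : Space) P.2.2 :=
    (hasDerivAt_const _ _).prodMk ((hasDerivAt_const _ _).prodMk (hasDerivAt_id _))
  have h2 : HasDerivAt (fun s : ℝ => a (P.1, P.2.1, s)) (pu a P) P.2.2 :=
    HasFDerivAt.comp_hasDerivAt (f := fun s : ℝ => ((P.1, P.2.1, s) : Space)) P.2.2
      ha.hasFDerivAt h1
  have h3 : HasDerivAt (fun s : ℝ => c₃ * s ^ 3 + c₂ * s ^ 2 + c₁ * s + c₀)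
      (3 * c₃ * P.2.2 ^ 2 + 2 * c₂ * P.2.2 + c₁) P.2.2 := by
    have := ((((hasDerivAt_pow 3 P.2.2).const_mul c₃).add
      ((hasDerivAt_pow 2 P.2.2).const_mul c₂)).add
      ((hasDerivAt_id P.2.2).const_mul c₁)).add_const c₀
    exact this.congr_deriv (by norm_num; ring)
  exact h2.unique (h3.congr_of_eventuallyEq h)

theorem eventually_line_mem (U : Opens Space) {P : Space} (hP : P ∈ U) :
    ∀ᶠ s in nhds P.2.2, ((P.1, P.2.1, s) : Space) ∈ U := by
  have : Continuous fun s : ℝ => ((P.1, P.2.1, s) : Space) := by fun_prop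
  exact this.continuousAt.eventually (U.isOpen.mem_nhds (by exact hP))

/-- For a cubic operator, `ξ_u = -1/2` and `η_uuu = 3/2`, and `Determining.third` gives `f = 1`. -/
theorem cubic_only_one {U : Opens Space} {f ξ0 η1 η0 : Plane → ℝ} (hf : InClass f (baseOpens U))
    (h : IsRegularReductionOperator f (cubicOperator ξ0 η1 η0) U) :
    ∀ p ∈ baseOpens U, f p = 1 := by
  rintro _ ⟨P, hP, rfl⟩
  obtain ⟨⟨-, hξ, hη⟩, -, hcrit⟩ := h
  have hdet := (criterion_iff hξ hη hf).1 hcrit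
  have h3 := congrArg (fun c => val c P hP) (hdet.third (setting hf))
  have eξ : ∀ P ∈ U, pu (cubicOperator ξ0 η1 η0).ξ P = -(1 / 2) := by
    intro P hP
    rw [pu_of_cubic_line (differentiableAt_of_smooth hξ hP) (c₃ := 0) (c₂ := 0) (c₁ := -(1 / 2))
      (c₀ := ξ0 (P.1, P.2.1)) (Filter.Eventually.of_forall fun s => by simp [cubicOperator])]
    ring
  have e1 : ∀ P ∈ U, pu (cubicOperator ξ0 η1 η0).η P
      = 3 / 4 * P.2.2 ^ 2 - ξ0 (P.1, P.2.1) * P.2.2 + η1 (P.1, P.2.1) := by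
    intro P hP
    rw [pu_of_cubic_line (differentiableAt_of_smooth hη hP) (c₃ := 1 / 4)
      (c₂ := -(1 / 2) * ξ0 (P.1, P.2.1)) (c₁ := η1 (P.1, P.2.1)) (c₀ := η0 (P.1, P.2.1))
      (Filter.Eventually.of_forall fun s => by simp [cubicOperator]; ring)]
    ring
  have e2 : ∀ P ∈ U, pu (pu (cubicOperator ξ0 η1 η0).η) P
      = 3 / 2 * P.2.2 - ξ0 (P.1, P.2.1) := by
    intro P hP
    rw [pu_of_cubic_line (differentiableAt_of_smooth (smooth_pu hη) hP) (c₃ := 0)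
      (c₂ := 3 / 4) (c₁ := -ξ0 (P.1, P.2.1)) (c₀ := η1 (P.1, P.2.1))
      ((eventually_line_mem U hP).mono fun s hs => by rw [e1 _ hs]; ring)]
    ring
  have e3 : pu (pu (pu (cubicOperator ξ0 η1 η0).η)) P = 3 / 2 := by
    rw [pu_of_cubic_line (differentiableAt_of_smooth (smooth_pu (smooth_pu hη)) hP) (c₃ := 0)
      (c₂ := 0) (c₁ := 3 / 2) (c₀ := -ξ0 (P.1, P.2.1))
      ((eventually_line_mem U hP).mono fun s hs => by rw [e2 _ hs]; ring)]
    ring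
  simp only [dU_sm, val_add, val_mul, val_sub, val_sm, val_lift, val_ofNat, val_one, val_zero,
    eξ P hP, e3] at h3
  change f (proj P) = 1
  linarith

/-! ### The equivalence group -/

namespace EquivTransf

variable (g : EquivTransf)

/-- The determinant of the fractional linear transformation of `t`. -/
def det : ℝ := g.α * g.δ - g.β * g.γ

theorem det_ne_zero : g.det ≠ 0 := g.det_ne

/-- The numerator of the `t`-derivative of the `x`-component of the transformation. -/
def shift (x : ℝ) : ℝ := g.μ₁ * g.δ - g.μ₀ * g.γ - g.κ * g.γ * x

theorem contDiffOn_planeMap {D : Set Plane} (hd : ∀ p ∈ D, g.denom p.1 ≠ 0) :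
    ContDiffOn ℝ ∞ g.planeMap D := by
  unfold planeMap denom
  unfold denom at hd
  exact (ContDiffOn.div (by fun_prop) (by fun_prop) hd).prodMk
    (ContDiffOn.div (by fun_prop) (by fun_prop) hd)

theorem fderiv_planeMap {p : Plane} (hd : g.denom p.1 ≠ 0) (v : Plane) :
    fderiv ℝ g.planeMap p v = (g.det / g.denom p.1 ^ 2 * v.1,
      g.κ / g.denom p.1 * v.2 + g.shift p.2 / g.denom p.1 ^ 2 * v.1) := by
  have h1 : HasFDerivAt (fun q : Plane => q.1) (ContinuousLinearMap.fst ℝ ℝ ℝ) p := hasFDerivAt_fst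
  have h2 : HasFDerivAt (fun q : Plane => q.2) (ContinuousLinearMap.snd ℝ ℝ ℝ) p := hasFDerivAt_snd
  have hD : HasFDerivAt (fun q : Plane => g.γ * q.1 + g.δ) _ p := (h1.const_mul g.γ).add_const _
  have hI := (hasDerivAt_inv hd).comp_hasFDerivAt p hD
  have e1 := ((h1.const_mul g.α).add_const g.β).mul hI
  have e2 := (((h2.const_mul g.κ).add (h1.const_mul g.μ₁)).add_const g.μ₀).mul hI
  have e := (e1.prodMk e2).fderiv
  have : g.planeMap = fun q : Plane => ((g.α * q.1 + g.β) / (g.γ * q.1 + g.δ),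
    (g.κ * q.2 + g.μ₁ * q.1 + g.μ₀) / (g.γ * q.1 + g.δ)) := rfl
  unfold denom at hd ⊢
  rw [this]
  refine (congrArg (fun L => L v) e).trans ?_
  ext
  · simp [det, denom]
    field_simp
    ring
  · simp [shift, denom]
    field_simp
    ring

theorem fderiv_map {P : Space} (hd : g.denom P.1 ≠ 0) (v : Space) :
    fderiv ℝ g.map P v = (g.det / g.denom P.1 ^ 2 * v.1,
      g.κ / g.denom P.1 * v.2.1 + g.shift P.2.1 / g.denom P.1 ^ 2 * v.1,
      g.κ * (g.γ * P.2.2 * v.1 + g.denom P.1 * v.2.2 - g.γ * v.2.1) / g.det) := by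
  have hp : HasFDerivAt (fun Q : Space => g.planeMap (proj Q))
      ((fderiv ℝ g.planeMap (proj P)).comp (fderiv ℝ proj P)) P := by
    have hs := g.contDiffOn_planeMap (D := {p : Plane | g.denom p.1 ≠ 0}) fun p hp => hp
    have hc : Continuous fun p : Plane => g.denom p.1 := by unfold denom; fun_prop
    have ho : IsOpen {p : Plane | g.denom p.1 ≠ 0} := isOpen_ne_fun hc continuous_const
    have h1 : DifferentiableAt ℝ g.planeMap (proj P) :=
      (hs.contDiffAt (ho.mem_nhds hd)).differentiableAt (by simp)
    have h2 : DifferentiableAt ℝ proj P := contDiff_proj.differentiable (by simp) P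
    exact h1.hasFDerivAt.comp P h2.hasFDerivAt
  have hproj : ∀ v, fderiv ℝ proj P v = proj v := by
    intro v
    have : HasFDerivAt proj ((ContinuousLinearMap.fst ℝ ℝ (ℝ × ℝ)).prod
      ((ContinuousLinearMap.fst ℝ ℝ ℝ).comp (ContinuousLinearMap.snd ℝ ℝ (ℝ × ℝ)))) P :=
      ((ContinuousLinearMap.fst ℝ ℝ (ℝ × ℝ)).prod
        ((ContinuousLinearMap.fst ℝ ℝ ℝ).comp (ContinuousLinearMap.snd ℝ ℝ (ℝ × ℝ)))).hasFDerivAt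
    rw [this.fderiv]
    rfl
  have h1 : HasFDerivAt (fun q : Space => q.1) (ContinuousLinearMap.fst ℝ ℝ (ℝ × ℝ)) P :=
    hasFDerivAt_fst
  have h2 : HasFDerivAt (fun q : Space => q.2.1) ((ContinuousLinearMap.fst ℝ ℝ ℝ).comp
      (ContinuousLinearMap.snd ℝ ℝ (ℝ × ℝ))) P := hasFDerivAt_snd.fst
  have h3 : HasFDerivAt (fun q : Space => q.2.2) ((ContinuousLinearMap.snd ℝ ℝ ℝ).comp
      (ContinuousLinearMap.snd ℝ ℝ (ℝ × ℝ))) P := hasFDerivAt_snd.snd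
  have hu : HasFDerivAt g.uMap _ P :=
    (((((((h1.const_mul g.γ).add_const g.δ).const_mul g.κ).mul h3).sub
      (h2.const_mul (g.κ * g.γ))).add_const (g.μ₁ * g.δ)).sub_const (g.μ₀ * g.γ)).mul_const
        (g.α * g.δ - g.β * g.γ)⁻¹
  have e := ((hp.fst.prodMk (hp.snd.prodMk hu)).fderiv)
  have hfun : g.map = fun Q : Space =>
      ((g.planeMap (proj Q)).1, (g.planeMap (proj Q)).2, g.uMap Q) := rfl
  rw [hfun]
  refine (congrArg (fun L => L v) e).trans ?_
  have hd' : g.denom (proj P).1 ≠ 0 := hd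
  simp only [ContinuousLinearMap.prod_apply, ContinuousLinearMap.comp_apply, hproj,
    g.fderiv_planeMap hd', ContinuousLinearMap.coe_fst', ContinuousLinearMap.coe_snd']
  ext
  · rfl
  · rfl
  · simp [det, denom]
    ring

theorem isOpen_denom_ne : IsOpen {P : Space | g.denom P.1 ≠ 0} := by
  have : Continuous fun P : Space => g.denom P.1 := by unfold denom; fun_prop
  exact isOpen_ne_fun this continuous_const

theorem contDiffOn_map {U : Set Space} (hd : ∀ P ∈ U, g.denom P.1 ≠ 0) :
    ContDiffOn ℝ ∞ g.map U := by
  have h1 : ContDiffOn ℝ ∞ (fun P : Space => g.planeMap (proj P)) U := by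
    have := g.contDiffOn_planeMap (D := {p : Plane | g.denom p.1 ≠ 0}) fun p hp => hp
    exact this.comp contDiff_proj.contDiffOn fun P hP => hd P hP
  have h2 : ContDiffOn ℝ ∞ g.uMap U := by unfold uMap denom; fun_prop
  exact h1.fst.prodMk (h1.snd.prodMk h2)

/-- Vector fields that are related by a transformation from the group, componentwise. -/
theorem carries_of {U U' : Set Space} {f f' : Plane → ℝ} {Q Q' : VField}
    (hd : ∀ P ∈ U, g.denom P.1 ≠ 0) (hU : Set.MapsTo g.map U U')
    (hf : ∀ p ∈ base U, f' (g.planeMap p) = g.factor * f p)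
    (hτ : ContDiffOn ℝ ∞ Q.τ U) (hτ0 : ∀ P ∈ U, Q.τ P ≠ 0)
    (hτ' : ContDiffOn ℝ ∞ Q'.τ U') (hτ0' : ∀ P ∈ U', Q'.τ P ≠ 0)
    (hξ : ∀ P ∈ U, Q'.ξ (g.map P) = Q'.τ (g.map P)
      * ((g.κ * g.denom P.1 * (Q.ξ P / Q.τ P) + g.shift P.2.1) / g.det))
    (hη : ∀ P ∈ U, Q'.η (g.map P) = Q'.τ (g.map P) * (g.κ * g.denom P.1 ^ 2
      * (g.γ * (P.2.2 - Q.ξ P / Q.τ P) + g.denom P.1 * (Q.η P / Q.τ P)) / g.det ^ 2)) :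
    g.Carries f Q U f' Q' U' := by
  refine ⟨hd, hU, hf, fun P => Q.τ P * g.det / (g.denom P.1 ^ 2 * Q'.τ (g.map P)), ?_, ?_⟩
  · have h1 : ContDiffOn ℝ ∞ (fun P : Space => g.denom P.1) U := by unfold denom; fun_prop
    exact (hτ.mul contDiffOn_const).div ((h1.pow 2).mul (hτ'.comp (g.contDiffOn_map hd) hU))
      fun P hP => mul_ne_zero (pow_ne_zero 2 (hd P hP)) (hτ0' _ (hU hP))
  · intro P hP
    have h1 := hd P hP
    have h2 := hτ0 P hP
    have h3 := hτ0' _ (hU hP)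
    have h4 := g.det_ne_zero
    refine ⟨by positivity, ?_⟩
    rw [g.fderiv_map h1]
    ext
    · simp only [VField.vec, Prod.smul_mk, smul_eq_mul]
      field_simp
    · simp only [VField.vec, Prod.smul_mk, smul_eq_mul, hξ P hP]
      field_simp
    · simp only [VField.vec, Prod.smul_mk, smul_eq_mul, hη P hP]
      field_simp
      ring

/-- The inverse transformation. -/
noncomputable def inv : EquivTransf where
  α := g.δ
  β := -g.β
  γ := -g.γ
  δ := g.α
  κ := g.det / g.κ
  μ₀ := (g.μ₁ * g.β - g.μ₀ * g.α) / g.κ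
  μ₁ := -(g.μ₁ * g.δ - g.μ₀ * g.γ) / g.κ
  det_ne := by
    have := g.det_ne
    contrapose! this
    linarith
  κ_ne := div_ne_zero g.det_ne_zero g.κ_ne

theorem inv_denom {p : Plane} (hd : g.denom p.1 ≠ 0) :
    g.inv.denom (g.planeMap p).1 = g.det / g.denom p.1 := by
  unfold denom at hd
  simp only [inv, denom, planeMap, det]
  field_simp
  ring

theorem inv_planeMap {p : Plane} (hd : g.denom p.1 ≠ 0) : g.inv.planeMap (g.planeMap p) = p := by
  have h := g.inv_denom hd
  have hκ := g.κ_ne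
  have hΔ := g.det_ne_zero
  unfold planeMap at h ⊢
  simp only at h ⊢
  rw [h]
  ext
  · simp only [inv]
    field_simp
    simp only [det, denom]
    ring
  · simp only [inv]
    field_simp
    simp only [det, denom]
    ring

section Pullback

variable {D D' : Opens Plane} (hd : ∀ p ∈ D, g.denom p.1 ≠ 0) (h : Set.MapsTo g.planeMap D D')

/-- The pullback of functions of `(t, x)` along a transformation from the group. -/
noncomputable def pullback : smoothAlg D' →ₐ[ℝ] smoothAlg D :=
  pull g.planeMap (g.contDiffOn_planeMap hd) h

theorem val_dx'_pullback (a : smoothAlg D') (p : Plane) (hp : p ∈ D) :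
    val (dx' D (g.pullback hd h a)) p hp
      = g.κ / g.denom p.1 * val (dx' D' a) (g.planeMap p) (h hp) := by
  have s : ContDiffOn ℝ ∞ (fun p : Plane => g.κ / g.denom p.1) D :=
    contDiffOn_const.div (by unfold denom; fun_prop) hd
  have := dir_pull (ι := Fin 1) g.planeMap (g.contDiffOn_planeMap hd) h (0, 1)
    (fun _ => sm _ s) (fun _ => (0, 1)) (fun p hp => by
      rw [g.fderiv_planeMap (hd p hp)]
      simp) a
  exact (congrArg (fun c => val c p hp) this).trans (by simp)

theorem val_dt'_pullback (a : smoothAlg D') (p : Plane) (hp : p ∈ D) :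
    val (dt' D (g.pullback hd h a)) p hp
      = g.det / g.denom p.1 ^ 2 * val (dt' D' a) (g.planeMap p) (h hp)
        + g.shift p.2 / g.denom p.1 ^ 2 * val (dx' D' a) (g.planeMap p) (h hp) := by
  have sd : ContDiffOn ℝ ∞ (fun p : Plane => g.denom p.1 ^ 2) D := by unfold denom; fun_prop
  have s1 : ContDiffOn ℝ ∞ (fun p : Plane => g.det / g.denom p.1 ^ 2) D :=
    contDiffOn_const.div sd fun p hp => pow_ne_zero 2 (hd p hp)
  have s2 : ContDiffOn ℝ ∞ (fun p : Plane => g.shift p.2 / g.denom p.1 ^ 2) D :=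
    ContDiffOn.div (by unfold shift; fun_prop) sd fun p hp => pow_ne_zero 2 (hd p hp)
  have := dir_pull g.planeMap (g.contDiffOn_planeMap hd) h (1, 0)
    ![sm _ s1, sm _ s2] ![(1, 0), (0, 1)] (fun p hp => by
      rw [g.fderiv_planeMap (hd p hp)]
      simp) a
  exact (congrArg (fun c => val c p hp) this).trans (by simp)

end Pullback

/-- If the graph of `u` is mapped to the graph of `u'`, then the left-hand sides of the two
equations differ by a nonvanishing multiplier. -/
theorem preservesClass : g.PreservesClass := by
  intro D D' f f' u u' hD hD' hd h hf hff hu hu' huu p hp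
  lift D to Opens Plane using hD
  lift D' to Opens Plane using hD'
  have hκ := g.κ_ne
  have hΔ := g.det_ne_zero
  have hdp := hd p hp
  have sx : ContDiffOn ℝ ∞ (fun p : Plane => p.2) D := by fun_prop
  have sd : ContDiffOn ℝ ∞ (fun p : Plane => g.denom p.1) D := by unfold denom; fun_prop
  have d0 : ∀ q v, fderiv ℝ (fun p : Plane => g.denom p.1) q v = g.γ * v.1 := by
    intro q v
    have : HasFDerivAt (fun q : Plane => g.γ * q.1 + g.δ) _ q :=
      ((hasFDerivAt_fst (𝕜 := ℝ) (p := q)).const_mul g.γ).add_const _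
    exact congrArg (fun L => L v) this.fderiv
  have d1 : ∀ (q v : Plane), fderiv ℝ (fun p : Plane => p.2) q v = v.2 := by
    intro q v
    have : HasFDerivAt (fun p : Plane => p.2) (ContinuousLinearMap.snd ℝ ℝ ℝ) q := hasFDerivAt_snd
    rw [this.fderiv]
    rfl
  set A := g.pullback hd h (sm u' hu') with hA
  have e0 : g.det • A = g.κ • (sm _ sd * sm u hu) - (g.κ * g.γ) • sm _ sx
      + algebraMap ℝ _ (g.μ₁ * g.δ - g.μ₀ * g.γ) := by
    refine smoothAlg_ext fun q hq => ?_
    have := huu q hq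
    simp only [uMap] at this
    simp only [hA, pullback, val_smul, val_pull, val_sm, val_sub, val_add, val_mul,
      val_algebraMap, this]
    simp only [det] at hΔ ⊢
    field_simp
    ring
  have ex : ∀ v, g.det • dir v A = g.κ • (sm _ sd * dir v (sm u hu) + sm u hu * dir v (sm _ sd))
      - (g.κ * g.γ) • dir v (sm _ sx) := by
    intro v
    have := congrArg (dir v) e0
    simpa only [map_add, map_sub, Derivation.map_smul, der_mul, Derivation.map_algebraMap,
      sub_zero, add_zero] using this
  have eX : g.det • dx' D A = g.κ • (sm _ sd * dx' D (sm u hu))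
      - algebraMap ℝ _ (g.κ * g.γ) := by
    rw [dx', ex]
    refine smoothAlg_ext fun q hq => ?_
    simp [dir_sm, d0, d1]
  have eXX : g.det • dx' D (dx' D A) = g.κ • (sm _ sd * dx' D (dx' D (sm u hu))) := by
    have := congrArg (dx' D) eX
    simp only [map_sub, Derivation.map_smul, der_mul, Derivation.map_algebraMap, sub_zero] at this
    rw [this]
    refine smoothAlg_ext fun q hq => ?_
    have : dx (fun p : Plane => g.denom p.1) q = 0 := by simp [dx, d0]
    simp [this]
  have vT := congrArg (fun c => val c p hp) (ex (1, 0))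
  have vX := congrArg (fun c => val c p hp) eX
  have vXX := congrArg (fun c => val c p hp) eXX
  have cX : sm _ sd * dx' D A = g.κ • g.pullback hd h (dx' D' (sm u' hu')) := by
    refine smoothAlg_ext fun q hq => ?_
    have hdq := hd q hq
    rw [val_mul, val_dx'_pullback]
    simp [pullback]
    field_simp
  have cXX := congrArg (fun c => val c p hp) (congrArg (dx' D) cX)
  have cT := g.val_dt'_pullback hd h (sm u' hu') p hp
  have cX := congrArg (fun c => val c p hp) cX
  have c0 := congrArg (fun c => val c p hp) e0
  simp only [der_mul, Derivation.map_smul, val_smul, val_add, val_mul, val_dx'_pullback] at cXX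
  simp only [val_smul, val_add, val_sub, val_mul, val_algebraMap, dir_sm, val_sm, d0, d1,
    mul_one, mul_zero, sub_zero, hA, pullback, val_pull] at vT vX vXX cX cXX cT c0
  set XA := val (dx' D (pull g.planeMap (g.contDiffOn_planeMap hd) h (sm u' hu'))) p hp
  set TA := val (dt' D (pull g.planeMap (g.contDiffOn_planeMap hd) h (sm u' hu'))) p hp
  set XXA := val (dx' D (dx' D (pull g.planeMap (g.contDiffOn_planeMap hd) h (sm u' hu')))) p hp
  change g.det * TA = g.κ * (g.denom p.1 * dt u p + u p * g.γ) at vT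
  change g.det * XA = g.κ * (g.denom p.1 * dx u p) - g.κ * g.γ at vX
  change g.det * XXA = g.κ * (g.denom p.1 * dx (dx u) p) at vXX
  change g.denom p.1 * XA = g.κ * dx u' (g.planeMap p) at cX
  change g.denom p.1 * XXA + 0
    = g.κ * (g.κ / g.denom p.1 * dx (dx u') (g.planeMap p)) at cXX
  change TA = g.det / g.denom p.1 ^ 2 * dt u' (g.planeMap p)
    + g.shift p.2 / g.denom p.1 ^ 2 * dx u' (g.planeMap p) at cT
  have r1 : g.det * dx u' (g.planeMap p) = g.denom p.1 * (g.denom p.1 * dx u p - g.γ) :=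
    mul_left_cancel₀ hκ (by linear_combination g.denom p.1 * vX - g.det * cX)
  have r2 : g.det * g.κ ^ 2 * dx (dx u') (g.planeMap p)
      = g.κ * g.denom p.1 ^ 3 * dx (dx u) p := by
    field_simp at cXX
    linear_combination g.denom p.1 ^ 2 * vXX - g.det * cXX
  have r0 : g.denom p.1 ^ 2 * TA = g.det * dt u' (g.planeMap p)
      + g.shift p.2 * dx u' (g.planeMap p) := by
    rw [cT]
    field_simp
  have key : g.det ^ 2 * lhs f' (jetOf u' (g.planeMap p))
      = g.κ * g.denom p.1 ^ 3 * lhs f (jetOf u p) := by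
    have hF : g.det * f' (g.planeMap p) = g.κ ^ 2 * f p := by
      rw [hff p hp]
      exact (by simp only [factor, det] at hΔ ⊢; field_simp)
    change g.det ^ 2 * (dt u' (g.planeMap p) + u' (g.planeMap p) * dx u' (g.planeMap p)
      + f' (g.planeMap p) * dx (dx u') (g.planeMap p)) = g.κ * g.denom p.1 ^ 3 *
      (dt u p + u p * dx u p + f p * dx (dx u) p)
    unfold shift at r0
    linear_combination (-g.det) * r0 + g.denom p.1 ^ 2 * vT
      + (g.det * dx u' (g.planeMap p)) * c0 + g.κ * g.denom p.1 * u p * r1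
      + g.det * dx (dx u') (g.planeMap p) * hF + f p * r2
  constructor
  · intro h0
    rw [h0, mul_zero] at key
    exact (mul_eq_zero.1 key).resolve_left (pow_ne_zero 2 hΔ)
  · intro h0
    rw [h0, mul_zero] at key
    exact (mul_eq_zero.1 key.symm).resolve_left (mul_ne_zero hκ (pow_ne_zero 3 hdp))

end EquivTransf

theorem exists_factor (c : ℝ) (hc : c ≠ 0) : ∃ g : EquivTransf, g.factor * c = 1 :=
  ⟨⟨c, 0, 0, 1, 1, 0, 0, by simpa using hc, one_ne_zero⟩, by
    simp [EquivTransf.factor, hc]⟩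

/-! ### Localization -/

/-- Near the point `P`, the pair (`L_f`, `Q`) over `U` is equivalent to a listed one. -/
def LocallyListed (f : Plane → ℝ) (Q : VField) (U : Set Space) (P : Space) : Prop :=
  ∃ (g : EquivTransf) (V : Set Space) (f' : Plane → ℝ) (Q' : VField) (V' : Set Space),
    IsOpen V ∧ P ∈ V ∧ V ⊆ U ∧ IsOpen V' ∧ InClass f' (base V') ∧
    g.Carries f Q V f' Q' V' ∧ IsListed f' Q' V'

theorem LocallyListed.mono {f : Plane → ℝ} {Q : VField} {U U' : Set Space} {P : Space}
    (h : LocallyListed f Q U P) (hU : U ⊆ U') : LocallyListed f Q U' P := by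
  obtain ⟨g, V, f', Q', V', h1, h2, h3, h4⟩ := h
  exact ⟨g, V, f', Q', V', h1, h2, h3.trans hU, h4⟩

theorem base_mono {U U' : Set Space} (hU : U ⊆ U') : base U ⊆ base U' := Set.image_mono hU

theorem InClass.mono {f : Plane → ℝ} {D D' : Set Plane} (h : InClass f D') (hD : D ⊆ D') :
    InClass f D :=
  ⟨h.1.mono hD, fun p hp => h.2 p (hD hp)⟩

theorem IsRegularReductionOperator.mono {f : Plane → ℝ} {Q : VField} {U U' : Set Space}
    (h : IsRegularReductionOperator f Q U') (hU : U ⊆ U') : IsRegularReductionOperator f Q U :=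
  ⟨⟨h.1.1.mono hU, h.1.2.1.mono hU, h.1.2.2.mono hU⟩, fun P hP => h.2.1 P (hU hP),
    fun j hj => h.2.2 j (hU hj)⟩

/-- The ball as an open set; in `Plane` and `Space`, which carry the supremum norm, it is a cube. -/
def ballOpens {E : Type*} [NormedAddCommGroup E] (p : E) (r : ℝ) : Opens E :=
  ⟨ball p r, isOpen_ball⟩

theorem mem_ballOpens_self {E : Type*} [NormedAddCommGroup E] {p : E} {r : ℝ} (hr : 0 < r) :
    p ∈ ballOpens p r := mem_ball_self hr

theorem mem_space_ball {P₀ P : Space} {r : ℝ} :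
    P ∈ ball P₀ r ↔ proj P ∈ ball (proj P₀) r ∧ P.2.2 ∈ ball P₀.2.2 r := by
  simp only [mem_ball, Prod.dist_eq, max_lt_iff, proj]
  tauto

theorem baseOpens_ball (P₀ : Space) {r : ℝ} (hr : 0 < r) :
    baseOpens (ballOpens P₀ r) = ballOpens (proj P₀) r := by
  ext p
  constructor
  · rintro ⟨P, hP, rfl⟩
    exact (mem_space_ball.1 hP).1
  · intro hp
    exact ⟨(p.1, p.2, P₀.2.2), mem_space_ball.2 ⟨hp, mem_ball_self hr⟩, rfl⟩

theorem lift_injective (U : Opens Space) : Function.Injective (lift U) := by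
  intro a b h
  refine smoothAlg_ext ?_
  rintro _ ⟨P, hP, rfl⟩
  exact congrArg (fun c => val c P hP) h

/-- On a ball, a function with vanishing `u`-derivative is a function of `(t, x)`. -/
theorem exists_lift {P₀ : Space} {r : ℝ} (a : smoothAlg (ballOpens P₀ r))
    (h : dU _ a = 0) : ∃ a', lift _ a' = a := by
  obtain ⟨a, ha, rfl⟩ := exists_sm a
  rw [dU_sm] at h
  have h0 : ∀ P ∈ ballOpens P₀ r, pu a P = 0 := fun P hP => congrArg (fun c => val c P hP) h
  have hm : ∀ P ∈ ballOpens P₀ r, ((P.1, P.2.1, P₀.2.2) : Space) ∈ ballOpens P₀ r := by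
    intro P hP
    have := mem_space_ball.1 hP
    exact mem_space_ball.2 ⟨this.1, mem_ball_self (pos_of_mem_ball this.2)⟩
  refine ⟨sm (fun p => a (p.1, p.2, P₀.2.2)) (ha.comp (by fun_prop) ?_), ?_⟩
  · rintro _ ⟨P, hP, rfl⟩
    exact hm P hP
  refine smoothAlg_ext fun P hP => ?_
  have hP' := mem_space_ball.1 hP
  have hl : ∀ s ∈ ball P₀.2.2 r, HasDerivAt (fun s : ℝ => a (P.1, P.2.1, s)) 0 s := by
    intro s hs
    have hs' : ((P.1, P.2.1, s) : Space) ∈ ballOpens P₀ r := mem_space_ball.2 ⟨hP'.1, hs⟩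
    have h1 : HasDerivAt (fun s : ℝ => (P.1, P.2.1, s)) ((0, 0, 1) : Space) s :=
      (hasDerivAt_const _ _).prodMk ((hasDerivAt_const _ _).prodMk (hasDerivAt_id _))
    have := HasFDerivAt.comp_hasDerivAt (f := fun s : ℝ => ((P.1, P.2.1, s) : Space)) s
      (differentiableAt_of_smooth ha hs').hasFDerivAt h1
    rw [← h0 _ hs']
    exact this
  have := isOpen_ball.is_const_of_deriv_eq_zero (convex_ball P₀.2.2 r).isPreconnected
    (fun s hs => (hl s hs).differentiableAt.differentiableWithinAt) (fun s hs => (hl s hs).deriv)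
    (mem_ball_self (pos_of_mem_ball hP'.2)) hP'.2
  exact this

/-- By continuity, `ξ_u` is one of the constants `0`, `1`, `-1/2` near each point. -/
theorem exists_slope_ball {U : Opens Space} {f : Plane → ℝ} {Q : VField}
    (hf : InClass f (baseOpens U)) (h : IsRegularReductionOperator f Q U) {P₀ : Space}
    (hP₀ : P₀ ∈ U) : ∃ r, 0 < r ∧ ball P₀ r ⊆ (U : Set Space) ∧ ∃ s : ℝ,
      (s = 0 ∨ s = 1 ∨ s = -1 / 2) ∧ ∀ P ∈ ball P₀ r, pu (fun P => Q.ξ P / Q.τ P) P = s := by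
  obtain ⟨hξ, hη, hdet⟩ := determining_of_regular hf h
  have hs := hdet.slope (setting hf)
  have hval : ∀ P ∈ U, pu (fun P => Q.ξ P / Q.τ P) P = 0 ∨ pu (fun P => Q.ξ P / Q.τ P) P = 1 ∨
      pu (fun P => Q.ξ P / Q.τ P) P = -1 / 2 := by
    intro P hP
    have := congrArg (fun c => val c P hP) hs
    simp only [dU_sm, val_mul, val_sub, val_add, val_sm, val_one, val_ofNat, val_zero,
      mul_eq_zero] at this
    rcases this with (h | h) | h
    · exact Or.inl h
    · exact Or.inr (Or.inl (by linarith))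
    · exact Or.inr (Or.inr (by linarith))
  have hc : ContinuousAt (pu (fun P => Q.ξ P / Q.τ P)) P₀ :=
    ((smooth_pu hξ).continuousOn.continuousAt (U.isOpen.mem_nhds hP₀))
  have he := (hc.eventually (ball_mem_nhds _ (by norm_num : (0 : ℝ) < 1 / 4))).and
    (U.isOpen.mem_nhds hP₀)
  obtain ⟨r, hr, hball⟩ := Metric.eventually_nhds_iff_ball.1 he
  refine ⟨r, hr, fun P hP => (hball P hP).2, _, hval P₀ hP₀, fun P hP => ?_⟩
  obtain ⟨h1, h2⟩ := hball P hP
  rw [Real.dist_eq, abs_lt] at h1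
  rcases hval P h2 with h | h | h <;> rcases hval P₀ hP₀ with h' | h' | h' <;>
    rw [h, h'] at h1 ⊢ <;> exfalso <;> norm_num at h1

/-- The identical transformation. -/
def EquivTransf.refl : EquivTransf := ⟨1, 0, 0, 1, 1, 0, 0, by norm_num, one_ne_zero⟩

theorem EquivTransf.carries_refl {U : Set Space} {f : Plane → ℝ} {Q Q' : VField}
    (hτ : ContDiffOn ℝ ∞ Q.τ U) (hτ0 : ∀ P ∈ U, Q.τ P ≠ 0)
    (hτ' : ContDiffOn ℝ ∞ Q'.τ U) (hτ0' : ∀ P ∈ U, Q'.τ P ≠ 0)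
    (hξ : ∀ P ∈ U, Q'.ξ P = Q'.τ P * (Q.ξ P / Q.τ P))
    (hη : ∀ P ∈ U, Q'.η P = Q'.τ P * (Q.η P / Q.τ P)) :
    EquivTransf.refl.Carries f Q U f Q' U := by
  have hp : ∀ p, EquivTransf.refl.planeMap p = p := fun p => by
    simp [EquivTransf.refl, EquivTransf.planeMap, EquivTransf.denom]
  have hm : ∀ P, EquivTransf.refl.map P = P := fun P => by
    rw [EquivTransf.map, hp]
    simp [EquivTransf.uMap, EquivTransf.denom, EquivTransf.refl]
  refine EquivTransf.refl.carries_of (fun P _ => by simp [EquivTransf.denom, EquivTransf.refl])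
    (fun P hP => by rwa [hm]) (fun p _ => by rw [hp]; simp [EquivTransf.factor, EquivTransf.refl])
    hτ hτ0 hτ' hτ0' (fun P hP => ?_) fun P hP => ?_
  · rw [hm, hξ P hP]
    simp [EquivTransf.denom, EquivTransf.refl, EquivTransf.shift, EquivTransf.det]
  · rw [hm, hη P hP]
    simp [EquivTransf.denom, EquivTransf.refl, EquivTransf.det]

theorem locallyListed_of_slope_one {U : Opens Space} {f : Plane → ℝ} {Q : VField}
    (hf : InClass f (baseOpens U)) (h : IsRegularReductionOperator f Q U)
    (hs : ∀ P ∈ U, pu (fun P => Q.ξ P / Q.τ P) P = 1) {P₀ : Space} (hP₀ : P₀ ∈ U) :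
    LocallyListed f Q U P₀ := by
  obtain ⟨hξ, hη, hdet⟩ := determining_of_regular hf h
  obtain ⟨e1, e2⟩ := hdet.of_slope_one (setting hf) (by
    rw [dU_sm]
    exact smoothAlg_ext fun P hP => hs P hP)
  have e1 : ∀ P ∈ U, Q.ξ P / Q.τ P = P.2.2 := fun P hP => congrArg (fun c => val c P hP) e1
  have e2 : ∀ P ∈ U, Q.η P / Q.τ P = 0 := fun P hP => congrArg (fun c => val c P hP) e2
  refine ⟨EquivTransf.refl, U, f, normalField (fun P => P.2.2) (fun _ => 0), U, U.isOpen, hP₀,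
    subset_rfl, U.isOpen, hf, ?_, Or.inl fun P _ => ⟨rfl, rfl, rfl⟩⟩
  refine EquivTransf.carries_refl h.1.1 h.2.1 contDiffOn_const (fun _ _ => one_ne_zero)
    (fun P hP => ?_) fun P hP => ?_
  · rw [e1 P hP]
    simp [normalField]
  · rw [e2 P hP]
    simp [normalField]

/-! ### Cubic systems and the Hopf–Cole transformation -/

section CubicAlgebra

variable {R : Type*} [CommRing R] [Algebra ℝ R] {T X U : Derivation ℝ R R} {f u ξ η : R}

/-- If `ξ_u = -1/2`, then `η` is the Taylor polynomial of degree three in `u`. -/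
theorem Determining.exists_cubic (c : Setting T X U f u) (h : Determining T X U f u ξ η)
    (hs : 2 * U ξ = -1) : ∃ ξ₀ η₁ η₀, U ξ₀ = 0 ∧ U η₁ = 0 ∧ U η₀ = 0 ∧ 2 * ξ = 2 * ξ₀ - u ∧
      4 * f * η = u ^ 3 - 2 * ξ₀ * u ^ 2 + 4 * f * η₁ * u + 4 * f * η₀ := by
  obtain ⟨-, -, h3, h2⟩ := h.of_slope_neg_half c hs
  have h4 := h.fourth c
  obtain ⟨k, hk, hD⟩ : ∃ k : R, 6 * k = 1 ∧ ∀ D : Derivation ℝ R R, D k = 0 :=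
    ⟨algebraMap ℝ R (1 / 6), by
      rw [← map_ofNat (algebraMap ℝ R) 6, ← map_mul, ← map_one (algebraMap ℝ R)]
      norm_num, fun D => D.map_algebraMap _⟩
  refine ⟨ξ + 3 * k * u, U η - u * U (U η) + 3 * k * u ^ 2 * U (U (U η)),
    η - u * U η + 3 * k * u ^ 2 * U (U η) - k * u ^ 3 * U (U (U η)), ?_, ?_, ?_, ?_, ?_⟩
  · simp only [map_add, der_mul, der_ofNat, hD, c.hUu]
    refine eq_zero_of_ofNat_mul 2 ?_
    linear_combination hs + hk
  · simp only [map_add, map_sub, der_mul, der_ofNat, hD, c.hUu, der_sq, h4]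
    linear_combination u * U (U (U η)) * hk
  · simp only [map_add, map_sub, der_mul, der_ofNat, hD, c.hUu, der_sq, der_cube, h4]
    linear_combination u * U (U η) * hk
  · linear_combination -u * hk
  · linear_combination -(u ^ 3 + 2 * f * u ^ 2 * U (U η)) * hk - (4 * k - 1) * u ^ 3 * h3
      + 2 * u ^ 2 * h2 + u ^ 3 * hs

/-- The connection of the system `ψ_t = -ψ_xx`, `ψ_xxx = x ψ_xx - e ψ_x - h ψ` for the vector
`(ψ, ψ_x, ψ_xx)` is flat. -/
theorem companion_flat {x e h : R} (s2 : T x + X (X x) + 2 * x * X x - 2 * X e = 0)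
    (s1 : T e + X (X e) + 2 * X x * e + 2 * X h = 0) (s0 : T h + X (X h) + 2 * X x * h = 0)
    {Mt Mx : Matrix (Fin 3) (Fin 3) R}
    (hMt : Mt = !![0, 0, -1; h, e, -x; X h + x * h, X e + x * e + h, -X x - x ^ 2 + e])
    (hMx : Mx = !![0, 1, 0; 0, 0, 1; -h, -e, x]) (i j : Fin 3) :
    X (Mt i j) + ∑ l, Mt i l * Mx l j = T (Mx i j) + ∑ l, Mx i l * Mt l j := by
  subst hMt hMx
  fin_cases i <;> fin_cases j <;>
    simp only [Fin.zero_eta, Fin.mk_one, Fin.reduceFinMk, Fin.sum_univ_three, Matrix.of_apply,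
      Matrix.cons_val, map_zero, map_neg, map_add, map_sub, der_mul, der_sq,
      Derivation.map_one_eq_zero]
  · ring
  · ring
  · ring
  · ring
  · ring
  · ring
  · linear_combination s0
  · linear_combination s1
  · linear_combination -s2

/-- The first component of a parallel section solves the scalar system. -/
theorem companion_sections {S : Type*} [CommRing S] [Algebra ℝ S] (r : R →ₐ[ℝ] S)
    {T' X' : S → S} {x e h : R}
    {Mt Mx : Matrix (Fin 3) (Fin 3) R} {m₁ m₂ m₃ m₄ m₅ m₆ : R}
    (hMt : Mt = !![0, 0, -1; m₁, m₂, m₃; m₄, m₅, m₆])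
    (hMx : Mx = !![0, 1, 0; 0, 0, 1; -h, -e, x]) {ψ : Fin 3 → S}
    (hψ : ∀ i, T' (ψ i) = ∑ j, r (Mt i j) * ψ j ∧ X' (ψ i) = ∑ j, r (Mx i j) * ψ j) :
    T' (ψ 0) = -ψ 2 ∧ X' (ψ 0) = ψ 1 ∧ X' (ψ 1) = ψ 2 ∧
      X' (ψ 2) = r x * ψ 2 - r e * ψ 1 - r h * ψ 0 := by
  subst hMt hMx
  refine ⟨?_, ?_, ?_, ?_⟩
  · rw [(hψ 0).1]
    simp [Fin.sum_univ_three]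
  · rw [(hψ 0).2]
    simp [Fin.sum_univ_three]
  · rw [(hψ 1).2]
    simp [Fin.sum_univ_three]
  · rw [(hψ 2).2]
    simp [Fin.sum_univ_three]
    ring

/-- The Hopf–Cole transformation. -/
theorem hopf_cole (hTX : ∀ a, T (X a) = X (T a)) {ψ v u : R} (hv : ψ * v = 1)
    (hψ : T ψ = -X (X ψ)) (hu : u = 2 * X ψ * v) :
    T u + u * X u + X (X u) = 0 ∧ 2 * X u + u ^ 2 = 4 * X (X ψ) * v ∧
      4 * X (X u) + 6 * u * X u + u ^ 3 = 8 * X (X (X ψ)) * v := by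
  have hX : X v = -(v ^ 2 * X ψ) := der_inv X hv
  have hT : T v = v ^ 2 * X (X ψ) := by
    rw [der_inv T hv, hψ]; ring
  have e1 : X u = 2 * X (X ψ) * v - 2 * X ψ ^ 2 * v ^ 2 := by
    rw [hu]
    simp only [der_mul, der_ofNat, hX]
    ring
  have e2 : X (X u) = 2 * X (X (X ψ)) * v - 6 * X ψ * X (X ψ) * v ^ 2
      + 4 * X ψ ^ 3 * v ^ 3 := by
    rw [e1]
    simp only [map_sub, der_mul, der_sq, der_ofNat, hX]
    ring
  have e3 : T u = -2 * X (X (X ψ)) * v + 2 * X ψ * v ^ 2 * X (X ψ) := by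
    rw [hu]
    simp only [der_mul, der_ofNat, hT, hTX, hψ, map_neg]
    ring
  rw [e2, e3, e1, hu]
  refine ⟨by ring, by ring, by ring⟩

end CubicAlgebra

section Restriction

variable {E : Type*} [NormedAddCommGroup E] [NormedSpace ℝ E] {D D' : Opens E}

/-- The restriction of smooth functions to a smaller open set. -/
def restrict (h : D ≤ D') : smoothAlg D' →ₐ[ℝ] smoothAlg D := pull id contDiffOn_id h

@[simp] theorem val_restrict (h : D ≤ D') (a : smoothAlg D') (p : E) (hp : p ∈ D) :
    val (restrict h a) p hp = val a p (h hp) := rfl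

theorem restrict_sm (h : D ≤ D') {a : E → ℝ} (ha : ContDiffOn ℝ ∞ a D') :
    restrict h (sm a ha) = sm a (ha.mono h) := rfl

theorem dir_restrict (h : D ≤ D') (v : E) (a : smoothAlg D') :
    dir v (restrict h a) = restrict h (dir v a) := by
  obtain ⟨a, ha, rfl⟩ := exists_sm a
  rw [restrict_sm, dir_sm, dir_sm, restrict_sm]

theorem ballOpens_mono {E : Type*} [NormedAddCommGroup E] {p : E} {r r' : ℝ} (h : r ≤ r') :
    ballOpens p r ≤ ballOpens p r' :=
  ball_subset_ball h

/-- Near the centre of a ball, a function that does not vanish there is invertible. -/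
theorem exists_ball_isUnit {p₀ : E} {r : ℝ} (hr : 0 < r) (a : smoothAlg (ballOpens p₀ r))
    (ha : val a p₀ (mem_ballOpens_self hr) ≠ 0) : ∃ ρ, 0 < ρ ∧ ∃ h : ρ ≤ r,
      ∀ p hp, val (restrict (ballOpens_mono (p := p₀) h) a) p hp ≠ 0 := by
  obtain ⟨a, sa, rfl⟩ := exists_sm a
  have hc : ContinuousAt a p₀ :=
    sa.continuousOn.continuousAt ((ballOpens p₀ r).isOpen.mem_nhds (mem_ballOpens_self hr))
  obtain ⟨ρ, hρ, hb⟩ := Metric.eventually_nhds_iff_ball.1 (hc.eventually_ne ha)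
  exact ⟨min ρ r, lt_min hρ hr, min_le_right _ _,
    fun p hp => hb p (ball_subset_ball (min_le_left _ _) hp)⟩

/-- Flat connections on a ball of the plane have parallel sections near its centre, in terms of
the algebra of smooth functions. -/
theorem exists_parallel_alg {n : ℕ} {p₀ : Plane} {r : ℝ} (hr : 0 < r)
    (Mt Mx : Matrix (Fin n) (Fin n) (smoothAlg (ballOpens p₀ r)))
    (flat : ∀ i j, dx' _ (Mt i j) + ∑ l, Mt i l * Mx l j
      = dt' _ (Mx i j) + ∑ l, Mx i l * Mt l j) (v : Fin n → ℝ) :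
    ∃ (ρ : ℝ) (hρ : 0 < ρ) (h : ρ ≤ r) (ψ : Fin n → smoothAlg (ballOpens p₀ ρ)),
      (∀ i, val (ψ i) p₀ (mem_ballOpens_self hρ) = v i) ∧
      ∀ i, dt' _ (ψ i) = ∑ j, restrict (ballOpens_mono h) (Mt i j) * ψ j ∧
        dx' _ (ψ i) = ∑ j, restrict (ballOpens_mono h) (Mx i j) * ψ j := by
  have hsum : ∀ {D : Opens Plane} (p : Plane) (hp : p ∈ D) (g : Fin n → smoothAlg D),
      val (∑ i, g i) p hp = ∑ i, val (g i) p hp := fun p hp g =>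
    map_sum (AddMonoidHom.mk' (fun b => val b p hp) (fun _ _ => rfl)) g _
  choose mt hmt et using fun i j => exists_sm (Mt i j)
  choose mx hmx ex using fun i j => exists_sm (Mx i j)
  obtain ⟨ρ, hρ, hρr, ψ, h0, hs, hd⟩ := exists_parallel_matrix mt mx p₀ hr hmt hmx
    (fun p hp i j => by
      have hp : p ∈ ballOpens p₀ r := hp
      have := congrArg (fun c => val c p hp) (flat i j)
      simpa [hsum, et, ex] using this) v
  have hs : ∀ i, ContDiffOn ℝ ∞ (ψ i) (ballOpens p₀ ρ) := hs
  refine ⟨ρ, hρ, hρr, fun i => sm (ψ i) (hs i), h0, fun i => ⟨?_, ?_⟩⟩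
  · refine smoothAlg_ext fun p hp => ?_
    simpa [hsum, et] using (hd p hp i).1
  · refine smoothAlg_ext fun p hp => ?_
    simpa [hsum, ex] using (hd p hp i).2

end Restriction

section CubicSolutions

theorem det3_cramer {u y z : Fin 3 → ℝ} {x e₁ e₀ : ℝ}
    (h : ∀ i, z i = 2 * x * y i - 4 * e₁ * u i - 4 * e₀) :
    det3 (fun _ => 1) u z = 2 * x * det3 (fun _ => 1) u y ∧
      det3 (fun _ => 1) y z = 4 * e₁ * det3 (fun _ => 1) u y ∧
      det3 u y z = -4 * e₀ * det3 (fun _ => 1) u y := by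
  simp only [det3_eq, h]
  refine ⟨by ring, by ring, by ring⟩

/-- The overdetermined system `φ_t = -φ_xx`, `φ_xxx = x φ_xx - e φ_x - h φ` has a solution with
given initial values `φ = 1`, `φ_x = v₁`, `φ_xx = v₂`. -/
theorem exists_potential {p₀ : Plane} {r : ℝ} (hr : 0 < r)
    {x e h : smoothAlg (ballOpens p₀ r)}
    (s2 : dt' _ x + dx' _ (dx' _ x) + 2 * x * dx' _ x - 2 * dx' _ e = 0)
    (s1 : dt' _ e + dx' _ (dx' _ e) + 2 * dx' _ x * e + 2 * dx' _ h = 0)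
    (s0 : dt' _ h + dx' _ (dx' _ h) + 2 * dx' _ x * h = 0) (v₁ v₂ : ℝ) :
    ∃ (ρ : ℝ) (hρ : 0 < ρ) (hρr : ρ ≤ r) (φ : smoothAlg (ballOpens p₀ ρ)),
      (∀ p hp, val φ p hp ≠ 0) ∧ dt' _ φ = -dx' _ (dx' _ φ) ∧
      dx' _ (dx' _ (dx' _ φ)) = restrict (ballOpens_mono hρr) x * dx' _ (dx' _ φ)
        - restrict (ballOpens_mono hρr) e * dx' _ φ - restrict (ballOpens_mono hρr) h * φ ∧
      val φ p₀ (mem_ballOpens_self hρ) = 1 ∧ val (dx' _ φ) p₀ (mem_ballOpens_self hρ) = v₁ ∧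
      val (dx' _ (dx' _ φ)) p₀ (mem_ballOpens_self hρ) = v₂ := by
  obtain ⟨Mt, hMt⟩ : ∃ Mt : Matrix (Fin 3) (Fin 3) (smoothAlg (ballOpens p₀ r)),
    Mt = !![0, 0, -1; h, e, -x;
      dx' _ h + x * h, dx' _ e + x * e + h, -dx' _ x - x ^ 2 + e] := ⟨_, rfl⟩
  obtain ⟨Mx, hMx⟩ : ∃ Mx : Matrix (Fin 3) (Fin 3) (smoothAlg (ballOpens p₀ r)),
    Mx = !![0, 1, 0; 0, 0, 1; -h, -e, x] := ⟨_, rfl⟩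
  obtain ⟨ρ₁, hρ₁, hρ₁r, ψ, hψ0, hψ⟩ := exists_parallel_alg hr _ _
    (companion_flat s2 s1 s0 hMt hMx) ![1, v₁, v₂]
  obtain ⟨ρ, hρ, hρρ₁, hne⟩ := exists_ball_isUnit hρ₁ (ψ 0) (by rw [hψ0]; exact one_ne_zero)
  have hρr : ρ ≤ r := hρρ₁.trans hρ₁r
  obtain ⟨t0, x0, x1, x2⟩ := companion_sections
    (restrict (ballOpens_mono (p := p₀) hρ₁r)) hMt hMx hψ
  refine ⟨ρ, hρ, hρr, restrict (ballOpens_mono (p := p₀) hρρ₁) (ψ 0), hne, ?_, ?_, hψ0 0, ?_, ?_⟩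
  · rw [dir_restrict, dir_restrict, dir_restrict, x0, x1, t0, map_neg]
  · rw [dir_restrict, dir_restrict, dir_restrict, x0, x1, x2]
    simp only [map_sub, map_mul]
    rfl
  · rw [dir_restrict, x0]
    exact hψ0 1
  · rw [dir_restrict, dir_restrict, x0, x1]
    exact hψ0 2

/-- A solution of the Burgers equation that satisfies the linear relation between `z`, `y`, `u` and
`1` with the coefficients given by a cubic system. -/
theorem CubicSystem.exists_solution {p₀ : Plane} {r : ℝ} (hr : 0 < r)
    {x e₁ e₀ : smoothAlg (ballOpens p₀ r)} (h : CubicSystem (dt' _) (dx' _) 1 x e₁ e₀)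
    (v₁ v₂ : ℝ) : ∃ ρ, 0 < ρ ∧ ∃ (hρ : ρ ≤ r) (u : Plane → ℝ),
      IsSolution (fun _ => 1) u (ball p₀ ρ) ∧ u p₀ = 2 * v₁ ∧ yOf u p₀ = 4 * v₂ ∧
      ∀ p hp, zOf u p = 2 * val x p (ballOpens_mono (p := p₀) hρ hp) * yOf u p
        - 4 * val e₁ p (ballOpens_mono (p := p₀) hρ hp) * u p
        - 4 * val e₀ p (ballOpens_mono (p := p₀) hρ hp) := by
  obtain ⟨H, hH⟩ : ∃ H, e₀ = 2 * H := ⟨(1 / 2 : ℝ) • e₀, smoothAlg_ext fun p hp => by simp⟩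
  have s0 : dt' _ H + dx' _ (dx' _ H) + 2 * dx' _ x * H = 0 := by
    have := h.s0
    rw [hH] at this
    simp only [der_mul, der_ofNat, mul_zero, add_zero] at this
    exact eq_zero_of_ofNat_mul 2 (by linear_combination this)
  have s1 : dt' _ e₁ + dx' _ (dx' _ e₁) + 2 * dx' _ x * e₁ + 2 * dx' _ H = 0 := by
    have := h.s1
    rw [hH, der_mul, der_ofNat] at this
    linear_combination this
  have s2 : dt' _ x + dx' _ (dx' _ x) + 2 * x * dx' _ x - 2 * dx' _ e₁ = 0 := by
    linear_combination h.s2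
  obtain ⟨ρ, hρ, hρr, φ, hne, ht, hx, hφ0, hφ1, hφ2⟩ := exists_potential hr s2 s1 s0 v₁ v₂
  obtain ⟨v, hv⟩ := exists_inv _ hne
  obtain ⟨u, su, hu⟩ := exists_sm (2 * dx' _ φ * v)
  obtain ⟨k1, k2, k3⟩ := hopf_cole (dir_comm (D := ballOpens p₀ ρ) (1, 0) (0, 1)) hv ht hu.symm
  have hv0 : val v p₀ (mem_ballOpens_self hρ) = 1 := by
    have := congrArg (fun c => val c p₀ (mem_ballOpens_self hρ)) hv
    simpa only [val_mul, hφ0, val_one, one_mul] using this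
  refine ⟨ρ, hρ, hρr, u, ⟨su, fun p hp => ?_⟩, ?_, ?_, fun p hp => ?_⟩
  · simpa [lhs, jetOf] using congrArg (fun c => val c p (show p ∈ ballOpens p₀ ρ from hp)) k1
  · have := congrArg (fun c => val c p₀ (mem_ballOpens_self hρ)) hu
    simp only [val_mul, val_sm, val_ofNat, hφ1, hv0, mul_one] at this
    exact this.symm
  · have := congrArg (fun c => val c p₀ (mem_ballOpens_self hρ)) k2
    simp only [dx'_sm, val_add, val_pow, val_mul, val_sm, val_ofNat, hφ2, hv0, mul_one] at this
    exact this
  · have hp : p ∈ ballOpens p₀ ρ := hp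
    have e3 := congrArg (fun c => val c p hp) k3
    have e2 := congrArg (fun c => val c p hp) k2
    have e1 := congrArg (fun c => val c p hp) hu
    have e0 := congrArg (fun c => val c p hp) hv
    have eH := congrArg (fun c => val c p (ballOpens_mono hρr hp)) hH
    rw [hx] at e3
    simp only [dx'_sm, val_add, val_sub, val_pow, val_mul, val_sm, val_ofNat, val_restrict,
      val_one] at e0 e1 e2 e3 eH
    rw [zOf, e3, yOf, e2, ← e1, eH]
    linear_combination -8 * val H p (ballOpens_mono hρr hp) * e0

/-- Near the centre of a ball, the coefficients of a cubic system over it are given by three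
solutions of the Burgers equation: the Hopf–Cole transformation turns the latter into solutions `ψ`
of the overdetermined linear system `ψ_t = -ψ_xx`, `ψ_xxx = ξ₀ ψ_xx - η₁ ψ_x - η₀ ψ / 2`. -/
theorem CubicSystem.exists_solutions {p₀ : Plane} {r : ℝ} (hr : 0 < r)
    {x e₁ e₀ : smoothAlg (ballOpens p₀ r)} (h : CubicSystem (dt' _) (dx' _) 1 x e₁ e₀) :
    ∃ ρ, 0 < ρ ∧ ∃ (hρ : ρ ≤ r) (u : Fin 3 → Plane → ℝ),
      (∀ i, IsSolution (fun _ => 1) (u i) (ball p₀ ρ)) ∧ ∀ p hp, denDet u p ≠ 0 ∧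
        xi0Of u p = val x p (ballOpens_mono (p := p₀) hρ hp) ∧
        eta1Of u p = val e₁ p (ballOpens_mono (p := p₀) hρ hp) ∧
        eta0Of u p = val e₀ p (ballOpens_mono (p := p₀) hρ hp) := by
  choose R hR hRr u hu hu1 hu2 hu3 using fun i : Fin 3 =>
    h.exists_solution hr ((![0, 1, 0] : Fin 3 → ℝ) i) ((![0, 0, 1] : Fin 3 → ℝ) i)
  obtain ⟨ρ₁, hρ₁, hle⟩ : ∃ ρ₁, 0 < ρ₁ ∧ ∀ i, ρ₁ ≤ R i :=
    ⟨min (R 0) (min (R 1) (R 2)), lt_min (hR 0) (lt_min (hR 1) (hR 2)), fun i => by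
      fin_cases i <;> simp⟩
  have hu' : ∀ i, IsSolution (fun _ => 1) (u i) (ballOpens p₀ ρ₁) := fun i =>
    ⟨(hu i).1.mono (ball_subset_ball (hle i)), fun p hp =>
      (hu i).2 p (ball_subset_ball (hle i) hp)⟩
  have sΔ : ContDiffOn ℝ ∞ (denDet u) (ballOpens p₀ ρ₁) :=
    smooth_det3 (fun _ => contDiffOn_const) (fun i => (hu' i).1) fun i => smooth_yOf (hu' i).1
  have hΔ : denDet u p₀ ≠ 0 := by
    simp [denDet, det3_eq, hu1, hu2]
  obtain ⟨ρ, hρ, hρρ₁, hne⟩ := exists_ball_isUnit hρ₁ (sm _ sΔ) hΔ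
  have hρr : ρ ≤ r := (hρρ₁.trans (hle 0)).trans (hRr 0)
  refine ⟨ρ, hρ, hρr, u, fun i => ⟨(hu' i).1.mono (ball_subset_ball hρρ₁), fun p hp =>
    (hu' i).2 p (ball_subset_ball hρρ₁ hp)⟩, fun p hp => ?_⟩
  have hd : denDet u p ≠ 0 := hne p hp
  obtain ⟨h1, h2, h3⟩ := det3_cramer (u := fun i => u i p) (y := fun i => yOf (u i) p)
    (z := fun i => zOf (u i) p) (x := val x p (ballOpens_mono (p := p₀) hρr hp))
    (e₁ := val e₁ p (ballOpens_mono (p := p₀) hρr hp))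
    (e₀ := val e₀ p (ballOpens_mono (p := p₀) hρr hp))
    fun i => hu3 i p (ball_subset_ball (hρρ₁.trans (hle i)) hp)
  refine ⟨hd, ?_, ?_, ?_⟩
  · rw [xi0Of, h1]
    change 1 / 2 * (2 * _ * denDet u p / denDet u p) = _
    field_simp
  · rw [eta1Of, h2]
    change 1 / 4 * (4 * _ * denDet u p / denDet u p) = _
    field_simp
  · rw [eta0Of, h3]
    change -(1 / 4) * (-4 * _ * denDet u p / denDet u p) = _
    field_simp

end CubicSolutions

/-! ### Operators with `ξ_u = -1/2` -/

namespace EquivTransf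

variable (g : EquivTransf)

/-- Near the image of a point where the transformation is defined, the inverse transformation is
defined. -/
theorem exists_ball {D : Opens Plane} {p₀ : Plane} (hp : p₀ ∈ D) (hd : g.denom p₀.1 ≠ 0) :
    ∃ r, 0 < r ∧ (∀ p ∈ ballOpens (g.planeMap p₀) r, g.inv.denom p.1 ≠ 0) ∧
      Set.MapsTo g.inv.planeMap (ballOpens (g.planeMap p₀) r) D := by
  have hd' : g.inv.denom (g.planeMap p₀).1 ≠ 0 := by
    rw [g.inv_denom hd]
    exact div_ne_zero g.det_ne_zero hd
  have hc : Continuous fun p : Plane => g.inv.denom p.1 := by unfold denom; fun_prop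
  have ho : IsOpen {p : Plane | g.inv.denom p.1 ≠ 0} := isOpen_ne_fun hc continuous_const
  have hm : ContinuousAt g.inv.planeMap (g.planeMap p₀) :=
    (g.inv.contDiffOn_planeMap (D := {p : Plane | g.inv.denom p.1 ≠ 0})
      fun p hp => hp).continuousOn.continuousAt (ho.mem_nhds hd')
  have hD : (D : Set Plane) ∈ nhds (g.inv.planeMap (g.planeMap p₀)) := by
    rw [g.inv_planeMap hd]
    exact D.isOpen.mem_nhds hp
  obtain ⟨r, hr, hb⟩ := Metric.eventually_nhds_iff_ball.1 ((ho.eventually_mem hd').and (hm hD))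
  exact ⟨r, hr, fun p hp => (hb p hp).1, fun p hp => (hb p hp).2⟩

theorem exists_domain {U V' : Set Space} (hU : IsOpen U) (hV' : IsOpen V') {P : Space}
    (hP : P ∈ U) (hd : g.denom P.1 ≠ 0) (hP' : g.map P ∈ V') :
    ∃ V, IsOpen V ∧ P ∈ V ∧ V ⊆ U ∧ (∀ P ∈ V, g.denom P.1 ≠ 0) ∧ Set.MapsTo g.map V V' := by
  refine ⟨U ∩ ({P | g.denom P.1 ≠ 0} ∩ g.map ⁻¹' V'), hU.inter ?_, ⟨hP, hd, hP'⟩, fun P h => h.1,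
    fun P h => h.2.1, fun P h => h.2.2⟩
  exact (g.contDiffOn_map fun P hP => hP).continuousOn.isOpen_inter_preimage g.isOpen_denom_ne hV'

/-- The scaling of `t` by `c` and of `u` by `c⁻¹`, which changes the constant `f = c` to `1`. -/
def scale (c : ℝ) (hc : c ≠ 0) : EquivTransf :=
  ⟨c, 0, 0, 1, 1, 0, 0, by simpa using hc, one_ne_zero⟩

end EquivTransf

/-- The cylinder over a ball of the plane. -/
def cylinder (p : Plane) (r : ℝ) : Set Space := proj ⁻¹' ball p r

theorem isOpen_cylinder (p : Plane) (r : ℝ) : IsOpen (cylinder p r) :=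
  isOpen_ball.preimage contDiff_proj.continuous

theorem base_cylinder (p : Plane) (r : ℝ) : base (cylinder p r) = ball p r := by
  ext q
  constructor
  · rintro ⟨P, hP, rfl⟩
    exact hP
  · intro hq
    exact ⟨(q.1, q.2, 0), hq, rfl⟩

theorem CubicSystem.of_lift {U : Opens Space} {f a b c : smoothAlg (baseOpens U)}
    (h : CubicSystem (dT U) (dX U) (GBE.lift U f) (GBE.lift U a) (GBE.lift U b) (GBE.lift U c)) :
    CubicSystem (dt' _) (dx' _) f a b c := by
  refine ⟨lift_injective U ?_, lift_injective U ?_, lift_injective U ?_⟩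
  · have := h.s2
    simp only [dT_lift, dX_lift] at this
    simpa only [map_add, map_sub, map_mul, map_zero, map_ofNat] using this
  · have := h.s1
    simp only [dT_lift, dX_lift] at this
    simpa only [map_add, map_mul, map_zero, map_ofNat] using this
  · have := h.s0
    simp only [dT_lift, dX_lift] at this
    simpa only [map_add, map_mul, map_zero, map_ofNat] using this

/-- On a ball, a function with vanishing derivatives is constant. -/
theorem eq_of_derivatives_zero {p₀ : Plane} {r : ℝ} (hr : 0 < r) {a : smoothAlg (ballOpens p₀ r)}
    (ht : dt' _ a = 0) (hx : dx' _ a = 0) {p : Plane} (hp : p ∈ ballOpens p₀ r) :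
    val a p hp = val a p₀ (mem_ballOpens_self hr) := by
  obtain ⟨a, ha, rfl⟩ := exists_sm a
  have hd : ∀ q ∈ ballOpens p₀ r, fderiv ℝ a q = 0 := by
    intro q hq
    have h1 := congrArg (fun c => val c q hq) ht
    have h2 := congrArg (fun c => val c q hq) hx
    simp only [dt'_sm, dx'_sm, val_sm, val_zero] at h1 h2
    refine ContinuousLinearMap.ext fun v => ?_
    rw [fderiv_plane, h1, h2]
    simp
  exact isOpen_ball.is_const_of_fderiv_eq_zero (convex_ball _ _).isPreconnected
    (ha.differentiableOn (by simp)) hd hp (mem_ballOpens_self hr)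

theorem val_congr {E : Type*} [NormedAddCommGroup E] [NormedSpace ℝ E] {D : Opens E}
    (a : smoothAlg D) {p q : E} (h : p = q) (hp : p ∈ D) (hq : q ∈ D) :
    val a p hp = val a q hq := by
  subst h
  rfl

section Scaling

variable {c : ℝ} (hc : c ≠ 0) {D D' : Opens Plane}
  (hd : ∀ p ∈ D, (EquivTransf.scale c hc).inv.denom p.1 ≠ 0)
  (h : Set.MapsTo (EquivTransf.scale c hc).inv.planeMap D D')

theorem dx'_pullback_scale (a : smoothAlg D') :
    dx' D ((EquivTransf.scale c hc).inv.pullback hd h a)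
      = (EquivTransf.scale c hc).inv.pullback hd h (dx' D' a) := by
  refine smoothAlg_ext fun p hp => ?_
  rw [EquivTransf.val_dx'_pullback]
  simp [EquivTransf.inv, EquivTransf.scale, EquivTransf.denom, EquivTransf.det, hc,
    EquivTransf.pullback]

theorem dt'_pullback_scale (a : smoothAlg D') :
    c • dt' D ((EquivTransf.scale c hc).inv.pullback hd h a)
      = (EquivTransf.scale c hc).inv.pullback hd h (dt' D' a) := by
  refine smoothAlg_ext fun p hp => ?_
  rw [val_smul, EquivTransf.val_dt'_pullback]
  simp [EquivTransf.inv, EquivTransf.scale, EquivTransf.denom, EquivTransf.det,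
    EquivTransf.pullback, EquivTransf.shift]
  field_simp

theorem CubicSystem.scale {x e₁ e₀ : smoothAlg D'}
    (hS : CubicSystem (dt' D') (dx' D') (algebraMap ℝ _ c) x e₁ e₀) :
    CubicSystem (dt' D) (dx' D) 1 (c⁻¹ • (EquivTransf.scale c hc).inv.pullback hd h x)
      (c⁻¹ • (EquivTransf.scale c hc).inv.pullback hd h e₁)
      (c⁻¹ ^ 2 • (EquivTransf.scale c hc).inv.pullback hd h e₀) := by
  set φ := (EquivTransf.scale c hc).inv.pullback hd h with hφ
  have hX : ∀ a, dx' D (φ a) = φ (dx' D' a) := dx'_pullback_scale hc hd h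
  have hT : ∀ a, dt' D (φ a) = c⁻¹ • φ (dt' D' a) := fun a => by
    rw [hφ, ← dt'_pullback_scale, smul_smul, inv_mul_cancel₀ hc, one_smul]
  have s2 := congrArg φ hS.s2
  have s1 := congrArg φ hS.s1
  have s0 := congrArg φ hS.s0
  simp only [map_add, map_sub, map_mul, map_zero, map_ofNat, AlgHom.commutes] at s2 s1 s0
  refine ⟨?_, ?_, ?_⟩ <;> simp only [Derivation.map_smul, hX, hT] <;>
    refine smoothAlg_ext fun p hp => ?_
  · have := congrArg (fun a => val a p hp) s2
    simp only [val_add, val_sub, val_mul, val_smul, val_algebraMap, val_ofNat, val_one,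
      val_zero] at this ⊢
    field_simp
    linear_combination this
  · have := congrArg (fun a => val a p hp) s1
    simp only [val_add, val_mul, val_smul, val_algebraMap, val_ofNat, val_one,
      val_zero] at this ⊢
    field_simp
    linear_combination this
  · have := congrArg (fun a => val a p hp) s0
    simp only [val_add, val_mul, val_smul, val_algebraMap, val_ofNat, val_one,
      val_zero] at this ⊢
    field_simp
    linear_combination this

end Scaling

/-- If `ξ_u = -1/2`, then `f` is constant, a scaling makes it equal to `1`, and the coefficients of
the operator satisfy the cubic system. -/
theorem locallyListed_of_slope_neg_half {P₀ : Space} {r : ℝ} (hr : 0 < r) {f : Plane → ℝ}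
    {Q : VField} (hf : InClass f (baseOpens (ballOpens P₀ r)))
    (h : IsRegularReductionOperator f Q (ballOpens P₀ r))
    (hs : ∀ P ∈ ballOpens P₀ r, pu (fun P => Q.ξ P / Q.τ P) P = -1 / 2) :
    LocallyListed f Q (ballOpens P₀ r) P₀ := by
  obtain ⟨hξ, hη, hdet⟩ := determining_of_regular hf h
  have c₁ := setting hf
  have hs' : 2 * dU (ballOpens P₀ r) (sm _ hξ) = -1 := smoothAlg_ext fun P hP => by
    simp [hs P hP]
    norm_num
  obtain ⟨hXf, hTf, -, -⟩ := hdet.of_slope_neg_half c₁ hs'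
  obtain ⟨x, e₁, e₀, hx, h1, h0, eξ, eη⟩ := hdet.exists_cubic c₁ hs'
  obtain ⟨x, rfl⟩ := exists_lift _ hx
  obtain ⟨e₁, rfl⟩ := exists_lift _ h1
  obtain ⟨e₀, rfl⟩ := exists_lift _ h0
  have hS := ((determining_cubic_iff c₁ hXf hTf hx h1 h0 eξ eη).1 hdet).of_lift
  have hP₀ : P₀ ∈ ballOpens P₀ r := mem_ballOpens_self hr
  obtain ⟨c, hcdef⟩ : ∃ c, c = f (proj P₀) := ⟨_, rfl⟩
  have hfc : ∀ p ∈ baseOpens (ballOpens P₀ r), f p = c := fun p hp => by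
    rw [hcdef]
    have hle : ballOpens (proj P₀) r ≤ baseOpens (ballOpens P₀ r) := (baseOpens_ball P₀ hr).ge
    refine eq_of_derivatives_zero hr (a := restrict hle (sm f hf.1)) ?_ ?_
      ((baseOpens_ball P₀ hr).le hp)
    · rw [dir_restrict, lift_injective _ (by rw [← dT_lift, hTf, map_zero] :
        lift _ (dt' _ (sm f hf.1)) = lift _ 0), map_zero]
    · rw [dir_restrict, lift_injective _ (by rw [← dX_lift, hXf, map_zero] :
        lift _ (dx' _ (sm f hf.1)) = lift _ 0), map_zero]
  have hc : c ≠ 0 := hcdef ▸ hf.2 _ (proj_mem hP₀)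
  have hF : sm f hf.1 = algebraMap ℝ _ c := smoothAlg_ext fun p hp => hfc p hp
  rw [hF] at hS
  set g := EquivTransf.scale c hc with hg
  have hgd : ∀ t, g.denom t = 1 := fun t => by simp [hg, EquivTransf.denom, EquivTransf.scale]
  have hgdet : g.det = c := by simp [hg, EquivTransf.det, EquivTransf.scale]
  have hgκ : g.κ = 1 := rfl
  have hgγ : g.γ = 0 := rfl
  have hgs : ∀ x, g.shift x = 0 := fun x => by simp [hg, EquivTransf.shift, EquivTransf.scale]
  have hgd0 : ∀ t, g.denom t ≠ 0 := fun t => by simp [hgd]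
  obtain ⟨r', hr', hd', hm'⟩ := g.exists_ball (proj_mem hP₀) (hgd0 _)
  obtain ⟨ρ, hρ, hρr, u, husol, hu⟩ := (hS.scale hc hd' hm').exists_solutions hr'
  obtain ⟨V, hV, hPV, hVU, hVd, hVm⟩ := g.exists_domain (ballOpens P₀ r).isOpen
    (isOpen_cylinder (g.planeMap (proj P₀)) ρ) hP₀ (hgd0 _) (mem_ball_self hρ)
  refine ⟨g, V, fun _ => 1, cubicOperator (xi0Of u) (eta1Of u) (eta0Of u),
    cylinder (g.planeMap (proj P₀)) ρ, hV, hPV, hVU, isOpen_cylinder _ _,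
    ⟨contDiffOn_const, fun _ _ => one_ne_zero⟩, ?_,
    Or.inr (Or.inr (Or.inr ⟨fun _ _ => rfl, u, ?_⟩))⟩
  · have hu' : ∀ P (hP : P ∈ V), xi0Of u (g.planeMap (proj P)) = c⁻¹ * val x _ (proj_mem (hVU hP)) ∧
        eta1Of u (g.planeMap (proj P)) = c⁻¹ * val e₁ _ (proj_mem (hVU hP)) ∧
        eta0Of u (g.planeMap (proj P)) = c⁻¹ ^ 2 * val e₀ _ (proj_mem (hVU hP)) := by
      intro P hP
      have e := g.inv_planeMap (p := proj P) (hgd0 _)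
      have hm : g.planeMap (proj P) ∈ ballOpens (g.planeMap (proj P₀)) ρ := hVm hP
      have hv : ∀ a : smoothAlg (baseOpens (ballOpens P₀ r)),
          val ((EquivTransf.scale c hc).inv.pullback hd' hm' a) _ (ballOpens_mono hρr hm)
            = val a _ (proj_mem (hVU hP)) := fun a => val_congr a e _ _
      have := (hu _ hm).2
      simpa only [val_smul, hv] using this
    refine g.carries_of hVd hVm ?_ (h.1.1.mono hVU) (fun P hP => h.2.1 P (hVU hP))
      contDiffOn_const (fun _ _ => one_ne_zero) ?_ ?_
    · rintro _ ⟨P, hP, rfl⟩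
      have := hfc _ (proj_mem (hVU hP))
      change 1 = g.factor * f (proj P)
      rw [this]
      simp [EquivTransf.factor, hg, EquivTransf.scale, hc]
    · intro P hP
      have e := congrArg (fun a => val a P (hVU hP)) eξ
      simp only [val_mul, val_sub, val_ofNat, val_sm, val_lift, val_uCoord] at e
      have hQ : Q.ξ P / Q.τ P = val x _ (proj_mem (hVU hP)) - P.2.2 / 2 := by linarith
      rw [hQ, hgd, hgκ, hgs, hgdet]
      change -(1 / 2) * g.uMap P + xi0Of u (g.planeMap (proj P)) = 1 * _
      rw [(hu' P hP).1]
      simp [EquivTransf.uMap, hg, EquivTransf.scale, EquivTransf.denom]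
      field_simp
      ring
    · intro P hP
      have e := congrArg (fun a => val a P (hVU hP)) eη
      simp only [val_mul, val_sub, val_add, val_pow, val_ofNat, val_sm, val_lift, val_uCoord,
        hfc _ (proj_mem (hVU hP))] at e
      have hQ : Q.η P / Q.τ P = (P.2.2 ^ 3 - 2 * val x _ (proj_mem (hVU hP)) * P.2.2 ^ 2) / (4 * c)
          + val e₁ _ (proj_mem (hVU hP)) * P.2.2 + val e₀ _ (proj_mem (hVU hP)) := by
        field_simp
        linear_combination e
      rw [hQ, hgd, hgκ, hgγ, hgdet]
      change 1 / 4 * g.uMap P ^ 3 - 1 / 2 * xi0Of u (g.planeMap (proj P)) * g.uMap P ^ 2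
        + eta1Of u (g.planeMap (proj P)) * g.uMap P + eta0Of u (g.planeMap (proj P)) = 1 * _
      rw [(hu' P hP).1, (hu' P hP).2.1, (hu' P hP).2.2]
      simp [EquivTransf.uMap, hg, EquivTransf.scale, EquivTransf.denom]
      field_simp
      ring
  · rw [base_cylinder]
    exact ⟨husol, fun p hp => (hu p hp).1, fun _ _ => rfl⟩

/-! ### Lie symmetry operators -/

section Affine

theorem AffineSystem.restrict {D D' : Opens Plane} (hD : D ≤ D') {f x a w : smoothAlg D'}
    (h : AffineSystem (dt' _) (dx' _) f x a w) :
    AffineSystem (dt' D) (dx' D) (restrict hD f) (restrict hD x) (restrict hD a)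
      (restrict hD w) := by
  have h1 := congrArg (GBE.restrict hD) h.hf
  have h2 := congrArg (GBE.restrict hD) h.ha
  have h3 := congrArg (GBE.restrict hD) h.hw
  have h4 := congrArg (GBE.restrict hD) h.hXw
  have h5 := congrArg (GBE.restrict hD) h.hTw
  simp only [map_add, map_sub, map_mul, map_pow, map_zero, map_ofNat] at h1 h2 h3 h4 h5
  refine ⟨?_, ?_, ?_, ?_, ?_⟩ <;> simp only [dir_restrict] <;> assumption

/-- If `ξ_u = 0`, then `η` is affine in `u`, and its coefficients satisfy the affine system. -/
theorem exists_affine {P₀ : Space} {r : ℝ} {f : Plane → ℝ}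
    (hf : InClass f (baseOpens (ballOpens P₀ r))) {ξ η : smoothAlg (ballOpens P₀ r)}
    (h : Determining (dT _) (dX _) (dU _) (lift _ (sm f hf.1)) (uCoord _) ξ η)
    (hs : dU _ ξ = 0) :
    ∃ x a w, AffineSystem (dt' _) (dx' _) (sm f hf.1) x a w ∧ ξ = lift _ x ∧
      η = lift _ a * (uCoord _ - lift _ x) + lift _ w := by
  have c := setting hf
  obtain ⟨hUU, h1, h2, h3, h4, h5⟩ := h.of_slope_zero c hs
  obtain ⟨x, rfl⟩ := exists_lift ξ hs
  obtain ⟨a, ha⟩ := exists_lift _ hUU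
  obtain ⟨η₀, hη⟩ := exists_lift (η - uCoord _ * dU _ η) (by
    rw [map_sub, der_mul, hUU, c.hUu]
    ring)
  rw [← ha] at h1 h2 h3 h4 h5 hη
  rw [← hη] at h3 h4 h5
  simp only [dT_lift, dX_lift] at h1 h2 h3 h4 h5
  simp only [← map_mul, ← map_add, ← map_sub] at h1 h2 h3 h4 h5
  rw [← map_zero (lift (ballOpens P₀ r))] at h2 h3 h4
  refine ⟨x, a, η₀ + a * x, AffineSystem.of_split (dir_comm _ _) (lift_injective _ h1)
    (lift_injective _ h2) (lift_injective _ h3) (lift_injective _ h4)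
    (lift_injective _ h5), rfl, ?_⟩
  rw [map_add, map_mul, hη]
  ring

/-- The open set on which a smooth function does not vanish. -/
def nonzeroOpens {D : Opens Plane} (a : smoothAlg D) : Opens Plane where
  carrier := {p | ∃ hp : p ∈ D, val a p hp ≠ 0}
  is_open' := by
    obtain ⟨a, ha, rfl⟩ := exists_sm a
    have : {p | ∃ hp : p ∈ D, val (sm a ha) p hp ≠ 0} = (D : Set Plane) ∩ a ⁻¹' {0}ᶜ := by
      ext p
      simp
    rw [this]
    exact ha.continuousOn.isOpen_inter_preimage D.isOpen isOpen_compl_singleton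

/-- On the open set where the product does not vanish, the affine system is incompatible. -/
theorem AffineSystem.mul_eq_zero {D : Opens Plane} {f x a w : smoothAlg D}
    (h : AffineSystem (dt' _) (dx' _) f x a w) :
    dx' _ (dx' _ x) * w * dx' _ w = 0 := by
  refine smoothAlg_ext fun p hp => ?_
  by_contra hne
  have hD : nonzeroOpens (dx' _ (dx' _ x) * w * dx' _ w) ≤ D := fun q hq => hq.1
  have key := (h.restrict hD).false_of_isUnit (dir_comm _ _)
    (isUnit_of_ne_zero fun q hq => by
      have := hq.2
      simp only [val_mul, mul_ne_zero_iff] at this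
      exact this.1.2)
    (isUnit_of_ne_zero fun q hq => by
      have := hq.2
      simp only [val_mul, mul_ne_zero_iff] at this
      rw [dir_restrict]
      exact this.2)
    (isUnit_of_ne_zero fun q hq => by
      have := hq.2
      simp only [val_mul, mul_ne_zero_iff] at this
      rw [dir_restrict, dir_restrict]
      exact this.1.1)
  have := congrArg (fun c => val c p (show p ∈ nonzeroOpens _ from ⟨hp, hne⟩)) key
  simp at this

/-- Where `w` and `w_x` do not vanish simultaneously, `ξ` is affine in `x`. -/
theorem AffineSystem.affine {D : Opens Plane} {f x a w : smoothAlg D}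
    (h : AffineSystem (dt' _) (dx' _) f x a w)
    (hw : ∀ p hp, val w p hp ≠ 0 ∨ val (dx' _ w) p hp ≠ 0) : dx' _ (dx' _ x) = 0 := by
  obtain ⟨v, hv⟩ : ∃ v, v = dx' _ (dx' _ x) := ⟨_, rfl⟩
  have h0 := h.mul_eq_zero
  have hTw := h.hTXw (dir_comm _ _)
  have hXX := h.hXXw (dir_comm _ _)
  rw [← hv] at h0 hTw ⊢
  have h1 := congrArg (dx' _) h0
  simp only [der_mul, hXX, map_zero] at h1
  have h2 : ∀ p hp, val v p hp * val (dx' _ w) p hp = 0 := fun p hp => by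
    have e0 := congrArg (fun c => val c p hp) h0
    have e1 := congrArg (fun c => val c p hp) h1
    simp only [val_mul, val_add, val_zero] at e0 e1
    refine pow_eq_zero_iff (n := 2) (by norm_num) |>.1 ?_
    linear_combination val v p hp * e1 - val (dx' _ v) p hp * e0
  have h2' : v * dx' _ w = 0 := smoothAlg_ext fun p hp => h2 p hp
  have h3 := congrArg (dt' _) h2'
  rw [der_mul, hTw, map_zero] at h3
  refine smoothAlg_ext fun p hp => ?_
  have e2 := h2 p hp
  have e3 := congrArg (fun c => val c p hp) h3
  simp only [val_mul, val_add, val_sub, val_ofNat, val_zero] at e3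
  rcases hw p hp with hw | hw
  · have : val v p hp ^ 3 * val w p hp = 0 := by
      linear_combination (-val v p hp) * e3 + (val (dt' _ v) p hp
        + 2 * val v p hp * val a p hp - 2 * val v p hp * val (dx' _ x) p hp) * e2
    simpa [hw] using this
  · simpa [hw] using e2

end Affine

section Lie

variable {U : Opens Space} {f : Plane → ℝ} {ξ η : Space → ℝ} {hξ : ContDiffOn ℝ ∞ ξ U}
  {hη : ContDiffOn ℝ ∞ η U}

/-- If `ξ_u = 0`, then the prolongation of `∂_t + ξ ∂_x + η ∂_u` maps the equation to a multiple of
the characteristic `η - u_t - ξ u_x`. -/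
theorem prolongLhs_of_slope_zero (hf : InClass f (baseOpens U))
    (h : Determining (dT U) (dX U) (dU U) (lift U (sm f hf.1)) (uCoord U) (sm ξ hξ) (sm η hη))
    (hs : dU U (sm ξ hξ) = 0) {j : Jet} (hj : j.space ∈ U) (hl : lhs f j = 0) :
    prolongLhs f (normalField ξ η) j = (pu η j.space - px ξ j.space) * chi ξ η j := by
  have c := setting hf
  have hX := congrArg (dX U) hs
  have hU := congrArg (dU U) hs
  rw [← c.hUX, map_zero] at hX
  rw [map_zero] at hU
  obtain ⟨hUU, h1, h2, h3, h4, h5⟩ := h.of_slope_zero c hs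
  have hUX := h2
  rw [← c.hUX] at hUX
  simp only [map_sub, map_add, der_mul, c.hXu, c.hTu, h2, map_zero] at h3 h4
  simp only [dT_sm, dX_sm, dU_sm, dT_lift, dX_lift, dt'_sm, dx'_sm] at hX hU hUU h1 h3 h4 h5 hUX hs
  have e := fun {a b : smoothAlg U} (h : a = b) => congrArg (fun c => val c _ hj) h
  have eX := e hX
  have eU := e hU
  have eUU := e hUU
  have e1 := e h1
  have e3 := e h3
  have e4 := e h4
  have e5 := e h5
  have eUX := e hUX
  have es := e hs
  simp only [val_add, val_sub, val_mul, val_zero, val_sm, val_lift, val_uCoord]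
    at eX eU eUU e1 e3 e4 e5 eUX es
  change dt f j.plane + ξ j.space * dx f j.plane
    = f j.plane * (pu η j.space + px ξ j.space) at e1
  change _ + f j.plane * _ + _ = 0 at e4
  change _ - j.u * pu η j.space = _ + f j.plane * _ at e5
  have hu : j.space.2.2 = j.u := rfl
  rw [hu] at e4
  have hl : j.ut + j.u * j.ux + f j.plane * j.uxx = 0 := hl
  rw [prolongLhs, normal_etaT, normal_etaX, normal_etaXX]
  simp only [totT, totX, totXX, normalField, chi, eX, eU, eUU, eUX, es]
  linear_combination j.uxx * e1 + (2 * pu η j.space - px ξ j.space) * hl + j.ux * e5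
    + j.u * e3 + e4

/-- The multiplier `m` of the field contributes `m_t` times the characteristic to the prolongation,
and `m_t = (ξ_x - η_u) m` cancels the multiple of the characteristic in `prolongLhs_of_slope_zero`.
-/
theorem lie_of_multiplier (hf : InClass f (baseOpens U))
    (h : Determining (dT U) (dX U) (dU U) (lift U (sm f hf.1)) (uCoord U) (sm ξ hξ) (sm η hη))
    (hs : dU U (sm ξ hξ) = 0) {m : smoothAlg (baseOpens U)} (hx : dx' _ m = 0)
    (ht : lift U (dt' _ m) = (dX U (sm ξ hξ) - dU U (sm η hη)) * lift U m) :
    ∃ m' : Space → ℝ, (∀ P hP, m' P = val m (proj P) (proj_mem hP)) ∧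
      ContDiffOn ℝ ∞ m' U ∧ IsLieSymmetryOperator f (scaledField m' ξ η) U := by
  obtain ⟨m', hm, hmm⟩ := exists_sm (lift U m)
  have hT := dT_lift m
  have hX := dX_lift m
  have hU := dU_lift m
  rw [hx, map_zero, hmm] at hX
  rw [hmm] at hU ht
  rw [hmm, ht] at hT
  have hXX := congrArg (dX U) hX
  have hXU := congrArg (dU U) hX
  have hUU := congrArg (dU U) hU
  simp only [dT_sm, dX_sm, dU_sm, map_zero] at hT hX hU hXX hXU hUU
  refine ⟨m', fun P hP => congrArg (fun c => val c P hP) hmm.symm, hm,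
    ⟨hm, hm.mul hξ, hm.mul hη⟩, fun j hj hl => ?_⟩
  have e := fun {a b : smoothAlg U} (h : a = b) => congrArg (fun c => val c _ hj) h
  have eT := e hT
  have eX := e hX
  have eU := e hU
  have eXX := e hXX
  have eXU := e hXU
  have eUU := e hUU
  simp only [val_mul, val_sub, val_sm, val_zero] at eT eX eU eXX eXU eUU
  rw [scaled_prolongLhs hm hξ hη f hj, prolongLhs_of_slope_zero hf h hs hj hl]
  simp only [totT, totX, totXX, eT, eX, eU, eXX, eXU, eUU]
  ring

end Lie

/-- Since `ξ_x` and `η_u = a` depend only on `t`, the equation `m_t = (ξ_x - a) m` has a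
nonvanishing solution that depends only on `t`. -/
theorem exists_multiplier {p₀ : Plane} {r : ℝ} (hr : 0 < r) {f x a w : smoothAlg (ballOpens p₀ r)}
    (h : AffineSystem (dt' _) (dx' _) f x a w) (hx : dx' _ (dx' _ x) = 0) :
    ∃ (ρ : ℝ) (_ : 0 < ρ) (hρr : ρ ≤ r) (m : smoothAlg (ballOpens p₀ ρ)),
      (∀ p hp, val m p hp ≠ 0) ∧ dx' _ m = 0 ∧
      dt' _ m = restrict (ballOpens_mono hρr) (dx' _ x - a) * m := by
  obtain ⟨ρ₁, hρ₁, hρ₁r, ψ, hψ0, hψ⟩ := exists_parallel_alg hr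
    (fun _ _ : Fin 1 => dx' _ x - a) (fun _ _ => 0) (fun i j => by
      simp [hx, h.ha]) (fun _ => 1)
  obtain ⟨ρ, hρ, hρρ₁, hne⟩ := exists_ball_isUnit hρ₁ (ψ 0) (by rw [hψ0]; exact one_ne_zero)
  refine ⟨ρ, hρ, hρρ₁.trans hρ₁r, restrict (ballOpens_mono hρρ₁) (ψ 0), hne, ?_, ?_⟩
  · rw [dir_restrict, (hψ 0).2]
    simp
  · rw [dir_restrict, (hψ 0).1]
    simp only [Fin.sum_univ_one, map_mul]
    rfl

/-! ### Uniqueness for linear equations and functional dependence -/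

theorem hasDerivAt_line_t {a : Plane → ℝ} {p : Plane} (ha : DifferentiableAt ℝ a p) :
    HasDerivAt (fun t => a (t, p.2)) (dt a p) p.1 :=
  HasFDerivAt.comp_hasDerivAt (f := fun t : ℝ => ((t, p.2) : Plane)) p.1 ha.hasFDerivAt
    ((hasDerivAt_id _).prodMk (hasDerivAt_const _ _))

theorem hasDerivAt_line_x {a : Plane → ℝ} {p : Plane} (ha : DifferentiableAt ℝ a p) :
    HasDerivAt (fun x => a (p.1, x)) (dx a p) p.2 :=
  HasFDerivAt.comp_hasDerivAt (f := fun x : ℝ => ((p.1, x) : Plane)) p.2 ha.hasFDerivAt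
    ((hasDerivAt_const _ _).prodMk (hasDerivAt_id _))

theorem mem_plane_ball {p₀ p : Plane} {r : ℝ} :
    p ∈ ballOpens p₀ r ↔ p.1 ∈ ball p₀.1 r ∧ p.2 ∈ ball p₀.2 r := by
  change p ∈ ball p₀ r ↔ _
  simp only [mem_ball, Prod.dist_eq, max_lt_iff]

/-- On a ball, a function with vanishing `x`-derivative is a function of `t`. -/
theorem eq_of_dx_zero {p₀ : Plane} {r : ℝ} {a : Plane → ℝ}
    (ha : ContDiffOn ℝ ∞ a (ballOpens p₀ r)) (h : ∀ p ∈ ballOpens p₀ r, dx a p = 0) {p : Plane}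
    (hp : p ∈ ballOpens p₀ r) : a p = a (p.1, p₀.2) := by
  have hp' := mem_plane_ball.1 hp
  have hl : ∀ s ∈ ball p₀.2 r, HasDerivAt (fun s : ℝ => a (p.1, s)) 0 s := by
    intro s hs
    have hs' : ((p.1, s) : Plane) ∈ ballOpens p₀ r := mem_plane_ball.2 ⟨hp'.1, hs⟩
    have := hasDerivAt_line_x (differentiableAt_of_smooth ha hs')
    rwa [h _ hs'] at this
  exact isOpen_ball.is_const_of_deriv_eq_zero (convex_ball p₀.2 r).isPreconnected
    (fun s hs => (hl s hs).differentiableAt.differentiableWithinAt) (fun s hs => (hl s hs).deriv)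
    hp'.2 (mem_ball_self (pos_of_mem_ball hp'.2))

/-- If `w` is affine in `x` and `(w, w_x)` satisfies a linear homogeneous system of ordinary
differential equations in `t`, then `w` vanishes near each point where `w` and `w_x` vanish. -/
theorem exists_ball_eq_zero {p₀ : Plane} {r : ℝ} (hr : 0 < r)
    {w b α β γ δ : smoothAlg (ballOpens p₀ r)} (hw : dt' _ w = α * w + β * b)
    (hb : dt' _ b = γ * w + δ * b) (hXw : dx' _ w = b) (hXb : dx' _ b = 0)
    (hw0 : val w p₀ (mem_ballOpens_self hr) = 0) (hb0 : val b p₀ (mem_ballOpens_self hr) = 0) :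
    ∃ (ρ : ℝ) (_ : 0 < ρ) (hρr : ρ ≤ r), restrict (ballOpens_mono (p := p₀) hρr) w = 0 := by
  obtain ⟨w, sw, rfl⟩ := exists_sm w
  obtain ⟨b, sb, rfl⟩ := exists_sm b
  obtain ⟨α, sα, rfl⟩ := exists_sm α
  obtain ⟨β, sβ, rfl⟩ := exists_sm β
  obtain ⟨γ, sγ, rfl⟩ := exists_sm γ
  obtain ⟨δ, sδ, rfl⟩ := exists_sm δ
  set D := ballOpens p₀ r
  have v1 : ∀ p ∈ D, dt w p = α p * w p + β p * b p := fun p hp => by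
    simpa using congrArg (fun c => val c p hp) hw
  have v2 : ∀ p ∈ D, dt b p = γ p * w p + δ p * b p := fun p hp => by
    simpa using congrArg (fun c => val c p hp) hb
  have v3 : ∀ p ∈ D, dx w p = b p := fun p hp => by
    simpa using congrArg (fun c => val c p hp) hXw
  have v4 : ∀ p ∈ D, dx b p = 0 := fun p hp => by
    simpa using congrArg (fun c => val c p hp) hXb
  have bd : ∀ {c : Plane → ℝ}, ContDiffOn ℝ ∞ c D → ∀ᶠ p in nhds p₀, |c p| ≤ |c p₀| + 1 := by
    intro c hc
    have := (hc.continuousOn.continuousAt (D.isOpen.mem_nhds (mem_ballOpens_self hr))).abs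
    exact (this.eventually (gt_mem_nhds (lt_add_one _))).mono fun p hp => le_of_lt hp
  obtain ⟨ρ₁, hρ₁, hb1⟩ := Metric.eventually_nhds_iff_ball.1
    ((bd sα).and ((bd sβ).and ((bd sγ).and (bd sδ))))
  set K := |α p₀| + |β p₀| + |γ p₀| + |δ p₀| + 1
  have k1 := abs_nonneg (α p₀)
  have k2 := abs_nonneg (β p₀)
  have k3 := abs_nonneg (γ p₀)
  have k4 := abs_nonneg (δ p₀)
  refine ⟨min ρ₁ r, lt_min hρ₁ hr, min_le_right _ _, ?_⟩
  set ρ := min ρ₁ r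
  have hρ : 0 < ρ := lt_min hρ₁ hr
  have hρD : ballOpens p₀ ρ ≤ D := ballOpens_mono (min_le_right _ _)
  have hl : ∀ t ∈ Ioo (p₀.1 - ρ) (p₀.1 + ρ), ((t, p₀.2) : Plane) ∈ ballOpens p₀ ρ := fun t ht =>
    mem_plane_ball.2 ⟨by rwa [Real.ball_eq_Ioo], mem_ball_self hρ⟩
  have hK : ∀ t ∈ Ioo (p₀.1 - ρ) (p₀.1 + ρ), |α (t, p₀.2)| ≤ K ∧ |β (t, p₀.2)| ≤ K ∧
      |γ (t, p₀.2)| ≤ K ∧ |δ (t, p₀.2)| ≤ K := fun t ht => by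
    obtain ⟨l1, l2, l3, l4⟩ := hb1 _ (ball_subset_ball (min_le_left _ _) (hl t ht))
    refine ⟨?_, ?_, ?_, ?_⟩ <;> linarith
  have hline := linear_pair_eq_zero (w := fun t => w (t, p₀.2)) (b := fun t => b (t, p₀.2))
    (α := fun t => α (t, p₀.2)) (β := fun t => β (t, p₀.2)) (γ := fun t => γ (t, p₀.2))
    (δ := fun t => δ (t, p₀.2)) (t₀ := p₀.1) (t₁ := p₀.1 - ρ) (t₂ := p₀.1 + ρ) (K := K)
    ⟨by linarith, by linarith⟩ (fun t ht => (hK t ht).1) (fun t ht => (hK t ht).2.1)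
    (fun t ht => (hK t ht).2.2.1) (fun t ht => (hK t ht).2.2.2)
    (fun t ht => by
      have h1 := hasDerivAt_line_t (differentiableAt_of_smooth sw (hρD (hl t ht)))
      rwa [v1 _ (hρD (hl t ht))] at h1)
    (fun t ht => by
      have h1 := hasDerivAt_line_t (differentiableAt_of_smooth sb (hρD (hl t ht)))
      rwa [v2 _ (hρD (hl t ht))] at h1) hw0 hb0
  have hI : ∀ p ∈ ballOpens p₀ ρ, p.1 ∈ Ioo (p₀.1 - ρ) (p₀.1 + ρ) := fun p hp => by
    rw [← Real.ball_eq_Ioo]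
    exact (mem_plane_ball.1 hp).1
  have hb0' : ∀ p ∈ ballOpens p₀ ρ, b p = 0 := fun p hp => by
    rw [eq_of_dx_zero (sb.mono hρD) (fun q hq => v4 q (hρD hq)) hp]
    exact (hline p.1 (hI p hp)).2
  refine smoothAlg_ext fun p hp => ?_
  change w p = 0
  rw [eq_of_dx_zero (sw.mono hρD) (fun q hq => by rw [v3 q (hρD hq), hb0' q hq]) hp]
  exact (hline p.1 (hI p hp)).1

/-- Functional dependence: if the gradients of `k` and `θ` are parallel and `θ_x` does not vanish,
then locally `k` is a smooth function of `θ`. -/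
theorem exists_function_of {p₀ : Plane} {r : ℝ} (hr : 0 < r) {θ k : Plane → ℝ}
    (sθ : ContDiffOn ℝ ∞ θ (ballOpens p₀ r)) (sk : ContDiffOn ℝ ∞ k (ballOpens p₀ r))
    (hθ : ∀ p ∈ ballOpens p₀ r, dx θ p ≠ 0)
    (hk : ∀ p ∈ ballOpens p₀ r, dt k p * dx θ p = dx k p * dt θ p) :
    ∃ ρ, 0 < ρ ∧ ρ ≤ r ∧ ∃ (I : Set ℝ) (h : ℝ → ℝ), IsOpen I ∧ ContDiffOn ℝ ∞ h I ∧
      ∀ p ∈ ballOpens p₀ ρ, θ p ∈ I ∧ k p = h (θ p) := by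
  set D := ballOpens p₀ r
  have hp₀ : p₀ ∈ D := mem_ballOpens_self hr
  -- in the coordinates `(t, θ)`, the function `k` does not depend on `t`
  let Φ : Plane → Plane := fun p => (p.1, θ p)
  have sΦ : ContDiffOn ℝ ∞ Φ D := contDiffOn_fst.prodMk sθ
  have hΦ : ∀ p ∈ D, ∃ L : Plane ≃L[ℝ] Plane, HasFDerivAt Φ (L : Plane →L[ℝ] Plane) p := by
    intro p hp
    have h1 : HasFDerivAt Φ ((ContinuousLinearMap.fst ℝ ℝ ℝ).prod (fderiv ℝ θ p)) p :=
      hasFDerivAt_fst.prodMk (differentiableAt_of_smooth sθ hp).hasFDerivAt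
    have hne := hθ p hp
    refine ⟨(LinearEquiv.ofBijective
      ((ContinuousLinearMap.fst ℝ ℝ ℝ).prod (fderiv ℝ θ p)).toLinearMap
      ⟨?_, ?_⟩).toContinuousLinearEquiv, ?_⟩
    · rw [← LinearMap.ker_eq_bot, LinearMap.ker_eq_bot']
      intro v hv
      have e1 : v.1 = 0 := congrArg Prod.fst hv
      have e2 : fderiv ℝ θ p v = 0 := congrArg Prod.snd hv
      rw [fderiv_plane, e1, zero_mul, zero_add] at e2
      exact Prod.ext e1 ((mul_eq_zero.1 e2).resolve_right hne)
    · intro v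
      refine ⟨(v.1, (v.2 - v.1 * dt θ p) / dx θ p), ?_⟩
      refine Prod.ext rfl ?_
      change fderiv ℝ θ p _ = v.2
      rw [fderiv_plane]
      field_simp
      ring
    · exact h1
  obtain ⟨L, hL⟩ := hΦ p₀ hp₀
  have hs : HasStrictFDerivAt Φ (L : Plane →L[ℝ] Plane) p₀ :=
    (sΦ.contDiffAt (D.isOpen.mem_nhds hp₀)).hasStrictFDerivAt' hL (by simp)
  set e := (hs.toOpenPartialHomeomorph Φ).restrOpen D D.isOpen with he
  have heΦ : ∀ p, e p = Φ p := fun p => rfl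
  have heD : ∀ p ∈ e.source, p ∈ D := fun p hp => hp.2
  have hp0 : p₀ ∈ e.source := ⟨hs.mem_toOpenPartialHomeomorph_source, hp₀⟩
  have hsymm : ContDiffOn ℝ ∞ e.symm e.target := by
    intro q hq
    have hq' := heD _ (e.map_target hq)
    obtain ⟨L, hL⟩ := hΦ _ hq'
    exact (e.contDiffAt_symm hq hL (sΦ.contDiffAt (D.isOpen.mem_nhds hq'))).contDiffWithinAt
  obtain ⟨ε, hε, hεt⟩ := Metric.isOpen_iff.1 e.open_target _ (e.map_source hp0)
  have hΦ0 : e p₀ = (p₀.1, θ p₀) := rfl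
  have hmem : ∀ τ ∈ ball p₀.1 ε, ∀ s ∈ ball (θ p₀) ε, ((τ, s) : Plane) ∈ e.target :=
    fun τ hτ s hs => hεt (mem_plane_ball.2 ⟨hτ, hs⟩)
  -- along the level curves of `θ`, `k` is constant
  have hconst : ∀ s ∈ ball (θ p₀) ε, ∀ τ ∈ ball p₀.1 ε,
      k (e.symm (τ, s)) = k (e.symm (p₀.1, s)) := by
    intro s hs τ hτ
    have hd : ∀ τ ∈ ball p₀.1 ε, HasDerivAt (fun τ => k (e.symm (τ, s))) 0 τ := by
      intro τ hτ
      have ht := hmem τ hτ s hs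
      have hD := heD _ (e.map_target ht)
      have hγ : HasDerivAt (fun τ => e.symm (τ, s)) (fderiv ℝ e.symm (τ, s) (1, 0)) τ :=
        HasFDerivAt.comp_hasDerivAt (f := fun τ : ℝ => ((τ, s) : Plane)) τ
          ((hsymm.contDiffAt (e.open_target.mem_nhds ht)).differentiableAt
            (by simp)).hasFDerivAt ((hasDerivAt_id _).prodMk (hasDerivAt_const _ _))
      set v := fderiv ℝ e.symm (τ, s) (1, 0)
      have hev : ∀ᶠ τ' in nhds τ, Φ (e.symm (τ', s)) = (τ', s) := by
        filter_upwards [isOpen_ball.mem_nhds hτ] with τ' hτ'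
        exact e.right_inv (hmem τ' hτ' s hs)
      have h1 : v.1 = 1 := by
        have a1 : HasDerivAt (fun τ => (e.symm (τ, s)).1) v.1 τ := hγ.fst
        exact a1.unique ((hasDerivAt_id τ).congr_of_eventuallyEq
          (hev.mono fun τ' h => congrArg Prod.fst h))
      have h2 : fderiv ℝ θ (e.symm (τ, s)) v = 0 := by
        have a1 : HasDerivAt (fun τ => θ (e.symm (τ, s))) (fderiv ℝ θ (e.symm (τ, s)) v) τ :=
          HasFDerivAt.comp_hasDerivAt (f := fun τ => e.symm (τ, s)) τ
            (differentiableAt_of_smooth sθ hD).hasFDerivAt hγ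
        exact a1.unique ((hasDerivAt_const τ s).congr_of_eventuallyEq
          (hev.mono fun τ' h => congrArg Prod.snd h))
      have h3 : HasDerivAt (fun τ => k (e.symm (τ, s))) (fderiv ℝ k (e.symm (τ, s)) v) τ :=
        HasFDerivAt.comp_hasDerivAt (f := fun τ => e.symm (τ, s)) τ
          (differentiableAt_of_smooth sk hD).hasFDerivAt hγ
      have h4 : fderiv ℝ k (e.symm (τ, s)) v = 0 := by
        have hk' := hk _ hD
        rw [fderiv_plane, h1, one_mul] at h2 ⊢
        refine (mul_eq_zero.1 (?_ : dx θ (e.symm (τ, s)) * _ = 0)).resolve_left (hθ _ hD)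
        linear_combination hk' + dx k (e.symm (τ, s)) * h2
      rwa [h4] at h3
    exact isOpen_ball.is_const_of_deriv_eq_zero (convex_ball p₀.1 ε).isPreconnected
      (fun s hs => (hd s hs).differentiableAt.differentiableWithinAt) (fun s hs => (hd s hs).deriv)
      hτ (mem_ball_self hε)
  have hcont : ContinuousAt Φ p₀ := hL.continuousAt
  obtain ⟨ρ, hρ, hb⟩ := Metric.eventually_nhds_iff_ball.1
    ((e.open_source.eventually_mem hp0).and (hcont (ball_mem_nhds _ hε)))
  refine ⟨min ρ r, lt_min hρ hr, min_le_right _ _, ball (θ p₀) ε, fun s => k (e.symm (p₀.1, s)),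
    isOpen_ball, ?_, fun p hp => ?_⟩
  · have h1 : ContDiffOn ℝ ∞ (fun s => e.symm (p₀.1, s)) (ball (θ p₀) ε) :=
      hsymm.comp (by fun_prop) fun s hs => hmem _ (mem_ball_self hε) s hs
    exact sk.comp h1 fun s hs => heD _ (e.map_target (hmem _ (mem_ball_self hε) s hs))
  · obtain ⟨h1, h2⟩ := hb p (ball_subset_ball (min_le_left _ _) hp)
    have h2 := mem_plane_ball.1 h2
    refine ⟨h2.2, ?_⟩
    have h3 : e.symm (p.1, θ p) = p := e.left_inv h1
    change _ = k (e.symm (p₀.1, θ p))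
    rw [← hconst _ h2.2 _ h2.1]
    change _ = k (e.symm (p.1, θ p))
    rw [h3]

/-! ### Reconstruction of the potential `θ` -/

section InertialAlgebra

variable {R S : Type*} [CommRing R] [Algebra ℝ R] [CommRing S] [Algebra ℝ S]
  {T X : Derivation ℝ R R} {T' X' : Derivation ℝ S S}

/-- A projective transformation of the independent variables reduces the case `w = 0` to the case
`a = 0`. -/
theorem AffineSystem.projective {f x a c d y : R} (h : AffineSystem T X f x a 0) (φ : R →ₐ[ℝ] S)
    (hX : ∀ q, X' (φ q) = φ (d * X q)) (hT : ∀ q, T' (φ q) = φ (d ^ 2 * T q - c * y * d * X q))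
    (hXd : X d = 0) (hTd : T d = -c) (hXy : X y = 1) (hTy : T y = 0) (hXc : X c = 0)
    (hTc : T c = 0) (had : a * d = c) :
    T' (φ f) + φ (d * x + c * y) * X' (φ f) = φ f * X' (φ (d * x + c * y)) ∧
      T' (φ (d * x + c * y)) + φ (d * x + c * y) * X' (φ (d * x + c * y))
        + φ f * X' (X' (φ (d * x + c * y))) = 0 := by
  simp only [hX, hT, ← map_mul, ← map_add]
  constructor
  · refine congrArg φ ?_
    simp only [map_add, der_mul, hXd, hXy, hXc]
    linear_combination d ^ 2 * h.hf + f * d * had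
  · rw [← map_zero φ]
    refine congrArg φ ?_
    simp only [map_add, der_mul, hXd, hTd, hXy, hTy, hXc, hTc, map_zero,
      Derivation.map_one_eq_zero]
    linear_combination -d ^ 3 * h.hw

/-- The form `θ_t dt + θ_x dx` with `θ_x = F = -1 / f` and `θ_t = -x F` is closed. -/
theorem potential_flat {f x F : R} (hF : f * F = -1) (h1 : T f + x * X f = f * X x) :
    X (-x * F) = T F := by
  have e1 := congrArg X hF
  have e2 := congrArg T hF
  simp only [der_mul, map_neg, Derivation.map_one_eq_zero] at e1 e2
  rw [der_mul, map_neg]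
  linear_combination (F * x) * e1 + F * e2 - F ^ 2 * h1 + (-(X x * F) - x * X F - T F) * hF

/-- The function `-(x + f_x)` is constant along the field `∂_t + x ∂_x`, as `θ` is. -/
theorem transport_of_inertial (hTX : ∀ a, T (X a) = X (T a)) {f x : R}
    (h1 : T f + x * X f = f * X x) (h2 : T x + x * X x + f * X (X x) = 0) :
    T (-(x + X f)) = -x * X (-(x + X f)) := by
  have e1 := congrArg X h1
  simp only [map_add, der_mul] at e1
  simp only [map_neg, map_add, hTX]
  linear_combination -h2 - e1

end InertialAlgebra

/-- The determining equations for an operator `∂_t + x ∂_x`, where `x` stands for its coefficient,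
are solved locally by a potential `θ`. -/
theorem exists_theta {p₀ : Plane} {r : ℝ} (hr : 0 < r) {f x : smoothAlg (ballOpens p₀ r)}
    (hf : ∀ p hp, val f p hp ≠ 0) (h1 : dt' _ f + x * dx' _ f = f * dx' _ x)
    (h2 : dt' _ x + x * dx' _ x + f * dx' _ (dx' _ x) = 0) :
    ∃ ρ, 0 < ρ ∧ ∃ (hρr : ρ ≤ r) (θ : Plane → ℝ) (I : Set ℝ) (h : ℝ → ℝ),
      ContDiffOn ℝ ∞ θ (ball p₀ ρ) ∧ IsOpen I ∧ ContDiffOn ℝ ∞ h I ∧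
      ∀ p (hp : p ∈ ballOpens p₀ ρ), dx θ p ≠ 0 ∧ θ p ∈ I ∧
        dt θ p = dx (dx θ) p / dx θ p + h (θ p) * dx θ p ∧
        val f p (ballOpens_mono hρr hp) = -1 / dx θ p ∧
        val x p (ballOpens_mono hρr hp) = -(dt θ p / dx θ p) := by
  obtain ⟨F, hF⟩ : ∃ F, f * F = -1 := by
    obtain ⟨b, hb⟩ := exists_inv f hf
    exact ⟨-b, by rw [mul_neg, hb]⟩
  have hflat := potential_flat hF h1
  have htr := transport_of_inertial (dir_comm _ _) h1 h2
  -- `θ` is the first component of the section `(θ, 1)`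
  obtain ⟨ρ₁, hρ₁, hρ₁r, ψ, hψ0, hψ⟩ := exists_parallel_alg hr
    (!![0, -x * F; 0, 0]) (!![0, F; 0, 0]) (fun i j => by
      fin_cases i <;> fin_cases j <;> simp [Fin.sum_univ_two]
      simpa using hflat) ![0, 1]
  have hψ1 : ψ 1 = 1 := smoothAlg_ext fun p hp => by
    rw [eq_of_derivatives_zero hρ₁ (by simpa [Fin.sum_univ_two] using (hψ 1).1)
      (by simpa [Fin.sum_univ_two] using (hψ 1).2), hψ0]
    simp
  have hx : dx' _ (ψ 0) = restrict (ballOpens_mono hρ₁r) F := by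
    simpa [Fin.sum_univ_two, hψ1] using (hψ 0).2
  have ht : dt' _ (ψ 0) = -restrict (ballOpens_mono hρ₁r) x * restrict (ballOpens_mono hρ₁r) F := by
    simpa [Fin.sum_univ_two, hψ1] using (hψ 0).1
  obtain ⟨θ, sθ, hθ⟩ := exists_sm (ψ 0)
  rw [hθ] at hx ht
  obtain ⟨k, sk, hk⟩ := exists_sm (-(x + dx' _ f))
  have hxx : f * dx' _ F = -F * dx' _ f := by
    have := congrArg (dx' _) hF
    rw [der_mul, map_neg, Derivation.map_one_eq_zero] at this
    linear_combination this
  rw [hk] at htr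
  have hle : ballOpens p₀ ρ₁ ≤ ballOpens p₀ r := ballOpens_mono hρ₁r
  have vx : ∀ p (hp : p ∈ ballOpens p₀ ρ₁), dx θ p = val F p (hle hp) := fun p hp => by
    simpa using congrArg (fun c => val c p hp) hx
  have vt : ∀ p (hp : p ∈ ballOpens p₀ ρ₁), dt θ p = -val x p (hle hp) * val F p (hle hp) :=
    fun p hp => by simpa using congrArg (fun c => val c p hp) ht
  have vF : ∀ p hp, val f p hp * val F p hp = -1 := fun p hp =>
    congrArg (fun c => val c p hp) hF
  have hne : ∀ p hp, val F p hp ≠ 0 := fun p hp h => by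
    have := vF p hp
    rw [h, mul_zero] at this
    norm_num at this
  obtain ⟨ρ, hρ, hρρ₁, I, h, hI, sh, hh⟩ := exists_function_of hρ₁ sθ (sk.mono hle)
    (fun p hp => by rw [vx p hp]; exact hne _ _) (fun p hp => by
      have := congrArg (fun c => val c p (hle hp)) htr
      simp only [dt'_sm, dx'_sm, val_sm, val_mul, val_neg] at this
      rw [vx p hp, vt p hp, this]
      ring)
  refine ⟨ρ, hρ, hρρ₁.trans hρ₁r, θ, I, h, sθ.mono (ball_subset_ball hρρ₁), hI, sh,
    fun p hp => ?_⟩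
  have hp₁ : p ∈ ballOpens p₀ ρ₁ := ballOpens_mono hρρ₁ hp
  have e1 := vF p (hle hp₁)
  have e2 := hne p (hle hp₁)
  refine ⟨by rw [vx p hp₁]; exact e2, (hh p hp).1, ?_, ?_, ?_⟩
  · have hxx' : dx (dx θ) p = val (dx' _ F) p (hle hp₁) := by
      have := congrArg (dx' _) hx
      rw [dir_restrict] at this
      simpa using congrArg (fun c => val c p hp₁) this
    have e3 := congrArg (fun c => val c p (hle hp₁)) hxx
    have e4 := congrArg (fun c => val c p (hle hp₁)) hk
    simp only [val_mul, val_neg, val_add, val_sm] at e3 e4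
    rw [← (hh p hp).2, ← e4, hxx', vx p hp₁, vt p hp₁]
    have e5 : val (dx' _ F) p (hle hp₁) =
        val F p (hle hp₁) ^ 2 * val (dx' _ f) p (hle hp₁) := by
      linear_combination (-val F p (hle hp₁)) * e3 + val (dx' _ F) p (hle hp₁) * e1
    rw [e5]
    field_simp
    ring
  · rw [vx p hp₁, eq_div_iff e2]
    exact e1
  · rw [vx p hp₁, vt p hp₁]
    field_simp

/-! ### The projective transformation -/

theorem smooth_denom (g : EquivTransf) (D : Set Plane) :
    ContDiffOn ℝ ∞ (fun p : Plane => g.denom p.1) D := by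
  unfold EquivTransf.denom
  fun_prop

/-- The denominator of a transformation, as a function of `(t, x)`. -/
noncomputable def denomAlg (g : EquivTransf) (D : Opens Plane) : smoothAlg D :=
  sm _ (smooth_denom g D)

/-- The coordinate function `x`. -/
noncomputable def xAlg (D : Opens Plane) : smoothAlg D :=
  sm (fun p => p.2) (by fun_prop)

theorem dir_denomAlg (g : EquivTransf) {D : Opens Plane} (v : Plane) :
    dir v (denomAlg g D) = algebraMap ℝ _ (g.γ * v.1) := by
  refine smoothAlg_ext fun p hp => ?_
  have : HasFDerivAt (fun q : Plane => g.γ * q.1 + g.δ) _ p :=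
    ((hasFDerivAt_fst (𝕜 := ℝ) (p := p)).const_mul g.γ).add_const _
  rw [denomAlg, dir_sm]
  exact congrArg (fun L => L v) this.fderiv

theorem dir_xAlg {D : Opens Plane} (v : Plane) : dir v (xAlg D) = algebraMap ℝ _ v.2 := by
  refine smoothAlg_ext fun p hp => ?_
  have : HasFDerivAt (fun q : Plane => q.2) (ContinuousLinearMap.snd ℝ ℝ ℝ) p := hasFDerivAt_snd
  rw [xAlg, dir_sm]
  exact congrArg (fun L => L v) this.fderiv

namespace EquivTransf

theorem denom_inv_planeMap (g : EquivTransf) {p : Plane} (hd : g.inv.denom p.1 ≠ 0) :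
    g.denom (g.inv.planeMap p).1 = g.det / g.inv.denom p.1 := by
  have e : (g.inv.planeMap p).1 * g.inv.denom p.1 = g.δ * p.1 - g.β := by
    rw [planeMap, div_mul_cancel₀ _ hd]
    simp only [inv]
    ring
  rw [eq_div_iff hd]
  have e' : g.inv.denom p.1 = -g.γ * p.1 + g.α := rfl
  simp only [denom, det] at e e' ⊢
  linear_combination g.γ * e + g.δ * e'

/-- The transformation with `t̃ = (t - t₀) / (1 - a₀ (t - t₀))` and `x̃ = x / (1 - a₀ (t - t₀))`. -/
def projective (t₀ a₀ : ℝ) : EquivTransf :=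
  ⟨1, -t₀, -a₀, 1 + a₀ * t₀, 1, 0, 0, by ring_nf; exact one_ne_zero, one_ne_zero⟩

section Projective

variable (t₀ a₀ : ℝ)

theorem det_projective : (projective t₀ a₀).det = 1 := by
  simp only [projective, det]
  ring

theorem κ_inv_projective : (projective t₀ a₀).inv.κ = 1 := by
  change (projective t₀ a₀).det / 1 = 1
  rw [det_projective, div_one]

variable {t₀ a₀} {D D' : Opens Plane} (hd : ∀ p ∈ D, (projective t₀ a₀).inv.denom p.1 ≠ 0)
  (h : Set.MapsTo (projective t₀ a₀).inv.planeMap D D')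

include hd in
theorem denom_inv_projective {p : Plane} (hp : p ∈ D) :
    1 / (projective t₀ a₀).inv.denom p.1
      = (projective t₀ a₀).denom ((projective t₀ a₀).inv.planeMap p).1 := by
  rw [denom_inv_planeMap _ (hd p hp), det_projective]

theorem dx'_pullback_projective (q : smoothAlg D') :
    dx' D ((projective t₀ a₀).inv.pullback hd h q)
      = (projective t₀ a₀).inv.pullback hd h (denomAlg (projective t₀ a₀) D' * dx' D' q) := by
  refine smoothAlg_ext fun p hp => ?_
  have hκ := κ_inv_projective t₀ a₀
  rw [val_dx'_pullback, hκ, denom_inv_projective hd hp]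
  rfl

theorem dt'_pullback_projective (q : smoothAlg D') :
    dt' D ((projective t₀ a₀).inv.pullback hd h q) = (projective t₀ a₀).inv.pullback hd h
      (denomAlg (projective t₀ a₀) D' ^ 2 * dt' D' q
        - algebraMap ℝ _ a₀ * xAlg D' * denomAlg (projective t₀ a₀) D' * dx' D' q) := by
  refine smoothAlg_ext fun p hp => ?_
  have hΔ : (projective t₀ a₀).inv.det = 1 := by
    simp only [inv, projective, det]
    ring
  have hs : (projective t₀ a₀).inv.shift p.2 = -a₀ * p.2 := by
    rw [shift, κ_inv_projective]
    simp [inv, projective]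
  have hx : ((projective t₀ a₀).inv.planeMap p).2
      = p.2 * (1 / (projective t₀ a₀).inv.denom p.1) := by
    rw [planeMap, κ_inv_projective, mul_one_div]
    simp [inv, projective]
  have hd1 := denom_inv_projective hd hp
  rw [val_dt'_pullback, hΔ, hs]
  change _ = (projective t₀ a₀).denom ((projective t₀ a₀).inv.planeMap p).1 ^ 2
      * val (dt' D' q) _ (h hp)
    - a₀ * ((projective t₀ a₀).inv.planeMap p).2
      * (projective t₀ a₀).denom ((projective t₀ a₀).inv.planeMap p).1 * val (dx' D' q) _ (h hp)
  rw [hx, ← hd1]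
  ring

end Projective

end EquivTransf

/-- If `w = 0`, then a projective transformation maps the operator to one with the coefficient
`0` of `∂_u`, whose coefficient of `∂_x` is `-θ_t / θ_x`. -/
theorem locallyListed_of_zero {P₀ : Space} {r : ℝ} (hr : 0 < r) {f : Plane → ℝ} {Q : VField}
    (hτ : ContDiffOn ℝ ∞ Q.τ (ballOpens P₀ r)) (hτ0 : ∀ P ∈ ballOpens P₀ r, Q.τ P ≠ 0)
    {F x a : smoothAlg (ballOpens (proj P₀) r)} (hF0 : ∀ p hp, val F p hp ≠ 0)
    (h : AffineSystem (dt' _) (dx' _) F x a 0) (hF : ∀ p hp, f p = val F p hp)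
    (hξ : ∀ P (_ : P ∈ ballOpens P₀ r) hp, Q.ξ P / Q.τ P = val x (proj P) hp)
    (hη : ∀ P (_ : P ∈ ballOpens P₀ r) hp,
      Q.η P / Q.τ P = val a (proj P) hp * (P.2.2 - val x (proj P) hp)) :
    LocallyListed f Q (ballOpens P₀ r) P₀ := by
  obtain ⟨a₀, ha₀⟩ : ∃ a₀, a₀ = val a (proj P₀) (mem_ballOpens_self hr) := ⟨_, rfl⟩
  set g := EquivTransf.projective P₀.1 a₀ with hg
  have hgΔ : g.det = 1 := EquivTransf.det_projective _ _
  have hgκ : g.κ = 1 := rfl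
  have hgγ : g.γ = -a₀ := rfl
  have hgs : ∀ x, g.shift x = a₀ * x := fun x => by
    simp [hg, EquivTransf.shift, EquivTransf.projective]
  have hgd₀ : g.denom P₀.1 = 1 := by
    simp only [hg, EquivTransf.denom, EquivTransf.projective]
    ring
  have hXc : ∀ {D : Opens Plane} (v : Plane) (c : ℝ), dir v (algebraMap ℝ (smoothAlg D) c) = 0 :=
    fun v c => Derivation.map_algebraMap _ _
  -- `a d = a₀`, since both sides coincide at the centre and `(a d - a₀)_t = a (a d - a₀)`
  have haa : dt' _ a = a ^ 2 := by
    have := h.hXw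
    rw [map_zero] at this
    linear_combination this
  obtain ⟨ρ₁, hρ₁, hρ₁r, had⟩ := exists_ball_eq_zero hr
    (w := a * denomAlg g _ - algebraMap ℝ _ a₀) (b := 0) (α := a) (β := 0) (γ := 0) (δ := 0)
    (by
      rw [map_sub, der_mul, haa, dir_denomAlg, hXc, hgγ, mul_one, map_neg]
      ring) (by simp)
    (by rw [map_sub, der_mul, h.ha, dir_denomAlg, hXc]; simp)
    (by simp) (by
      change val a _ _ * g.denom P₀.1 - a₀ = 0
      rw [hgd₀, ← ha₀, mul_one, sub_self]) rfl
  have hle : ballOpens (proj P₀) ρ₁ ≤ ballOpens (proj P₀) r := ballOpens_mono hρ₁r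
  obtain ⟨r', hr', hd', hm'⟩ := g.exists_ball (mem_ballOpens_self (p := proj P₀) hρ₁)
    (by change g.denom P₀.1 ≠ 0; rw [hgd₀]; exact one_ne_zero)
  have hsys := (h.restrict hle)
  rw [map_zero] at hsys
  obtain ⟨t1, t2⟩ := hsys.projective (d := denomAlg g _) (c := algebraMap ℝ _ a₀) (y := xAlg _)
    (g.inv.pullback hd' hm')
    (EquivTransf.dx'_pullback_projective hd' hm') (EquivTransf.dt'_pullback_projective hd' hm')
    (by simp [dir_denomAlg]) (by simp [dir_denomAlg, hgγ]) (by simp [dir_xAlg]) (by simp [dir_xAlg])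
    (hXc _ _) (hXc _ _) (by
      rw [map_sub, map_mul, sub_eq_zero] at had
      exact had)
  obtain ⟨f', sf', hf'⟩ := exists_sm (g.inv.pullback hd' hm' (restrict hle F))
  obtain ⟨ρ, hρ, hρr, θ, I, k, sθ, hI, sk, hθ⟩ := exists_theta hr'
    (fun p hp => hF0 _ (hle (hm' hp))) t1 t2
  have hρf : ∀ p ∈ ball (g.planeMap (proj P₀)) ρ, p ∈ ballOpens (g.planeMap (proj P₀)) r' :=
    fun p hp => ballOpens_mono hρr hp
  have hf'' : ∀ p hp, val (g.inv.pullback hd' hm' (restrict hle F)) p hp = f' p := fun p hp => by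
    rw [hf', val_sm]
  obtain ⟨V, hV, hPV, hVU, hVd, hVm⟩ := g.exists_domain (ballOpens P₀ r).isOpen
    (isOpen_cylinder (g.planeMap (proj P₀)) ρ) (mem_ballOpens_self hr)
    (by rw [hgd₀]; exact one_ne_zero) (mem_ball_self hρ)
  -- the relation `a d = a₀` is available only over the ball of the radius `ρ₁`
  obtain ⟨W, hW, hPW, hWV, hWp⟩ : ∃ W, IsOpen W ∧ P₀ ∈ W ∧ W ⊆ V ∧ ∀ P ∈ W, proj P ∈
      ballOpens (proj P₀) ρ₁ :=
    ⟨V ∩ cylinder (proj P₀) ρ₁, hV.inter (isOpen_cylinder _ _), ⟨hPV, mem_ball_self hρ₁⟩,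
      Set.inter_subset_left, fun P hP => hP.2⟩
  have hval : ∀ P (hP : P ∈ W) (b : smoothAlg (ballOpens (proj P₀) ρ₁)) hp,
      val (g.inv.pullback hd' hm' b) (g.planeMap (proj P)) hp = val b (proj P) (hWp P hP) :=
    fun P hP b hp => val_congr b (g.inv_planeMap (p := proj P) (hVd P (hWV hP))) _ _
  refine ⟨g, W, f', normalField (fun P => -(dt θ (proj P) / dx θ (proj P))) fun _ => 0,
    cylinder (g.planeMap (proj P₀)) ρ, hW, hPW, hWV.trans hVU, isOpen_cylinder _ _, ?_, ?_,
    Or.inr (Or.inr (Or.inl ⟨θ, I, k, ?_⟩))⟩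
  · rw [base_cylinder]
    exact ⟨sf'.mono hρf, fun p hp => by
      rw [← hf'' p (hρf p hp)]
      exact hF0 _ (hle (hm' (hρf p hp)))⟩
  · refine g.carries_of (fun P hP => hVd P (hWV hP)) (fun P hP => hVm (hWV hP)) ?_
      (hτ.mono (hWV.trans hVU)) (fun P hP => hτ0 P (hVU (hWV hP)))
      contDiffOn_const (fun _ _ => one_ne_zero) ?_ ?_
    · rintro _ ⟨P, hP, rfl⟩
      have hm : g.planeMap (proj P) ∈ ball (g.planeMap (proj P₀)) ρ := hVm (hWV hP)
      have : g.factor = 1 := by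
        rw [EquivTransf.factor, hgκ, show g.α * g.δ - g.β * g.γ = 1 from hgΔ]
        norm_num
      change f' (g.planeMap (proj P)) = g.factor * f (proj P)
      rw [this, one_mul, ← hf'' _ (hρf _ hm), hval P hP, hF _ (hle (hWp P hP))]
      rfl
    · intro P hP
      have hm : g.planeMap (proj P) ∈ ball (g.planeMap (proj P₀)) ρ := hVm (hWV hP)
      have := (hθ _ hm).2.2.2.2
      rw [hval P hP] at this
      rw [hξ P (hVU (hWV hP)) (hle (hWp P hP)), hgκ, hgs, hgΔ]
      change -(dt θ (g.planeMap (proj P)) / dx θ (g.planeMap (proj P))) = 1 * _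
      rw [← this]
      change g.denom P.1 * val x (proj P) _ + a₀ * P.2.1 = _
      ring
    · intro P hP
      have := congrArg (fun c => val c (proj P) (hWp P hP)) had
      have : val a (proj P) (hle (hWp P hP)) * g.denom P.1 - a₀ = 0 := this
      rw [hη P (hVU (hWV hP)) (hle (hWp P hP)), hξ P (hVU (hWV hP)) (hle (hWp P hP)), hgγ]
      change (0 : ℝ) = 1 * _
      rw [hgκ, hgΔ]
      linear_combination -g.denom P.1 ^ 2
        * (P.2.2 - val x (proj P) (hle (hWp P hP))) * this
  · rw [base_cylinder]
    refine ⟨sθ, hI, sk, fun p hp => ?_, fun P hP => ⟨rfl, rfl, rfl⟩⟩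
    obtain ⟨h1, h2, h3, h4, -⟩ := hθ p hp
    exact ⟨h1, h2, h3, by rw [← h4, hf'']⟩

/-! ### The classification -/

/-- If `ξ` does not depend on `u` and `ξ_xx = 0`, then a multiple of the operator that does not
depend on `u` is a Lie symmetry operator. -/
theorem locallyListed_of_affine {P₀ : Space} {r : ℝ} (hr : 0 < r) {f : Plane → ℝ} {Q : VField}
    (hf : InClass f (baseOpens (ballOpens P₀ r)))
    (h : IsRegularReductionOperator f Q (ballOpens P₀ r))
    (hs : ∀ P ∈ ballOpens P₀ r, pu (fun P => Q.ξ P / Q.τ P) P = 0)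
    {F x a w : smoothAlg (ballOpens (proj P₀) r)}
    (hA : AffineSystem (dt' _) (dx' _) F x a w) (hxx : dx' _ (dx' _ x) = 0)
    (hξ : ∀ P (_ : P ∈ ballOpens P₀ r) hp,
      px (fun P => Q.ξ P / Q.τ P) P = val (dx' _ x) (proj P) hp)
    (hη : ∀ P (_ : P ∈ ballOpens P₀ r) hp, pu (fun P => Q.η P / Q.τ P) P = val a (proj P) hp) :
    LocallyListed f Q (ballOpens P₀ r) P₀ := by
  obtain ⟨ρ, hρ, hρr, m, hm, hmx, hmt⟩ := exists_multiplier hr hA hxx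
  have hle : ballOpens P₀ ρ ≤ ballOpens P₀ r := ballOpens_mono hρr
  have hf' := hf.mono (base_mono hle)
  have h' := h.mono hle
  obtain ⟨sξ, sη, hdet⟩ := determining_of_regular hf' h'
  have hb : baseOpens (ballOpens P₀ ρ) ≤ ballOpens (proj P₀) ρ := (baseOpens_ball P₀ hρ).le
  obtain ⟨m', hmv, sm', hL⟩ := lie_of_multiplier hf' hdet (m := restrict hb m)
    (smoothAlg_ext fun P hP => by
      rw [dU_sm]
      exact hs P (hle hP))
    (by rw [dir_restrict, hmx, map_zero])
    (smoothAlg_ext fun P hP => by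
      have e := congrArg (fun c => val c (proj P) (hb (proj_mem hP))) hmt
      simp only [val_mul, val_sub, val_lift, dX_sm, dU_sm, val_sm, dir_restrict, val_restrict]
        at e ⊢
      rw [e, hξ P (hle hP) (ballOpens_mono hρr (hb (proj_mem hP))),
        hη P (hle hP) (ballOpens_mono hρr (hb (proj_mem hP)))])
  have hm0 : ∀ P ∈ ballOpens P₀ ρ, m' P ≠ 0 := fun P hP => by
    rw [hmv P hP]
    exact hm _ _
  exact ⟨EquivTransf.refl, ballOpens P₀ ρ, f, scaledField m' (fun P => Q.ξ P / Q.τ P)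
    (fun P => Q.η P / Q.τ P), ballOpens P₀ ρ, (ballOpens P₀ ρ).isOpen, mem_ballOpens_self hρ, hle,
    (ballOpens P₀ ρ).isOpen, hf', EquivTransf.carries_refl h'.1.1 h'.2.1 sm' hm0
      (fun _ _ => rfl) (fun _ _ => rfl), Or.inr (Or.inl ⟨hL, hm0⟩)⟩

/-- If `ξ_u = 0`, then the operator comes from a potential `θ` near the points where `w` and `w_x`
vanish, and from a Lie symmetry operator near all other points. -/
theorem locallyListed_of_slope_zero {P₀ : Space} {r : ℝ} (hr : 0 < r) {f : Plane → ℝ} {Q : VField}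
    (hf : InClass f (baseOpens (ballOpens P₀ r)))
    (h : IsRegularReductionOperator f Q (ballOpens P₀ r))
    (hs : ∀ P ∈ ballOpens P₀ r, pu (fun P => Q.ξ P / Q.τ P) P = 0) :
    LocallyListed f Q (ballOpens P₀ r) P₀ := by
  obtain ⟨sξ, sη, hdet⟩ := determining_of_regular hf h
  obtain ⟨x, a, w, hA, eξ, eη⟩ := exists_affine hf hdet (by
    rw [dU_sm]
    exact smoothAlg_ext fun P hP => hs P hP)
  have hb : ballOpens (proj P₀) r ≤ baseOpens (ballOpens P₀ r) := (baseOpens_ball P₀ hr).ge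
  have hpx := congrArg (dX _) eξ
  have hpu := congrArg (dU _) eη
  rw [dX_sm, dX_lift] at hpx
  rw [dU_sm, map_add, der_mul, map_sub, dU_lift, dU_lift, dU_lift, (setting hf).hUu] at hpu
  have vξ : ∀ P (hP : P ∈ ballOpens P₀ r), Q.ξ P / Q.τ P = val x (proj P) (proj_mem hP) :=
    fun P hP => congrArg (fun c => val c P hP) eξ
  have vη : ∀ P (hP : P ∈ ballOpens P₀ r), Q.η P / Q.τ P = val a (proj P) (proj_mem hP)
      * (P.2.2 - val x (proj P) (proj_mem hP)) + val w (proj P) (proj_mem hP) :=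
    fun P hP => congrArg (fun c => val c P hP) eη
  have vpx : ∀ P (hP : P ∈ ballOpens P₀ r), px (fun P => Q.ξ P / Q.τ P) P
      = val (dx' _ x) (proj P) (proj_mem hP) := fun P hP => congrArg (fun c => val c P hP) hpx
  have vpu : ∀ P (hP : P ∈ ballOpens P₀ r), pu (fun P => Q.η P / Q.τ P) P
      = val a (proj P) (proj_mem hP) := fun P hP => by
    have := congrArg (fun c => val c P hP) hpu
    simpa using this
  have hA' := hA.restrict hb
  by_cases hw : val w (proj P₀) (proj_mem (mem_ballOpens_self hr)) = 0 ∧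
      val (dx' _ w) (proj P₀) (proj_mem (mem_ballOpens_self hr)) = 0
  · obtain ⟨ρ, hρ, hρr, hw0⟩ := exists_ball_eq_zero hr (w := restrict hb w)
      (b := dx' _ (restrict hb w))
      (α := 2 * restrict hb a - dx' _ (restrict hb x)) (β := -restrict hb x)
      (γ := -dx' _ (dx' _ (restrict hb x)))
      (δ := 2 * restrict hb a - 2 * dx' _ (restrict hb x))
      (by rw [hA'.hTw]; ring) (by rw [hA'.hTXw (dir_comm _ _)]; ring) rfl
      (hA'.hXXw (dir_comm _ _)) hw.1 (by
        rw [dir_restrict]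
        exact hw.2)
    have hle : ballOpens (proj P₀) ρ ≤ ballOpens (proj P₀) r := ballOpens_mono hρr
    have hle' : ballOpens P₀ ρ ≤ ballOpens P₀ r := ballOpens_mono hρr
    have hA'' := hA'.restrict hle
    rw [hw0] at hA''
    have hτ := h.mono hle'
    refine (locallyListed_of_zero (F := restrict hle (restrict hb (sm f hf.1))) hρ hτ.1.1 hτ.2.1
      (fun p hp => hf.2 _ (hb (hle hp))) hA'' (fun _ _ => rfl) (fun P hP hp => vξ P (hle' hP))
      fun P hP hp => ?_).mono hle'
    have := congrArg (fun c => val c (proj P) hp) hw0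
    have : val w (proj P) (proj_mem (hle' hP)) = 0 := this
    rw [vη P (hle' hP), this, add_zero]
    rfl
  · -- shrink the ball to make `w ^ 2 + w_x ^ 2` nonvanishing
    obtain ⟨ρ, hρ, hρr, hne⟩ := exists_ball_isUnit hr
      (restrict hb w ^ 2 + dx' _ (restrict hb w) ^ 2) (fun h0 => hw (by
        rw [dir_restrict] at h0
        simp only [val_add, val_pow, val_restrict] at h0
        constructor <;> nlinarith [sq_nonneg (val w (proj P₀) (proj_mem (mem_ballOpens_self hr))),
          sq_nonneg (val (dx' _ w) (proj P₀) (proj_mem (mem_ballOpens_self hr)))]))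
    have hle : ballOpens (proj P₀) ρ ≤ ballOpens (proj P₀) r := ballOpens_mono hρr
    have hle' : ballOpens P₀ ρ ≤ ballOpens P₀ r := ballOpens_mono hρr
    have hA'' := hA'.restrict hle
    refine (locallyListed_of_affine hρ (hf.mono (base_mono hle')) (h.mono hle')
      (fun P hP => hs P (hle' hP)) hA'' (hA''.affine fun p hp => ?_) (fun P hP hp => ?_)
      fun P hP hp => vpu P (hle' hP)).mono hle'
    · by_contra! h0
      refine hne p hp ?_
      rw [dir_restrict] at h0
      rw [map_add, map_pow, map_pow, val_add, val_pow, val_pow, h0.1, h0.2]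
      norm_num
    · rw [vpx P (hle' hP), dir_restrict, dir_restrict]
      rfl

theorem locallyListed {U : Opens Space} {f : Plane → ℝ} {Q : VField}
    (hf : InClass f (baseOpens U)) (h : IsRegularReductionOperator f Q U) {P : Space}
    (hP : P ∈ U) : LocallyListed f Q U P := by
  obtain ⟨r, hr, hrU, s, hs, hsP⟩ := exists_slope_ball hf h hP
  have hf' : InClass f (baseOpens (ballOpens P r)) := hf.mono (base_mono hrU)
  have h' : IsRegularReductionOperator f Q (ballOpens P r) := h.mono hrU
  refine LocallyListed.mono (U := ballOpens P r) ?_ hrU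
  rcases hs with rfl | rfl | rfl
  · exact locallyListed_of_slope_zero hr hf' h' hsP
  · exact locallyListed_of_slope_one hf' h' hsP (mem_ballOpens_self hr)
  · exact locallyListed_of_slope_neg_half hr hf' h' hsP

end GBE

theorem theorem2 :
    -- the transformations of the equivalence group map equations of the class to equations of it
    (∀ g : GBE.EquivTransf, g.PreservesClass) ∧
    -- all operators of the four families are regular reduction operators
    (∀ (f : GBE.Plane → ℝ) (Q : GBE.VField) (U : Set GBE.Space), IsOpen U →
      GBE.InClass f (GBE.base U) → GBE.IsListed f Q U →
      GBE.IsRegularReductionOperator f Q U) ∧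
    -- locally, each regular reduction operator is equivalent to one from the four families
    (∀ (f : GBE.Plane → ℝ) (Q : GBE.VField) (U : Set GBE.Space), IsOpen U →
      GBE.InClass f (GBE.base U) → GBE.IsRegularReductionOperator f Q U →
      ∀ P ∈ U, ∃ (g : GBE.EquivTransf) (V : Set GBE.Space)
        (f' : GBE.Plane → ℝ) (Q' : GBE.VField) (V' : Set GBE.Space),
        IsOpen V ∧ P ∈ V ∧ V ⊆ U ∧ IsOpen V' ∧ GBE.InClass f' (GBE.base V') ∧
        g.Carries f Q V f' Q' V' ∧ GBE.IsListed f' Q' V') ∧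
    -- the operators of the cubic form occur only for the classical Burgers equation
    (∀ (f : GBE.Plane → ℝ) (ξ0 η1 η0 : GBE.Plane → ℝ) (U : Set GBE.Space), IsOpen U →
      GBE.InClass f (GBE.base U) →
      GBE.IsRegularReductionOperator f (GBE.cubicOperator ξ0 η1 η0) U →
      ∀ p ∈ GBE.base U, f p = 1) ∧
    -- any nonzero constant value of `f` can be set to one
    (∀ c : ℝ, c ≠ 0 → ∃ g : GBE.EquivTransf, g.factor * c = 1) := by
  refine ⟨GBE.EquivTransf.preservesClass, fun f Q U hU hf h => ?_, fun f Q U hU hf h P hP => ?_,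
    fun f ξ0 η1 η0 U hU hf h => ?_, GBE.exists_factor⟩ <;>
    lift U to TopologicalSpace.Opens GBE.Space using hU
  · exact GBE.regular_of_listed hf h
  · exact GBE.locallyListed hf h hP
  · exact GBE.cubic_only_one hf h
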